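/- **Notation.** Let $R(u)=1+u^{-1}\sum_{a,b}E_{ab}\otimes E_{ba}\in\operatorname{End}(\mathbb C^4\otimes\mathbb C^4)$, and let $Y(\mathfrak{gl}_4)$ be the Yangian: the unital associative $\mathbb C$-algebra generated by the coefficients of the series $T^a_b(u)=\delta_{ab}+\sum_{s\ge1}(T^a_b)^{\{s\}}u^{-s}$, $1\le a,b\le 4$, with the relations $(u-v)[T^a_b(u),T^c_d(v)]=T^a_d(u)T^c_b(v)-T^a_d(v)T^c_b(u)$. Let $e_{ab}$ be the standard generators of $\mathfrak{gl}_4$. For $x\in\mathbb C$ and a $\mathfrak{gl}_4$-module $V$, the evaluation module $V(x)$ is the pullback of $V$ through $\epsilon\circ\rho_x$, where $\rho_x\colon T(u)\mapsto T(u-x)$ (expanded in powers of $u^{-1}$) and $\epsilon\colon T^a_b(u)\mapsto\delta_{ab}+e_{ba}u^{-1}$; thus in $V(x)$ the series $T^a_b(u)$ is the expansion at $u=\infty$ of a rational function of $u$. A vector $v\in V$ is singular of weight $(\Lambda^1,\dots,\Lambda^4)$ if $e_{ab}v=0$ for $a<b$ and $e_{aa}v=\Lambda^av$ for all $a$. For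 $\boldsymbol\xi=(\xi_1,\xi_2,\xi_3)\in\mathbb Z_{\ge0}^3$ and $\boldsymbol t=(\boldsymbol t^1,\boldsymbol t^2,\boldsymbol t^3)$, $\boldsymbol t^a=(t^a_1,\dots,t^a_{\xi_a})$, set $\xi^0=0$, $\xi^a=\xi_1+\dots+\xi_a$, and in $(\mathbb C^4)^{\otimes \xi^3}$ set $$\mathbb T^{[j]}=T^{(\xi^{j-1}+1)}(t^j_1)\cdots T^{(\xi^{j-1}+\xi_j)}(t^j_{\xi_j}),\qquad \mathbb R^{[k,j]}=\overset{\rightarrow}{\prod_{1\le i\le\xi_k}}\Bigl(\overset{\leftarrow}{\prod_{1\le l\le\xi_j}}R^{(\xi^{k-1}+i,\,\xi^{j-1}+l)}(t^k_i-t^j_l)\Bigr),$$ where superscripts in round brackets indicate the tensor factors acted on, and the arrow $\rightarrow$ (resp. $\leftarrow$) means that the index increases (resp. decreases) from left to right. Let $$\mathbb B_{\boldsymbol\xi}(\boldsymbol t)=\bigl(\mathbb T^{[1]}\mathbb T^{[2]}\mathbb T^{[3]}\,\mathbb R^{[3,2]}\mathbb R^{[3,1]}\mathbb R^{[2,1]}\bigr)^{\boldsymbol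 1^{\xi_1},\boldsymbol 2^{\xi_2},\boldsymbol 3^{\xi_3}}_{\boldsymbol 2^{\xi_1},\boldsymbol 3^{\xi_2},\boldsymbol 4^{\xi_3}}$$ be the matrix entry with row multiindex $1,\dots,1,2,\dots,2,3,\dots,3$ and column multiindex $2,\dots,2,3,\dots,3,4,\dots,4$ (with $\xi_1,\xi_2,\xi_3$ repetitions). For $\boldsymbol t=(t_1,\dots,t_m)$ put $Q_m(\boldsymbol t)=\prod_{1\le i<j\le m}\frac{t_i-t_j-1}{t_i-t_j}$ and $\overline{\mathrm{Sym}}_{\boldsymbol t}f=\sum_{\sigma\in S_m}(fQ_m)(t_{\sigma(1)},\dots,t_{\sigma(m)})$. For $\boldsymbol t=(t_1,\dots,t_\xi)$, $\boldsymbol z=(z_1,\dots,z_k)$, $y\in\mathbb C$ and $I=\{i_1<\dots<i_{|I|}\}\subset\{1,\dots,k\}$ with $|I|\le\xi$ put $$V_I(\boldsymbol t,\boldsymbol z,y)=\frac1{(\xi-|I|)!}\overline{\mathrm{Sym}}_{\boldsymbol t}\prod_{a=1}^{|I|}\Bigl(\frac{t_a-y}{t_a-z_{i_a}}\prod_{m=i_a+1}^k\frac{t_a-z_m+1}{t_a-z_m}\Bigr),$$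 $$\widetilde V_I(\boldsymbol t,\boldsymbol z,y)=\frac1{(\xi-|I|)!}\overline{\mathrm{Sym}}_{\boldsymbol t}\prod_{a=1}^{|I|}\Bigl(\frac{t_{\xi-a+1}-y}{z_{i_a}-t_{\xi-a+1}}\prod_{m=i_a+1}^k\frac{z_m-t_{\xi-a+1}+1}{z_m-t_{\xi-a+1}}\Bigr).$$ Let $\mathcal S_{p,q,r,k}$ be the set of pairs $(I,J)$ of subsets of $\{1,\dots,k\}$ with $|I|=p$, $|J|=q$, $|I\cap J|=r$. For $I\subset\{1,\dots,k\}$ put $\check I=\{k-i+1: i\in I\}$, and put $\check{\boldsymbol t}^2=(t^2_{\xi_2},\dots,t^2_1)$. **Theorem.** Let $V$ be a $\mathfrak{gl}_4$-module, $v\in V$ a singular vector of weight $(\Lambda^1,\Lambda^2,\Lambda^3,\Lambda^4)$, $x\in\mathbb C$, and $\xi_1,\xi_2,\xi_3$ nonnegative integers. Let $t^a_i\in\mathbb C$ ($a=1,2,3$, $i=1,\dots,\xi_a$) be pairwise distinct and different from $x$. For every triple $(p,q,r)$ with $0\le p\le\min(\xi_2,\xi_3)$, $0\le q\le\min(\xi_2,\xi_1)$,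 $\max(0,p+q-\xi_2)\le r\le\min(p,q)$, fix a pair $(I_{p,q,r},J_{p,q,r})\in\mathcal S_{p,q,r,\xi_2}$. Then: (a) In the evaluation $Y(\mathfrak{gl}_4)$-module $V(x)$, $$\mathbb B_{\boldsymbol\xi}(\boldsymbol t)v=\prod_{a=1}^3\prod_{i=1}^{\xi_a}\frac1{t^a_i-x}\;\sum_{p=0}^{\min(\xi_2,\xi_3)}\;\sum_{q=0}^{\min(\xi_2,\xi_1)}\;\sum_{r=\max(0,p+q-\xi_2)}^{\min(p,q)}\overline{\mathrm{Sym}}_{\boldsymbol t^2}\Bigl(V_{\check I_{p,q,r}}(\boldsymbol t^3,\boldsymbol t^2,x-\Lambda^3)\,\widetilde V_{J_{p,q,r}}(\boldsymbol t^1,\check{\boldsymbol t}^2,x-\Lambda^2)\Bigr)\,\frac{e_{32}^{\xi_2-p-q+r}e_{31}^{q-r}e_{42}^{p-r}e_{41}^{r}e_{21}^{\xi_1-q}e_{43}^{\xi_3-p}v}{(p-r)!\,(q-r)!\,r!\,(\xi_2-p-q+r)!}.$$ (b) For each such triple $(p,q,r)$, the function $\overline{\mathrm{Sym}}_{\boldsymbol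 t^2}\bigl(V_{\check I}(\boldsymbol t^3,\boldsymbol t^2,x-\Lambda^3)\,\widetilde V_{J}(\boldsymbol t^1,\check{\boldsymbol t}^2,x-\Lambda^2)\bigr)$ is the same for all pairs $(I,J)\in\mathcal S_{p,q,r,\xi_2}$. -/

import Mathlib

/-! The Lie bracket of an associative ring is its commutator. -/
attribute [local instance 100] LieRing.ofAssociativeRing

noncomputable section

namespace GL4Weight

/-! ### The Yangian `Y(gl_n)`

Indices run over `Fin n`, so the index `a` of the usual numbering `1, …, n` is `a - 1` here. -/

/-- The element `(T^a_b)^{{s}}` of the free algebra on the symbols `(T^a_b)^{{1}}, (T^a_b)^{{2}}, …`,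
with the convention `(T^a_b)^{{0}} = δ_{ab}`. The triple `(a, b, s)` names `(T^a_b)^{{s + 1}}`. -/
def freeGen {n : ℕ} (a b : Fin n) : ℕ → FreeAlgebra ℂ (Fin n × Fin n × ℕ)
  | 0 => if a = b then 1 else 0
  | s + 1 => FreeAlgebra.ι ℂ (a, b, s)

/-- The coefficient at `u^{-r} v^{-s}` of the defining relation
`(u - v) [T^a_b(u), T^c_d(v)] = T^a_d(u) T^c_b(v) - T^a_d(v) T^c_b(u)`. The coefficients at the
positive powers of `u` or `v` are trivial, because `(T^a_b)^{{0}}` is a scalar. -/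
inductive YangianRel (n : ℕ) :
    FreeAlgebra ℂ (Fin n × Fin n × ℕ) → FreeAlgebra ℂ (Fin n × Fin n × ℕ) → Prop
  | rel (a b c d : Fin n) (r s : ℕ) : YangianRel n
      ((freeGen a b (r + 1) * freeGen c d s - freeGen c d s * freeGen a b (r + 1)) -
        (freeGen a b r * freeGen c d (s + 1) - freeGen c d (s + 1) * freeGen a b r))
      (freeGen a d r * freeGen c b s - freeGen a d s * freeGen c b r)

/-- The Yangian `Y(gl_n)`. -/
abbrev Yangian (n : ℕ) : Type := RingQuot (YangianRel n)

/-- The coefficient `(T^a_b)^{{s}}` of `u^{-s}` in the series `T^a_b(u)`. -/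
def yGen {n : ℕ} (a b : Fin n) (s : ℕ) : Yangian n :=
  RingQuot.mkAlgHom ℂ (YangianRel n) (freeGen a b s)

theorem yGen_zero {n : ℕ} (a b : Fin n) : yGen a b 0 = if a = b then 1 else 0 := by
  unfold yGen freeGen
  split_ifs <;> simp

theorem yGen_rel {n : ℕ} (a b c d : Fin n) (r s : ℕ) :
    (yGen a b (r + 1) * yGen c d s - yGen c d s * yGen a b (r + 1)) -
        (yGen a b r * yGen c d (s + 1) - yGen c d (s + 1) * yGen a b r) =
      yGen a d r * yGen c b s - yGen a d s * yGen c b r := by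
  have h := RingQuot.mkAlgHom_rel ℂ (YangianRel.rel a b c d r s)
  simpa only [yGen, map_sub, map_mul] using h

/-- A family of elements that satisfies the relations of the Yangian defines a homomorphism. -/
def yLift {n : ℕ} {A : Type*} [Ring A] [Algebra ℂ A] (g : Fin n → Fin n → ℕ → A)
    (h0 : ∀ a b, g a b 0 = if a = b then 1 else 0)
    (h : ∀ a b c d r s, (g a b (r + 1) * g c d s - g c d s * g a b (r + 1)) -
        (g a b r * g c d (s + 1) - g c d (s + 1) * g a b r) =
      g a d r * g c b s - g a d s * g c b r) : Yangian n →ₐ[ℂ] A :=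
  RingQuot.liftAlgHom ℂ
    ⟨FreeAlgebra.lift ℂ fun i : Fin n × Fin n × ℕ => g i.1 i.2.1 (i.2.2 + 1), by
      have key : ∀ a b s, FreeAlgebra.lift ℂ
          (fun i : Fin n × Fin n × ℕ => g i.1 i.2.1 (i.2.2 + 1)) (freeGen a b s) = g a b s := by
        intro a b s
        cases s with
        | zero => rw [h0]; unfold freeGen; split_ifs <;> simp
        | succ s => simp [freeGen]
      rintro _ _ ⟨a, b, c, d, r, s⟩
      simp only [map_sub, map_mul, key]
      exact h a b c d r s⟩

theorem yLift_yGen {n : ℕ} {A : Type*} [Ring A] [Algebra ℂ A] (g : Fin n → Fin n → ℕ → A)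
    (h0 : ∀ a b, g a b 0 = if a = b then 1 else 0)
    (h : ∀ a b c d r s, (g a b (r + 1) * g c d s - g c d s * g a b (r + 1)) -
        (g a b r * g c d (s + 1) - g c d (s + 1) * g a b r) =
      g a d r * g c b s - g a d s * g c b r) (a b : Fin n) (s : ℕ) :
    yLift g h0 h (yGen a b s) = g a b s := by
  unfold yLift yGen
  rw [RingQuot.liftAlgHom_mkAlgHom_apply]
  cases s with
  | zero => rw [h0]; unfold freeGen; split_ifs <;> simp
  | succ s => simp [freeGen]

/-! ### The shift automorphism `ρ_x : T(u) ↦ T(u - x)` -/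

/-- The coefficient of `u^{-m}` in the expansion of `(u - x)^{-s}` in powers of `u⁻¹`. -/
def shiftCoeff (x : ℂ) (m s : ℕ) : ℂ := ((m - 1).choose (m - s) : ℂ) * x ^ (m - s)

/-- The coefficient of `u^{-m}` in `∑ s, f s (u - x)^{-s}`. -/
def shiftSeq {A : Type*} [AddCommMonoid A] [Module ℂ A] (x : ℂ) (f : ℕ → A) (m : ℕ) : A :=
  ∑ s ∈ Finset.range (m + 1), shiftCoeff x m s • f s

theorem shiftSeq_zero {A : Type*} [AddCommMonoid A] [Module ℂ A] (x : ℂ) (f : ℕ → A) :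
    shiftSeq x f 0 = f 0 := by
  simp [shiftSeq, shiftCoeff]

theorem shiftSeq_succ {A : Type*} [AddCommMonoid A] [Module ℂ A] (x : ℂ) (f : ℕ → A) (m : ℕ) :
    shiftSeq x f (m + 1) =
      ∑ k ∈ Finset.range (m + 1), ((m.choose k : ℂ) * x ^ (m - k)) • f (k + 1) := by
  unfold shiftSeq
  rw [Finset.sum_range_succ']
  have h0 : shiftCoeff x (m + 1) 0 = 0 := by simp [shiftCoeff]
  rw [h0, zero_smul, add_zero]
  refine Finset.sum_congr rfl fun k hk => ?_
  have hk' : k ≤ m := by simpa [Nat.lt_succ_iff] using hk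
  simp [shiftCoeff, Nat.choose_symm hk']

theorem shiftSeq_step {A : Type*} [AddCommMonoid A] [Module ℂ A] (x : ℂ) (f : ℕ → A) (m : ℕ) :
    shiftSeq x f (m + 2) =
      x • shiftSeq x f (m + 1) + shiftSeq x (fun k => f (k + 1)) (m + 1) := by
  rw [shiftSeq_succ, shiftSeq_succ, shiftSeq_succ, Finset.sum_range_succ', Finset.smul_sum,
    Finset.sum_range_succ' (fun k => x • ((m.choose k : ℂ) * x ^ (m - k)) • f (k + 1))]
  have e1 : ∀ k ∈ Finset.range (m + 1),
      (((m + 1).choose (k + 1) : ℂ) * x ^ (m + 1 - (k + 1))) • f (k + 1 + 1) =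
        ((m.choose k : ℂ) * x ^ (m - k)) • f (k + 1 + 1) +
          ((m.choose (k + 1) : ℂ) * x ^ (m - k)) • f (k + 1 + 1) := by
    intro k _
    rw [← add_smul, Nat.choose_succ_succ, Nat.add_sub_add_right]
    congr 1
    push_cast
    ring
  rw [Finset.sum_congr rfl e1, Finset.sum_add_distrib,
    Finset.sum_range_succ (fun k => ((m.choose (k + 1) : ℂ) * x ^ (m - k)) • f (k + 1 + 1))]
  have e2 : ∀ k ∈ Finset.range m,
      x • ((m.choose (k + 1) : ℂ) * x ^ (m - (k + 1))) • f (k + 1 + 1) =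
        ((m.choose (k + 1) : ℂ) * x ^ (m - k)) • f (k + 1 + 1) := by
    intro k hk
    have hk' : k < m := by simpa using hk
    rw [smul_smul]
    congr 1
    obtain ⟨j, rfl⟩ : ∃ j, m = k + 1 + j := ⟨m - (k + 1), by omega⟩
    have h1 : k + 1 + j - (k + 1) = j := by omega
    have h2 : k + 1 + j - k = j + 1 := by omega
    rw [h1, h2, pow_succ]
    ring
  rw [Finset.sum_congr rfl e2]
  have e3 : x • (((m.choose 0 : ℕ) : ℂ) * x ^ (m - 0)) • f (0 + 1) =
      ((((m + 1).choose 0 : ℕ) : ℂ) * x ^ (m + 1 - 0)) • f (0 + 1) := by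
    rw [smul_smul]; simp [pow_succ, mul_comm]
  rw [e3]
  simp only [Nat.choose_succ_self, Nat.cast_zero, zero_mul, zero_smul, add_zero]
  abel

theorem shiftSeq_mul {A : Type*} [Ring A] [Algebra ℂ A] (x : ℂ) (f g : ℕ → A) (r s : ℕ) :
    shiftSeq x f r * shiftSeq x g s =
      ∑ i ∈ Finset.range (r + 1), ∑ j ∈ Finset.range (s + 1),
        (shiftCoeff x r i * shiftCoeff x s j) • (f i * g j) := by
  unfold shiftSeq
  rw [Finset.sum_mul_sum]
  simp only [smul_mul_smul_comm]

/-- `ρ_x` respects the defining relations. -/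
theorem shiftSeq_rel {A : Type*} [Ring A] [Algebra ℂ A] (x : ℂ) (f g p q : ℕ → A)
    (hf : ∀ y, f 0 * y = y * f 0) (hg : ∀ y, g 0 * y = y * g 0)
    (h : ∀ r s, (f (r + 1) * g s - g s * f (r + 1)) - (f r * g (s + 1) - g (s + 1) * f r) =
      p r * q s - p s * q r) (r s : ℕ) :
    (shiftSeq x f (r + 1) * shiftSeq x g s - shiftSeq x g s * shiftSeq x f (r + 1)) -
        (shiftSeq x f r * shiftSeq x g (s + 1) - shiftSeq x g (s + 1) * shiftSeq x f r) =
      shiftSeq x p r * shiftSeq x q s - shiftSeq x p s * shiftSeq x q r := by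
  have step : ∀ (k : ℕ → A) (_ : ∀ y, k 0 * y = y * k 0) (m : ℕ) (y : A),
      shiftSeq x (fun i => k (i + 1)) m * y - y * shiftSeq x (fun i => k (i + 1)) m =
        (shiftSeq x k (m + 1) * y - y * shiftSeq x k (m + 1)) -
          x • (shiftSeq x k m * y - y * shiftSeq x k m) := by
    intro k hk m y
    cases m with
    | zero =>
      rw [shiftSeq_zero, shiftSeq_zero, hk y, sub_self, smul_zero, sub_zero, shiftSeq_succ]
      simp
    | succ m =>
      rw [shiftSeq_step x k m]
      simp only [add_mul, mul_add, smul_sub, smul_mul_assoc, mul_smul_comm]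
      abel
  have h1 := step f hf r (shiftSeq x g s)
  have h2 := step g hg s (shiftSeq x f r)
  have h3 : (shiftSeq x (fun i => f (i + 1)) r * shiftSeq x g s -
        shiftSeq x g s * shiftSeq x (fun i => f (i + 1)) r) +
      (shiftSeq x (fun i => g (i + 1)) s * shiftSeq x f r -
        shiftSeq x f r * shiftSeq x (fun i => g (i + 1)) s) =
      shiftSeq x p r * shiftSeq x q s - shiftSeq x p s * shiftSeq x q r := by
    simp only [shiftSeq_mul]
    rw [Finset.sum_comm (s := Finset.range (s + 1)) (t := Finset.range (r + 1)),
      Finset.sum_comm (s := Finset.range (s + 1)) (t := Finset.range (r + 1)),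
      Finset.sum_comm (s := Finset.range (s + 1)) (t := Finset.range (r + 1))]
    simp only [← Finset.sum_sub_distrib, ← Finset.sum_add_distrib]
    refine Finset.sum_congr rfl fun i _ => Finset.sum_congr rfl fun j _ => ?_
    rw [mul_comm (shiftCoeff x s j) (shiftCoeff x r i), ← smul_sub, ← smul_sub, ← smul_sub,
      ← smul_add, ← h i j]
    congr 1
    abel
  rw [h1, h2] at h3
  rw [← h3]
  simp only [smul_sub]
  abel

/-- The automorphism `ρ_x` of `Y(gl_n)`, `T(u) ↦ T(u - x)`, where `(u - x)^{-s}` is expanded in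
powers of `u⁻¹`. -/
def yShift (n : ℕ) (x : ℂ) : Yangian n →ₐ[ℂ] Yangian n :=
  yLift (fun a b => shiftSeq x (yGen a b))
    (fun a b => by rw [shiftSeq_zero, yGen_zero])
    (fun a b c d r s => shiftSeq_rel x _ _ _ _
      (fun y => by rw [yGen_zero]; split_ifs <;> simp)
      (fun y => by rw [yGen_zero]; split_ifs <;> simp) (yGen_rel a b c d) r s)

theorem yShift_yGen {n : ℕ} (x : ℂ) (a b : Fin n) (s : ℕ) :
    yShift n x (yGen a b s) = shiftSeq x (yGen a b) s :=
  yLift_yGen _ _ _ a b s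

/-! ### The evaluation homomorphism and evaluation modules -/

/-- The Lie algebra `gl_n` over `ℂ`, with the commutator bracket. -/
abbrev gl (n : ℕ) : Type := Matrix (Fin n) (Fin n) ℂ

/-- The standard generator `e_{ab}` of `gl_n`. -/
def e {n : ℕ} (a b : Fin n) : gl n := Matrix.single a b 1

theorem e_comm {n : ℕ} (a b c d : Fin n) :
    ⁅(e a b : gl n), e c d⁆ = (if b = c then e a d else 0) - (if a = d then e c b else 0) := by
  rw [Ring.lie_def]
  unfold e
  congr 1
  · split_ifs with h
    · subst h; simp
    · exact Matrix.single_mul_single_of_ne _ _ _ _ h _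
  · split_ifs with h
    · subst h; simp
    · exact Matrix.single_mul_single_of_ne _ _ _ _ (Ne.symm h) _

/-- The coefficient of `u^{-s}` in `δ_{ab} + e_{ba} u⁻¹`. -/
def evalCoeff {n : ℕ} (a b : Fin n) : ℕ → UniversalEnvelopingAlgebra ℂ (gl n)
  | 0 => if a = b then 1 else 0
  | 1 => UniversalEnvelopingAlgebra.ι ℂ (e b a)
  | _ + 2 => 0

theorem evalCoeff_rel {n : ℕ} (a b c d : Fin n) (r s : ℕ) :
    (evalCoeff a b (r + 1) * evalCoeff c d s - evalCoeff c d s * evalCoeff a b (r + 1)) -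
        (evalCoeff a b r * evalCoeff c d (s + 1) - evalCoeff c d (s + 1) * evalCoeff a b r) =
      evalCoeff a d r * evalCoeff c b s - evalCoeff a d s * evalCoeff c b r := by
  have comm : (evalCoeff a b 1 * evalCoeff c d 1 - evalCoeff c d 1 * evalCoeff a b 1) =
      (if a = d then 1 else 0) * evalCoeff c b 1 -
        evalCoeff a d 1 * (if c = b then 1 else 0) := by
    have h := congrArg (UniversalEnvelopingAlgebra.ι ℂ) (e_comm b a d c)
    rw [LieHom.map_lie, Ring.lie_def] at h
    simp only [evalCoeff]
    rw [h, map_sub]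
    have hbc : (if c = b then (1 : UniversalEnvelopingAlgebra ℂ (gl n)) else 0) =
        if b = c then 1 else 0 := by simp only [eq_comm]
    rw [hbc]
    by_cases h1 : a = d <;> by_cases h2 : b = c <;> simp [h1, h2]
  rcases r with _ | _ | r <;> rcases s with _ | _ | s
  · simp only [zero_add]
    simp only [evalCoeff]
    split_ifs <;> simp
  · simp only [zero_add]
    rw [comm]
    simp only [evalCoeff]
    split_ifs <;> simp
  · simp only [evalCoeff]
    split_ifs <;> simp
  · simp only [zero_add]
    rw [comm]
    simp only [evalCoeff]
    split_ifs <;> simp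
  · simp only [evalCoeff]
    simp
  · simp only [evalCoeff]
    simp
  · simp only [evalCoeff]
    split_ifs <;> simp
  · simp only [evalCoeff]
    simp
  · simp only [evalCoeff]
    simp

/-- The evaluation homomorphism `ε : Y(gl_n) → U(gl_n)`, `T^a_b(u) ↦ δ_{ab} + e_{ba} u⁻¹`. -/
def evalHom (n : ℕ) : Yangian n →ₐ[ℂ] UniversalEnvelopingAlgebra ℂ (gl n) :=
  yLift evalCoeff (fun _ _ => rfl) evalCoeff_rel

theorem evalHom_yGen {n : ℕ} (a b : Fin n) (s : ℕ) :
    evalHom n (yGen a b s) = evalCoeff a b s :=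
  yLift_yGen _ _ _ a b s

/-- The evaluation module `V(x)`, as a representation of `Y(gl_n)` on `V`: the pullback of the
`gl_n`-module `V` through `ε ∘ ρ_x`. -/
def evalModule {n : ℕ} (V : Type*) [AddCommGroup V] [Module ℂ V] [LieRingModule (gl n) V]
    [LieModule ℂ (gl n) V] (x : ℂ) : Yangian n →ₐ[ℂ] Module.End ℂ V :=
  ((UniversalEnvelopingAlgebra.lift ℂ (LieModule.toEnd ℂ (gl n) V)).comp (evalHom n)).comp
    (yShift n x)

/-- A `gl_n`-singular vector of weight `Λ`. -/
def IsSingularOfWeight {n : ℕ} {V : Type*} [AddCommGroup V] [Module ℂ V] [LieRingModule (gl n) V]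
    (v : V) (Λ : Fin n → ℂ) : Prop :=
  (∀ a b : Fin n, a < b → ⁅e a b, v⁆ = 0) ∧ ∀ a : Fin n, ⁅e a a, v⁆ = Λ a • v

/-! ### Values of the series `T^a_b(u)` acting in a module

In an evaluation module the series `T^a_b(u)` is the expansion at `u = ∞` of a rational function
of `u`. -/

/-- `∑ s, F_s U^{-s}` is the expansion at `U = ∞` of a rational function of `U` that is regular at
`U = u` and takes the value `y` there: `d(U) ∑ s, F_s U^{-s} = N(U)` for polynomials `d` and `N`
with `d(u) ≠ 0` and `y = N(u) / d(u)`. The identity is written in powers of `X = U⁻¹`, after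
multiplication by `X ^ m`. -/
def IsRationalValue {A : Type*} [Ring A] [Algebra ℂ A] (F : PowerSeries A) (u : ℂ) (y : A) : Prop :=
  ∃ (m : ℕ) (d : Polynomial ℂ) (N : Polynomial A), d.natDegree ≤ m ∧ N.natDegree ≤ m ∧
    d.eval u ≠ 0 ∧
    (((d.map (algebraMap ℂ A)).reflect m : Polynomial A) : PowerSeries A) * F =
      ((N.reflect m : Polynomial A) : PowerSeries A) ∧
    y = (d.eval u)⁻¹ • N.eval (algebraMap ℂ A u)

open Classical in
/-- The value at `u` of the rational function with expansion `∑ s, F_s U^{-s}` at infinity. -/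
def rationalValue {A : Type*} [Ring A] [Algebra ℂ A] (F : PowerSeries A) (u : ℂ) : A :=
  if h : ∃ y, IsRationalValue F u y then h.choose else 0

/-- The value is unique. -/
theorem IsRationalValue.unique {A : Type*} [Ring A] [Algebra ℂ A] {F : PowerSeries A} {u : ℂ}
    {y y' : A} (h : IsRationalValue F u y) (h' : IsRationalValue F u y') : y = y' := by
  obtain ⟨m, d, N, hd, hN, hdu, hF, rfl⟩ := h
  obtain ⟨m', d', N', hd', hN', hdu', hF', rfl⟩ := h'
  have comm : ∀ (p : Polynomial ℂ) (G : Polynomial A),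
      p.map (algebraMap ℂ A) * G = G * p.map (algebraMap ℂ A) := by
    intro p G
    induction p using Polynomial.induction_on' with
    | add p q hp hq => rw [Polynomial.map_add, add_mul, mul_add, hp, hq]
    | monomial k c =>
      rw [Polynomial.map_monomial, ← Polynomial.C_mul_X_pow_eq_monomial, mul_assoc,
        Polynomial.X_pow_mul, ← mul_assoc, ← mul_assoc]
      congr 1
      ext i
      rw [Polynomial.coeff_C_mul, Polynomial.coeff_mul_C]
      exact Algebra.commutes c _
  have hmap : ∀ p : Polynomial ℂ, (p.map (algebraMap ℂ A)).natDegree ≤ p.natDegree :=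
    fun p => Polynomial.natDegree_map_le
  have key : d'.map (algebraMap ℂ A) * N = d.map (algebraMap ℂ A) * N' := by
    have e1 : (((d'.map (algebraMap ℂ A)) * N).reflect (m' + m) : Polynomial A) =
        ((d.map (algebraMap ℂ A)) * N').reflect (m' + m) := by
      rw [Polynomial.reflect_mul _ _ ((hmap d').trans hd') hN, add_comm m' m,
        Polynomial.reflect_mul _ _ ((hmap d).trans hd) hN']
      apply Polynomial.coe_injective A
      rw [Polynomial.coe_mul, Polynomial.coe_mul, ← hF, ← hF', ← mul_assoc, ← mul_assoc,
        ← Polynomial.coe_mul, ← Polynomial.coe_mul]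
      congr 2
      rw [← Polynomial.reflect_mul _ _ ((hmap d').trans hd') ((hmap d).trans hd),
        ← Polynomial.reflect_mul _ _ ((hmap d).trans hd) ((hmap d').trans hd'), comm, add_comm]
    have e2 := congrArg (Polynomial.reflect (m' + m)) e1
    simpa only [Polynomial.reflect_reflect] using e2
  have ev : ∀ (p : Polynomial ℂ) (G : Polynomial A),
      (p.map (algebraMap ℂ A) * G).eval (algebraMap ℂ A u) =
        p.eval u • G.eval (algebraMap ℂ A u) := by
    intro p G
    have h1 : ∀ k, Commute (RingHom.id A (G.coeff k)) (algebraMap ℂ A u) :=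
      fun k => (Algebra.commutes u _).symm
    have h2 := Polynomial.eval₂_mul_noncomm (p := p.map (algebraMap ℂ A)) (q := G)
      (RingHom.id A) (algebraMap ℂ A u) h1
    have h3 : (p.map (algebraMap ℂ A)).eval (algebraMap ℂ A u) = algebraMap ℂ A (p.eval u) := by
      rw [Polynomial.eval_map_algebraMap, Polynomial.aeval_algebraMap_apply]
      rfl
    rw [Algebra.smul_def, ← h3]
    exact h2
  have e3 := congrArg (Polynomial.eval (algebraMap ℂ A u)) key
  rw [ev, ev] at e3
  rw [inv_smul_eq_iff₀ hdu, smul_comm, ← e3, inv_smul_smul₀ hdu']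

theorem IsRationalValue.rationalValue_eq {A : Type*} [Ring A] [Algebra ℂ A] {F : PowerSeries A}
    {u : ℂ} {y : A} (h : IsRationalValue F u y) : rationalValue F u = y := by
  have h' : ∃ y, IsRationalValue F u y := ⟨y, h⟩
  rw [rationalValue, dif_pos h']
  exact h'.choose_spec.unique h

/-- The matrix `T(u)` acting in a representation `π` of the Yangian. -/
def tValue {n : ℕ} {A : Type*} [Ring A] [Algebra ℂ A] (π : Yangian n →ₐ[ℂ] A) (u : ℂ) :
    Matrix (Fin n) (Fin n) A :=
  Matrix.of fun a b => rationalValue (PowerSeries.mk fun s => π (yGen a b s)) u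

/-- In `V(x)` the series `T^a_b(u)` acts as `δ_{ab} + (u - x)⁻¹ e_{ba}`. -/
theorem tValue_evalModule {n : ℕ} (V : Type*) [AddCommGroup V] [Module ℂ V]
    [LieRingModule (gl n) V] [LieModule ℂ (gl n) V] (x u : ℂ) (hu : u ≠ x) (a b : Fin n) :
    tValue (evalModule V x) u a b =
      (if a = b then 1 else 0) + (u - x)⁻¹ • LieModule.toEnd ℂ (gl n) V (e b a) := by
  set E := LieModule.toEnd ℂ (gl n) V (e b a) with hE
  have h0 : evalModule V x (yGen a b 0) = if a = b then 1 else 0 := by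
    rw [yGen_zero]; split_ifs <;> simp
  have h1 : ∀ s, evalModule V x (yGen a b (s + 1)) = x ^ s • E := by
    intro s
    simp only [evalModule, AlgHom.comp_apply]
    rw [yShift_yGen, shiftSeq_succ, map_sum, map_sum, Finset.sum_eq_single 0]
    · simp only [map_smul, zero_add, evalHom_yGen, evalCoeff,
        UniversalEnvelopingAlgebra.lift_ι_apply]
      simp [hE]
    · intro k _ hk
      obtain ⟨j, rfl⟩ := Nat.exists_eq_succ_of_ne_zero hk
      simp only [map_smul, evalHom_yGen, evalCoeff, map_zero, smul_zero]
    · simp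
  unfold tValue
  rw [Matrix.of_apply]
  refine IsRationalValue.rationalValue_eq ⟨1, Polynomial.X - Polynomial.C x,
    Polynomial.X * Polynomial.C (if a = b then 1 else 0) +
      Polynomial.C (E - x • (if a = b then 1 else 0)), ?_, ?_, ?_, ?_, ?_⟩
  · exact (Polynomial.natDegree_X_sub_C x).le
  · refine (Polynomial.natDegree_add_le _ _).trans (max_le ?_ ?_)
    · refine Polynomial.natDegree_mul_le.trans ?_
      rw [Polynomial.natDegree_C, add_zero]
      exact Polynomial.natDegree_X_le
    · rw [Polynomial.natDegree_C]; exact Nat.zero_le _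
  · simpa [sub_eq_zero] using hu
  · rw [Polynomial.map_sub, Polynomial.map_X, Polynomial.map_C, Polynomial.reflect_sub,
      Polynomial.reflect_add, Polynomial.reflect_C, Polynomial.reflect_C, Polynomial.X_mul_C,
      Polynomial.reflect_C_mul]
    have hX : (Polynomial.X : Polynomial (Module.End ℂ V)).reflect 1 = 1 := by
      rw [← pow_one Polynomial.X, Polynomial.reflect_monomial, Polynomial.revAt_le le_rfl]
      simp
    have hs : ∀ c : Module.End ℂ V,
        ((1 - Polynomial.C c * Polynomial.X : Polynomial (Module.End ℂ V)) :
          PowerSeries (Module.End ℂ V)) = 1 - PowerSeries.C c * PowerSeries.X := by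
      intro c
      rw [eq_sub_iff_add_eq, ← Polynomial.coe_C, ← Polynomial.coe_X, ← Polynomial.coe_mul,
        ← Polynomial.coe_add, sub_add_cancel, Polynomial.coe_one]
    rw [hX, pow_one, mul_one, hs, Polynomial.coe_add, Polynomial.coe_mul,
      Polynomial.coe_C, Polynomial.coe_C, Polynomial.coe_X, sub_mul, one_mul, mul_assoc]
    ext1 k
    rw [map_sub, map_add, PowerSeries.coeff_C_mul, PowerSeries.coeff_C_mul]
    rcases k with _ | _ | k
    · simp [h0]
    · simp only [PowerSeries.coeff_succ_X_mul, PowerSeries.coeff_mk, h1, h0, PowerSeries.coeff_C,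
        PowerSeries.coeff_X]
      simp [Algebra.smul_def]
    · simp only [PowerSeries.coeff_succ_X_mul, PowerSeries.coeff_mk, h1, PowerSeries.coeff_C,
        PowerSeries.coeff_X]
      simp [Algebra.smul_def, pow_succ', mul_assoc]
  · have hux : u - x ≠ 0 := sub_ne_zero.mpr hu
    rw [Polynomial.X_mul_C, Polynomial.eval_add, Polynomial.eval_C_mul, Polynomial.eval_X,
      Polynomial.eval_C, Polynomial.eval_sub, Polynomial.eval_X, Polynomial.eval_C]
    have : (if a = b then (1 : Module.End ℂ V) else 0) * algebraMap ℂ (Module.End ℂ V) u =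
        u • (if a = b then (1 : Module.End ℂ V) else 0) := by
      rw [Algebra.smul_def, Algebra.commutes]
    rw [this, eq_inv_smul_iff₀ hux, smul_add, smul_inv_smul₀ hux, sub_smul]
    abel

/-! ### The off-shell Bethe vector operator `𝔹_ξ(t)` -/

/-- The rational `R`-matrix `R(u) = 1 + u⁻¹ ∑ E_{ab} ⊗ E_{ba}`. -/
def rMatrix (n : ℕ) (u : ℂ) : Matrix (Fin n × Fin n) (Fin n × Fin n) ℂ :=
  1 + u⁻¹ • ∑ a : Fin n, ∑ b : Fin n,
    Matrix.kroneckerMap (· * ·) (Matrix.single a b (1 : ℂ)) (Matrix.single b a (1 : ℂ))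

section Bethe

variable {m : ℕ} {A : Type*} [Ring A] [Algebra ℂ A]

/-- The labels of the tensor factors of `(ℂ^n)^{⊗ (ξ_1 + ⋯ + ξ_m)}`, where `n = m + 1`: the factor
number `ξ_1 + ⋯ + ξ_{a-1} + i` is labelled by `(a, i)`. -/
abbrev Site (ξ : Fin m → ℕ) : Type := (a : Fin m) × Fin (ξ a)

/-- Matrices with entries in `A` acting in `(ℂ^n)^{⊗ (ξ_1 + ⋯ + ξ_m)}`, labelled by multiindices;
the row index is the upper one. -/
abbrev SiteMatrix (ξ : Fin m → ℕ) (A : Type*) : Type _ :=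
  Matrix (Site ξ → Fin (m + 1)) (Site ξ → Fin (m + 1)) A

/-- `L^{(k)}`: the matrix `L` acting in the factor `k`. -/
def siteT {ξ : Fin m → ℕ} (L : Matrix (Fin (m + 1)) (Fin (m + 1)) A) (k : Site ξ) :
    SiteMatrix ξ A :=
  Matrix.of fun I J => if ∀ l, l ≠ k → I l = J l then L (I k) (J k) else 0

/-- `R^{(k,l)}(u)`: the matrix `R(u)` acting in the factors `k` and `l`. -/
def siteR {ξ : Fin m → ℕ} (u : ℂ) (k l : Site ξ) : SiteMatrix ξ A :=
  Matrix.of fun I J => if ∀ j, j ≠ k → j ≠ l → I j = J j then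
    algebraMap ℂ A (rMatrix (m + 1) u (I k, I l) (J k, J l)) else 0

/-- `𝕋^{[j]}(t^j)`, the product of `T^{(j,k)}(t^j_k)` in increasing order of `k`. -/
def bigT (T : ℂ → Matrix (Fin (m + 1)) (Fin (m + 1)) A) {ξ : Fin m → ℕ}
    (t : (a : Fin m) → Fin (ξ a) → ℂ) (j : Fin m) : SiteMatrix ξ A :=
  ((List.finRange (ξ j)).map fun k => siteT (T (t j k)) ⟨j, k⟩).prod

/-- `ℝ^{[k,j]}(t^k, t^j)`, the product over increasing `i` of the products over decreasing `l` of
`R^{(k,i),(j,l)}(t^k_i - t^j_l)`. -/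
def bigR (A : Type*) [Ring A] [Algebra ℂ A] {ξ : Fin m → ℕ} (t : (a : Fin m) → Fin (ξ a) → ℂ)
    (k j : Fin m) : SiteMatrix ξ A :=
  ((List.finRange (ξ k)).map fun i =>
    ((List.finRange (ξ j)).reverse.map fun l =>
      (siteR (t k i - t j l) ⟨k, i⟩ ⟨j, l⟩ : SiteMatrix ξ A)).prod).prod

/-- `𝕋̂_ξ(t) = 𝕋^{[1]}(t^1) ⋯ 𝕋^{[n-1]}(t^{n-1})` times the product over decreasing `i` of the
products over decreasing `j < i` of `ℝ^{[i,j]}(t^i, t^j)`. -/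
def hatT (T : ℂ → Matrix (Fin (m + 1)) (Fin (m + 1)) A) {ξ : Fin m → ℕ}
    (t : (a : Fin m) → Fin (ξ a) → ℂ) : SiteMatrix ξ A :=
  ((List.finRange m).map fun j => bigT T t j).prod *
    ((List.finRange m).reverse.map fun i =>
      (((List.finRange m).filter fun j => j < i).reverse.map fun j => bigR A t i j).prod).prod

/-- The operator `𝔹_ξ(t)` in a representation `π` of `Y(gl_n)`, `n = m + 1`: the entry of
`𝕋̂_ξ(t)` with upper multiindex `1^{ξ_1}, 2^{ξ_2}, …, (n-1)^{ξ_{n-1}}` and lower multiindex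
`2^{ξ_1}, 3^{ξ_2}, …, n^{ξ_{n-1}}`. -/
def bethe (π : Yangian (m + 1) →ₐ[ℂ] A) {ξ : Fin m → ℕ} (t : (a : Fin m) → Fin (ξ a) → ℂ) : A :=
  hatT (tValue π) t (fun s => s.1.castSucc) (fun s => s.1.succ)

end Bethe

/-! ### Symmetrization and the functions `V_I`, `Ṽ_I` -/

/-- `Q_m(t_1, …, t_m) = ∏_{i < j} (t_i - t_j - 1) / (t_i - t_j)`. -/
def Q {m : ℕ} (t : Fin m → ℂ) : ℂ :=
  ∏ i : Fin m, ∏ j ∈ Finset.Ioi i, (t i - t j - 1) / (t i - t j)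

/-- `Sym_t f = ∑_σ f(t_{σ(1)}, …, t_{σ(m)})`. -/
def sym {m : ℕ} (f : (Fin m → ℂ) → ℂ) (t : Fin m → ℂ) : ℂ :=
  ∑ σ : Equiv.Perm (Fin m), f fun i => t (σ i)

/-- `Sym̄_t f = Sym_t (f Q_m)`. -/
def symBar {m : ℕ} (f : (Fin m → ℂ) → ℂ) (t : Fin m → ℂ) : ℂ :=
  sym (fun s => f s * Q s) t

/-- The `a`-th smallest element `i_a` of `I = {i_1 < ⋯ < i_{|I|}}`. -/
def nth {k : ℕ} (I : Finset (Fin k)) (a : Fin I.card) : Fin k := I.orderEmbOfFin rfl a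

/-- `F_I(t, z) = ∏_{a = 1}^{|I|} (1 / (t_a - z_{i_a}) ∏_{m > i_a} (t_a - z_m + 1) / (t_a - z_m))`,
for `|I| ≤ ξ`. -/
def FI {ξ k : ℕ} (I : Finset (Fin k)) (h : I.card ≤ ξ) (t : Fin ξ → ℂ) (z : Fin k → ℂ) : ℂ :=
  ∏ a : Fin I.card, (1 / (t (Fin.castLE h a) - z (nth I a)) *
    ∏ m ∈ Finset.Ioi (nth I a), (t (Fin.castLE h a) - z m + 1) / (t (Fin.castLE h a) - z m))

/-- `F̃_I(t, z) = ∏_{a = 1}^{|I|} (1 / (z_{i_a} - t_{ξ-a+1})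
∏_{m > i_a} (z_m - t_{ξ-a+1} + 1) / (z_m - t_{ξ-a+1}))`, for `|I| ≤ ξ`. -/
def FItilde {ξ k : ℕ} (I : Finset (Fin k)) (h : I.card ≤ ξ) (t : Fin ξ → ℂ) (z : Fin k → ℂ) : ℂ :=
  ∏ a : Fin I.card, (1 / (z (nth I a) - t (Fin.castLE h a).rev) *
    ∏ m ∈ Finset.Ioi (nth I a),
      (z m - t (Fin.castLE h a).rev + 1) / (z m - t (Fin.castLE h a).rev))

/-- `V_I(t, z, y) = 1 / (ξ - |I|)! Sym̄_t (F_I(t, z) ∏_{a = 1}^{|I|} (t_a - y))` for `|I| ≤ ξ`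
(and zero for `|I| > ξ`, a case that does not occur). -/
def VI {ξ k : ℕ} (I : Finset (Fin k)) (t : Fin ξ → ℂ) (z : Fin k → ℂ) (y : ℂ) : ℂ :=
  if h : I.card ≤ ξ then
    1 / ((ξ - I.card).factorial : ℂ) *
      symBar (fun s => FI I h s z * ∏ a : Fin I.card, (s (Fin.castLE h a) - y)) t
  else 0

/-- `Ṽ_I(t, z, y) = 1 / (ξ - |I|)! Sym̄_t (F̃_I(t, z) ∏_{a = 1}^{|I|} (t_{ξ-a+1} - y))` for
`|I| ≤ ξ` (and zero for `|I| > ξ`, a case that does not occur). -/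
def VItilde {ξ k : ℕ} (I : Finset (Fin k)) (t : Fin ξ → ℂ) (z : Fin k → ℂ) (y : ℂ) : ℂ :=
  if h : I.card ≤ ξ then
    1 / ((ξ - I.card).factorial : ℂ) *
      symBar (fun s => FItilde I h s z * ∏ a : Fin I.card, (s (Fin.castLE h a).rev - y)) t
  else 0

/-- `Ǐ = {k - i + 1 : i ∈ I}`. -/
def check {k : ℕ} (I : Finset (Fin k)) : Finset (Fin k) := I.image Fin.rev

/-- `𝒮_{p,q,r,k}`: the pairs of subsets of `{1, …, k}` with `|I| = p`, `|J| = q`,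
`|I ∩ J| = r`. -/
def pairs (p q r k : ℕ) : Set (Finset (Fin k) × Finset (Fin k)) :=
  {P | P.1.card = p ∧ P.2.card = q ∧ (P.1 ∩ P.2).card = r}

/-- `(p, q, r)` is in the range of summation: `0 ≤ p ≤ min(ξ_2, ξ_3)`, `0 ≤ q ≤ min(ξ_2, ξ_1)`,
`max(0, p + q - ξ_2) ≤ r ≤ min(p, q)`. The family `ξ` is indexed from zero. -/
def InRange (ξ : Fin 3 → ℕ) (p q r : ℕ) : Prop :=
  p ≤ min (ξ 1) (ξ 2) ∧ q ≤ min (ξ 1) (ξ 0) ∧ p + q ≤ ξ 1 + r ∧ r ≤ min p q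

/-- `Sym̄_{t²} (V_Ǐ(t³, t², x - Λ³) Ṽ_J(t¹, ť², x - Λ²))`, where `ť²` is `t²` in the reverse
order. The families `t` and `Λ` are indexed from zero. -/
def coeff {ξ : Fin 3 → ℕ} (t : (a : Fin 3) → Fin (ξ a) → ℂ) (x : ℂ) (Λ : Fin 4 → ℂ)
    (P : Finset (Fin (ξ 1)) × Finset (Fin (ξ 1))) : ℂ :=
  symBar (fun z => VI (check P.1) (t 2) z (x - Λ 2) *
    VItilde P.2 (t 0) (fun i => z i.rev) (x - Λ 1)) (t 1)

/-- The action of `e_{ab}` on a `gl_4`-module. -/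
def act (V : Type*) [AddCommGroup V] [Module ℂ V] [LieRingModule (gl 4) V]
    [LieModule ℂ (gl 4) V] (a b : Fin 4) : Module.End ℂ V :=
  LieModule.toEnd ℂ (gl 4) V (e a b)

/-- `e_32^{ξ_2-p-q+r} e_31^{q-r} e_42^{p-r} e_41^r e_21^{ξ_1-q} e_43^{ξ_3-p} v`; the indices of
the matrix units are numbered from zero in the code. -/
def basisVector {V : Type*} [AddCommGroup V] [Module ℂ V] [LieRingModule (gl 4) V]
    [LieModule ℂ (gl 4) V] (ξ : Fin 3 → ℕ) (p q r : ℕ) (v : V) : V :=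
  (act V 2 1 ^ (ξ 1 + r - (p + q)) * act V 2 0 ^ (q - r) * act V 3 1 ^ (p - r) * act V 3 0 ^ r *
    act V 1 0 ^ (ξ 0 - q) * act V 3 2 ^ (ξ 2 - p)) v

end GL4Weight

end

open GL4Weight

noncomputable section

namespace GL4Weight

/-! ### The coefficients of a `gl_2` Bethe vector, by recursion on the sites -/

/-! Both sides are sums over pairs of spin configurations on the sites of the middle group of
variables. Groups and colours are numbered from zero here, and w₀ is the permutation `Fin.revPerm`.

Operator side. The Yang–Baxter equation and the RTT relation turn 𝕋₀𝕋₁𝕋₂ℝ₂₁ℝ₂₀ℝ₁₀ into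
ℝ₁₀ℝ₂₀(𝕋₁𝕋₂𝕋₀)ℝ₂₁ (`hatT_word`). In the required matrix entry ℝ₁₀ and ℝ₂₀ then act on the row index
only, and ℝ₂₁, transposed, on the column index only (`bethe_apply`). The factor ℝ₂₀ acts trivially
because v is singular. The factor ℝ₁₀ only moves the colours 0, 1 between groups 0 and 1, and ℝ₂₁
only the colours 2, 3 between groups 1 and 2. So each of them is a product of monodromy entries of a
gl_2 chain with one two-dimensional site for every variable of group 1, glued to entries of T from
the other group (`lines_apply_eq`). The algebraic Bethe ansatz, one site at a time, gives the
components of the resulting vectors as `chainCoeff` (`prod_chainOp_apply`). Group 1 itself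
contributes a product of commuting generators e_{ab} with a in {2, 3} and b in {0, 1}. Hence the
vector multiplying a pair of configurations depends only on how many sites carry each pair of spins
(`bethe_apply_eq_sum_pairCoeff`).

Function side. `VI` and `VItilde` obey the recursion of `chainCoeff`, with evaluation points z and
-z respectively. Exchanging neighbouring evaluation points amounts, through an R-matrix, to
exchanging the spins there (`chainCoeff_swap`). The corresponding operators `exchange` on functions
on the orbit of z satisfy the Coxeter relations, so they define an action of the symmetric group,
and this action permutes the spins. The action is triangular with respect to length, and its leading
coefficient for w₀ is the weight `Q`. This yields `sum_Q_mul_eq`, which trades the weighted sum of f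
h Q for an unweighted sum over the group. For two chain coefficients the result is the sum over τ of
their product with both configurations permuted by the same τ (`sum_chainCoeff_mul_chainCoeff`).

Such a sum depends on (I, J) only through the orbit of the pair of configurations, that is, through
p, q, r: this is (b). Counting stabilizers turns the sum over τ into product of factorials times a
sum over the orbit, and comparison with the operator side is (a). -/

/-- The coefficient of the basis vector with spins `J` in the off-shell Bethe vector with
parameters `t i`, `i ∈ S`, of a chain of vector modules with evaluation points `z`, glued to a
singular vector of weight function `h`. -/
def chainCoeff {ι : Type*} [DecidableEq ι] (h t : ι → ℂ) :
    (k : ℕ) → (Fin k → ℂ) → (Fin k → Bool) → Finset ι → ℂ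
  | 0, _, _, _ => 1
  | k + 1, z, J, S =>
    if J 0 then
      ∑ i ∈ S, h i * (t i - z 0)⁻¹ * (∏ m, (1 + (t i - Fin.tail z m)⁻¹)) *
        (∏ j ∈ S.erase i, (1 - (t i - t j)⁻¹)) *
          chainCoeff h t k (Fin.tail z) (Fin.tail J) (S.erase i)
    else chainCoeff h t k (Fin.tail z) (Fin.tail J) S

section chainCoeff

variable {ι : Type*} [DecidableEq ι] (h t : ι → ℂ)

theorem chainCoeff_cons_false {k : ℕ} (a : ℂ) (z : Fin k → ℂ) (J : Fin k → Bool) (S : Finset ι) :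
    chainCoeff h t (k + 1) (Fin.cons a z) (Fin.cons false J) S = chainCoeff h t k z J S := by
  simp [chainCoeff]

theorem chainCoeff_cons_true {k : ℕ} (a : ℂ) (z : Fin k → ℂ) (J : Fin k → Bool) (S : Finset ι) :
    chainCoeff h t (k + 1) (Fin.cons a z) (Fin.cons true J) S =
      ∑ i ∈ S, h i * (t i - a)⁻¹ * (∏ m, (1 + (t i - z m)⁻¹)) *
        (∏ j ∈ S.erase i, (1 - (t i - t j)⁻¹)) * chainCoeff h t k z J (S.erase i) := by
  simp [chainCoeff]

theorem sum_erase_antisymm (S : Finset ι) (f : ι → ι → ℂ)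
    (hf : ∀ i ∈ S, ∀ j ∈ S, i ≠ j → f i j + f j i = 0) :
    ∑ i ∈ S, ∑ j ∈ S.erase i, f i j = 0 := by
  have h1 : ∑ i ∈ S, ∑ j ∈ S.erase i, f i j = ∑ i ∈ S, ∑ j ∈ S.erase i, f j i :=
    Finset.sum_comm' (by grind)
  have h2 : ∑ i ∈ S, ∑ j ∈ S.erase i, f i j + ∑ i ∈ S, ∑ j ∈ S.erase i, f j i = 0 := by
    rw [← Finset.sum_add_distrib]
    refine Finset.sum_eq_zero fun i hi => ?_
    rw [← Finset.sum_add_distrib]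
    refine Finset.sum_eq_zero fun j hj => ?_
    rw [Finset.mem_erase] at hj
    exact hf i hi j hj.2 hj.1.symm
  rw [← h1] at h2
  linear_combination h2 / 2

theorem cons_cons_comp_swap {α : Type*} {k : ℕ} (a b : α) (z : Fin k → α) :
    (Fin.cons a (Fin.cons b z : Fin (k + 1) → α) : Fin (k + 2) → α) ∘
      Equiv.swap (0 : Fin (k + 2)) 1 = Fin.cons b (Fin.cons a z : Fin (k + 1) → α) := by
  funext i
  refine Fin.cases ?_ (fun i => Fin.cases ?_ (fun i => ?_) i) i
  · rw [Function.comp_apply, Equiv.swap_apply_left]; rfl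
  · simp
  · rw [Function.comp_apply, Equiv.swap_apply_of_ne_of_ne] <;> simp [Fin.ext_iff]

theorem cons_comp_swap_succ {α : Type*} {k : ℕ} (a : α) (z : Fin k → α) (i j : Fin k) :
    (Fin.cons a z : Fin (k + 1) → α) ∘ Equiv.swap i.succ j.succ =
      Fin.cons a (z ∘ Equiv.swap i j) := by
  funext m
  refine Fin.cases ?_ (fun m => ?_) m
  · rw [Function.comp_apply, Equiv.swap_apply_of_ne_of_ne] <;> simp [Fin.ext_iff]
  · simp only [Function.comp_apply, Fin.cons_succ, Equiv.swap_apply_def, Fin.succ_inj]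
    split_ifs <;> simp

/-- The exchange relation for the two leftmost sites. -/
theorem chainCoeff_swap_zero {k : ℕ} (a b : ℂ) (z : Fin k → ℂ) (c d : Bool) (J : Fin k → Bool)
    (S : Finset ι) (ht : Set.InjOn t S) (ha : ∀ i ∈ S, t i ≠ a) (hb : ∀ i ∈ S, t i ≠ b) :
    (a - b) * chainCoeff h t (k + 2) (Fin.cons a (Fin.cons b z : Fin (k + 1) → ℂ))
        (Fin.cons d (Fin.cons c J : Fin (k + 1) → Bool)) S =
      (a - b + 1) * chainCoeff h t (k + 2) (Fin.cons b (Fin.cons a z : Fin (k + 1) → ℂ))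
        (Fin.cons c (Fin.cons d J : Fin (k + 1) → Bool)) S -
      chainCoeff h t (k + 2) (Fin.cons a (Fin.cons b z : Fin (k + 1) → ℂ))
        (Fin.cons c (Fin.cons d J : Fin (k + 1) → Bool)) S := by
  cases c <;> cases d
  · simp only [chainCoeff_cons_false]; ring
  · simp only [chainCoeff_cons_false, chainCoeff_cons_true, Fin.prod_univ_succ, Fin.cons_zero,
      Fin.cons_succ, Finset.mul_sum, ← Finset.sum_sub_distrib]
    refine Finset.sum_congr rfl fun i hi => ?_
    have h1 := sub_ne_zero.mpr (ha i hi)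
    have h2 := sub_ne_zero.mpr (hb i hi)
    have key : (a - b) * ((t i - a)⁻¹ * (1 + (t i - b)⁻¹)) =
        (a - b + 1) * (t i - a)⁻¹ - (t i - b)⁻¹ := by
      field_simp; ring
    linear_combination h i * (∏ m, (1 + (t i - z m)⁻¹)) *
        (∏ j ∈ S.erase i, (1 - (t i - t j)⁻¹)) * chainCoeff h t k z J (S.erase i) * key
  · simp only [chainCoeff_cons_false, chainCoeff_cons_true, Fin.prod_univ_succ, Fin.cons_zero,
      Fin.cons_succ, Finset.mul_sum, ← Finset.sum_sub_distrib]
    refine Finset.sum_congr rfl fun i hi => ?_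
    have h1 := sub_ne_zero.mpr (ha i hi)
    have h2 := sub_ne_zero.mpr (hb i hi)
    have key : (a - b) * ((t i - b)⁻¹) =
        (a - b + 1) * ((t i - b)⁻¹ * (1 + (t i - a)⁻¹)) - (t i - a)⁻¹ * (1 + (t i - b)⁻¹) := by
      field_simp; ring
    linear_combination h i * (∏ m, (1 + (t i - z m)⁻¹)) *
        (∏ j ∈ S.erase i, (1 - (t i - t j)⁻¹)) * chainCoeff h t k z J (S.erase i) * key
  -- With both spins up the relation follows from symmetry in the two evaluation points. The
  -- difference of the two sides is a double sum over the parameters that flip the two sites, and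
  -- its summand is antisymmetric in these parameters.
  · suffices hs : chainCoeff h t (k + 2) (Fin.cons b (Fin.cons a z : Fin (k + 1) → ℂ))
        (Fin.cons true (Fin.cons true J : Fin (k + 1) → Bool)) S =
      chainCoeff h t (k + 2) (Fin.cons a (Fin.cons b z : Fin (k + 1) → ℂ))
        (Fin.cons true (Fin.cons true J : Fin (k + 1) → Bool)) S by
      rw [hs]; ring
    rw [← sub_eq_zero]
    simp only [chainCoeff_cons_true, Fin.prod_univ_succ, Fin.cons_zero,
      Fin.cons_succ, Finset.mul_sum, ← Finset.sum_sub_distrib]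
    refine sum_erase_antisymm S _ fun i hi j hj hij => ?_
    have hji : j ∈ S.erase i := Finset.mem_erase.mpr ⟨hij.symm, hj⟩
    have hij' : i ∈ S.erase j := Finset.mem_erase.mpr ⟨hij, hi⟩
    rw [← Finset.mul_prod_erase _ _ hji, ← Finset.mul_prod_erase _ _ hij',
      Finset.erase_right_comm (a := j) (b := i)]
    have h1 := sub_ne_zero.mpr (ha i hi)
    have h2 := sub_ne_zero.mpr (hb i hi)
    have h3 := sub_ne_zero.mpr (ha j hj)
    have h4 := sub_ne_zero.mpr (hb j hj)
    have h5 : t i - t j ≠ 0 := sub_ne_zero.mpr fun e => hij (ht hi hj e)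
    have h6 : t j - t i ≠ 0 := sub_ne_zero.mpr fun e => hij (ht hi hj e.symm)
    have key : ((t i - b)⁻¹ * (1 + (t i - a)⁻¹) * (t j - a)⁻¹ -
          (t i - a)⁻¹ * (1 + (t i - b)⁻¹) * (t j - b)⁻¹) * (1 - (t i - t j)⁻¹) +
        ((t j - b)⁻¹ * (1 + (t j - a)⁻¹) * (t i - a)⁻¹ -
          (t j - a)⁻¹ * (1 + (t j - b)⁻¹) * (t i - b)⁻¹) * (1 - (t j - t i)⁻¹) = 0 := by
      have e : (t j - t i)⁻¹ = -(t i - t j)⁻¹ := by rw [← neg_sub, inv_neg]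
      rw [e]
      field_simp; ring
    linear_combination h i * h j * (∏ m, (1 + (t i - z m)⁻¹)) * (∏ m, (1 + (t j - z m)⁻¹)) *
        (∏ l ∈ (S.erase i).erase j, (1 - (t i - t l)⁻¹)) *
        (∏ l ∈ (S.erase i).erase j, (1 - (t j - t l)⁻¹)) *
        chainCoeff h t k z J ((S.erase i).erase j) * key

/-- The exchange relation for two neighbouring sites. -/
theorem chainCoeff_swap {k : ℕ} (i : Fin k) (z : Fin (k + 1) → ℂ) (J : Fin (k + 1) → Bool)
    (S : Finset ι) (ht : Set.InjOn t S) (hz : ∀ i ∈ S, ∀ m, t i ≠ z m) :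
    (z i.castSucc - z i.succ) *
        chainCoeff h t (k + 1) z (J ∘ Equiv.swap i.castSucc i.succ) S =
      (z i.castSucc - z i.succ + 1) *
        chainCoeff h t (k + 1) (z ∘ Equiv.swap i.castSucc i.succ) J S -
      chainCoeff h t (k + 1) z J S := by
  induction k generalizing S with
  | zero => exact i.elim0
  | succ k ih =>
    induction z using Fin.consCases with | _ a z => ?_
    induction J using Fin.consCases with | _ c J => ?_
    refine Fin.cases ?_ (fun i => ?_) i
    · induction z using Fin.consCases with | _ b z => ?_
      induction J using Fin.consCases with | _ d J => ?_
      have ha : ∀ i ∈ S, t i ≠ a := fun i hi => hz i hi 0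
      have hb : ∀ i ∈ S, t i ≠ b := fun i hi => by simpa using hz i hi (Fin.succ 0)
      have := chainCoeff_swap_zero h t a b z c d J S ht ha hb
      rw [Fin.castSucc_zero, Fin.succ_zero_eq_one, cons_cons_comp_swap, cons_cons_comp_swap]
      exact this
    · rw [← Fin.succ_castSucc, cons_comp_swap_succ, cons_comp_swap_succ]
      have hz' : ∀ i ∈ S, ∀ m, t i ≠ z m := fun i hi m => by simpa using hz i hi m.succ
      cases c
      · simp only [chainCoeff_cons_false, Fin.cons_succ]
        exact ih i z J S ht hz'
      · simp only [chainCoeff_cons_true, Fin.cons_succ, Finset.mul_sum, ← Finset.sum_sub_distrib]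
        refine Finset.sum_congr rfl fun l hl => ?_
        have e : ∏ m, (1 + (t l - (z ∘ Equiv.swap i.castSucc i.succ) m)⁻¹) =
            ∏ m, (1 + (t l - z m)⁻¹) :=
          Equiv.prod_comp (Equiv.swap i.castSucc i.succ) fun m => 1 + (t l - z m)⁻¹
        rw [e]
        have := ih i z J (S.erase l) (ht.mono (by simp))
          fun i hi => hz' i (Finset.mem_of_mem_erase hi)
        linear_combination (h l * (t l - a)⁻¹ * (∏ m, (1 + (t l - z m)⁻¹)) *
          ∏ j ∈ S.erase l, (1 - (t l - t j)⁻¹)) * this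

end chainCoeff

end GL4Weight

end
noncomputable section

namespace GL4Weight

/-! ### Adjacent transpositions, inversions and the lift of the braid relations -/

section Perm

open Equiv

variable {n : ℕ}

/-- The transposition of `i` and `i + 1`. -/
def adj (i : Fin n) : Perm (Fin (n + 1)) := swap i.castSucc i.succ

theorem adj_mul_self (i : Fin n) : adj i * adj i = 1 := swap_mul_self _ _

theorem adj_mul_adj_mul (i : Fin n) (w : Perm (Fin (n + 1))) : adj i * (adj i * w) = w := by
  rw [← mul_assoc, adj_mul_self, one_mul]

theorem adj_inv (i : Fin n) : (adj i)⁻¹ = adj i := swap_inv _ _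

theorem adj_castSucc (i : Fin n) : adj i i.castSucc = i.succ := swap_apply_left _ _

theorem adj_succ (i : Fin n) : adj i i.succ = i.castSucc := swap_apply_right _ _

theorem adj_of_ne {i : Fin n} {a : Fin (n + 1)} (h : a ≠ i.castSucc) (h' : a ≠ i.succ) :
    adj i a = a := swap_apply_of_ne_of_ne h h'

theorem adj_lt_adj {i : Fin n} {a b : Fin (n + 1)} (h : a < b)
    (h' : ¬(a = i.castSucc ∧ b = i.succ)) : adj i a < adj i b := by
  simp only [adj, swap_apply_def, Fin.ext_iff, Fin.lt_def, Fin.val_castSucc, Fin.val_succ] at h h' ⊢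
  split_ifs <;> (try simp only [Fin.val_castSucc, Fin.val_succ]) <;> omega

/-- The inversions of `w⁻¹`. -/
def inversions (w : Perm (Fin (n + 1))) : Finset (Fin (n + 1) × Fin (n + 1)) :=
  {p | p.1 < p.2 ∧ w⁻¹ p.2 < w⁻¹ p.1}

theorem mem_inversions {w : Perm (Fin (n + 1))} {p : Fin (n + 1) × Fin (n + 1)} :
    p ∈ inversions w ↔ p.1 < p.2 ∧ w⁻¹ p.2 < w⁻¹ p.1 := by simp [inversions]

theorem inv_adj_mul (i : Fin n) (w : Perm (Fin (n + 1))) (a : Fin (n + 1)) :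
    (adj i * w)⁻¹ a = w⁻¹ (adj i a) := by
  rw [mul_inv_rev, adj_inv, Perm.mul_apply]

/-- `i` is a left descent of `w`. -/
def IsDescent (w : Perm (Fin (n + 1))) (i : Fin n) : Prop := w⁻¹ i.succ < w⁻¹ i.castSucc

theorem isDescent_adj_mul_self {w : Perm (Fin (n + 1))} {i : Fin n} :
    IsDescent (adj i * w) i ↔ ¬IsDescent w i := by
  have : w⁻¹ i.succ ≠ w⁻¹ i.castSucc := by simp [Fin.ext_iff]
  simp only [IsDescent, inv_adj_mul, adj_castSucc, adj_succ, not_lt]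
  exact ⟨le_of_lt, fun h => lt_of_le_of_ne h this.symm⟩

/-- The transposition of i and i + 1 preserves the order of every pair a < b except (i, i + 1), so
it transports all inversions and creates exactly one. -/
theorem inversions_adj_mul {w : Perm (Fin (n + 1))} {i : Fin n} (h : ¬IsDescent w i) :
    inversions (adj i * w) = insert (i.castSucc, i.succ)
      ((inversions w).map ((adj i).prodCongr (adj i)).toEmbedding) := by
  have hd := isDescent_adj_mul_self.mpr h
  ext ⟨a, b⟩
  have hmap : (a, b) ∈ (inversions w).map ((adj i).prodCongr (adj i)).toEmbedding ↔
      (adj i a, adj i b) ∈ inversions w := by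
    rw [Finset.mem_map_equiv]
    rfl
  rw [Finset.mem_insert, hmap, mem_inversions, mem_inversions, inv_adj_mul, inv_adj_mul]
  by_cases hab : a = i.castSucc ∧ b = i.succ
  · obtain ⟨rfl, rfl⟩ := hab
    simp only [true_or, iff_true]
    refine ⟨Fin.castSucc_lt_succ, ?_⟩
    simpa only [IsDescent, inv_adj_mul] using hd
  · have hne : ¬(a, b) = (i.castSucc, i.succ) := by simpa using hab
    simp only [hne, false_or]
    refine and_congr_left fun h2 => ⟨fun h3 => adj_lt_adj h3 hab, fun h3 => ?_⟩
    have h4 : ¬(adj i a = i.castSucc ∧ adj i b = i.succ) := by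
      rintro ⟨e1, e2⟩
      rw [e1, e2] at h2
      exact h h2
    have := adj_lt_adj h3 h4
    rwa [← Perm.mul_apply, ← Perm.mul_apply, adj_mul_self] at this

theorem prod_inversions_adj_mul {M : Type*} [CommMonoid M] {w : Perm (Fin (n + 1))} {i : Fin n}
    (h : ¬IsDescent w i) (c : Fin (n + 1) × Fin (n + 1) → M) :
    ∏ p ∈ inversions (adj i * w), c p =
      c (i.castSucc, i.succ) * ∏ p ∈ inversions w, c (adj i p.1, adj i p.2) := by
  rw [inversions_adj_mul h, Finset.prod_insert, Finset.prod_map]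
  · rfl
  · rw [Finset.mem_map_equiv, mem_inversions]
    rintro ⟨h1, -⟩
    have : ((adj i).prodCongr (adj i)).symm (i.castSucc, i.succ) = (i.succ, i.castSucc) := by
      rw [Equiv.symm_apply_eq]
      simp [adj_castSucc, adj_succ]
    rw [this] at h1
    exact absurd h1 (not_lt.mpr Fin.castSucc_lt_succ.le)

/-- The length of a permutation. -/
def permLength (w : Perm (Fin (n + 1))) : ℕ := (inversions w).card

theorem permLength_adj_mul {w : Perm (Fin (n + 1))} {i : Fin n} (h : ¬IsDescent w i) :
    permLength (adj i * w) = permLength w + 1 := by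
  have := prod_inversions_adj_mul (M := Multiplicative ℕ) h fun _ => Multiplicative.ofAdd 1
  simp only [Finset.prod_const, ← ofAdd_nsmul, ← ofAdd_add] at this
  have := Multiplicative.ofAdd.injective this
  simpa [permLength, add_comm] using this

theorem permLength_of_isDescent {w : Perm (Fin (n + 1))} {i : Fin n} (h : IsDescent w i) :
    permLength w = permLength (adj i * w) + 1 := by
  have h' : ¬IsDescent (adj i * w) i := by rw [isDescent_adj_mul_self, not_not]; exact h
  rw [← permLength_adj_mul h', adj_mul_adj_mul]

theorem permLength_le_adj_mul (w : Perm (Fin (n + 1))) (i : Fin n) :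
    permLength w ≤ permLength (adj i * w) + 1 := by
  by_cases h : IsDescent w i
  · exact (permLength_of_isDescent h).le
  · rw [permLength_adj_mul h]; omega

theorem eq_one_of_strictMono {w : Perm (Fin (n + 1))} (h : StrictMono w) : w = 1 := by
  have := Subsingleton.elim (h.orderIsoOfSurjective _ w.surjective) (OrderIso.refl _)
  ext i
  exact congrArg Fin.val (DFunLike.congr_fun this i)

theorem eq_one_of_not_isDescent {w : Perm (Fin (n + 1))} (h : ∀ i, ¬IsDescent w i) : w = 1 := by
  have : StrictMono (w⁻¹ : Perm (Fin (n + 1))) := Fin.strictMono_iff_lt_succ.mpr fun i =>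
    lt_of_le_of_ne (not_lt.mp (h i)) (by simp [Fin.ext_iff])
  rw [← inv_inv w, eq_one_of_strictMono this, inv_one]

theorem not_isDescent_one (i : Fin n) : ¬IsDescent 1 i :=
  not_lt.mpr Fin.castSucc_lt_succ.le

theorem inversions_revPerm :
    inversions (Fin.revPerm : Perm (Fin (n + 1))) = ({p | p.1 < p.2} : Finset _) := by
  ext p
  have : (Fin.revPerm : Perm (Fin (n + 1)))⁻¹ = Fin.revPerm := rfl
  simp [inversions, this]

/-- If every pair is an inversion of `w⁻¹`, then w₀w⁻¹ is strictly increasing, hence the identity.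
So w₀ is the only permutation of maximal length. -/
theorem permLength_lt_revPerm {w : Perm (Fin (n + 1))} (h : w ≠ Fin.revPerm) :
    permLength w < permLength (Fin.revPerm : Perm (Fin (n + 1))) := by
  have hsub : inversions w ⊆ inversions Fin.revPerm := by
    intro p hp
    rw [inversions_revPerm]
    simpa using (mem_inversions.mp hp).1
  refine Finset.card_lt_card (hsub.ssubset_of_ne fun heq => h ?_)
  have h1 : StrictMono (Fin.revPerm * w⁻¹ : Perm (Fin (n + 1))) := by
    intro a b hab
    have hm : (a, b) ∈ inversions w := by
      rw [heq, inversions_revPerm]; simpa using hab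
    simpa using (mem_inversions.mp hm).2
  have h2 := eq_one_of_strictMono h1
  rw [mul_inv_eq_one] at h2
  exact h2.symm

open Classical in
/-- The product of the `g i` along a reduced word of `w`. -/
def permLift {M : Type*} [Monoid M] (g : Fin n → M) (w : Perm (Fin (n + 1))) : M :=
  if h : ∃ i, IsDescent w i then g h.choose * permLift g (adj h.choose * w) else 1
termination_by permLength w
decreasing_by rw [permLength_of_isDescent h.choose_spec]; omega

theorem permLift_one {M : Type*} [Monoid M] (g : Fin n → M) : permLift g 1 = 1 := by
  rw [permLift, dif_neg]
  rintro ⟨i, hi⟩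
  exact not_isDescent_one i hi

theorem isDescent_adj_mul_of_far {w : Perm (Fin (n + 1))} {i j : Fin n}
    (h : (i : ℕ) + 2 ≤ j ∨ (j : ℕ) + 2 ≤ i) : IsDescent (adj i * w) j ↔ IsDescent w j := by
  have h1 : adj i j.castSucc = j.castSucc := adj_of_ne
    (by simp only [ne_eq, Fin.ext_iff, Fin.val_castSucc]; omega)
    (by simp only [ne_eq, Fin.ext_iff, Fin.val_castSucc, Fin.val_succ]; omega)
  have h2 : adj i j.succ = j.succ := adj_of_ne
    (by simp only [ne_eq, Fin.ext_iff, Fin.val_castSucc, Fin.val_succ]; omega)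
    (by simp only [ne_eq, Fin.ext_iff, Fin.val_succ]; omega)
  simp only [IsDescent, inv_adj_mul, h1, h2]

theorem adj_commute_of_far {i j : Fin n} (h : (i : ℕ) + 2 ≤ j ∨ (j : ℕ) + 2 ≤ i) :
    adj i * adj j = adj j * adj i := by
  refine (Perm.Disjoint.commute ?_).eq
  refine Perm.disjoint_swap_swap ?_
  simp [Fin.ext_iff]
  omega

theorem adj_braid {i j : Fin n} (h : (i : ℕ) + 1 = j) :
    adj i * adj j * adj i = adj j * adj i * adj j := by
  have hij : i.succ = j.castSucc := by simp [Fin.ext_iff, h]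
  have h1 : i.castSucc ≠ j.castSucc := by simp [Fin.ext_iff]; omega
  have h2 : i.castSucc ≠ j.succ := by simp [Fin.ext_iff]; omega
  have h3 : j.castSucc ≠ j.succ := by simp [Fin.ext_iff]
  unfold adj
  rw [hij, swap_comm i.castSucc j.castSucc, swap_comm j.castSucc j.succ,
    swap_mul_swap_mul_swap h3.symm h2.symm, swap_comm j.succ j.castSucc,
    swap_comm j.castSucc i.castSucc, swap_mul_swap_mul_swap h1 h2, swap_comm]

/-- Independence of the reduced word, by induction on length. For two descents i < j at distance at
least 2, both words can be continued by the other letter and the letters commute. For neighbours, w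
begins with the longest element on three letters, so both words can be continued to full braids,
which agree. -/
theorem permLift_of_isDescent {M : Type*} [Monoid M] (g : Fin n → M)
    (hfar : ∀ i j : Fin n, (i : ℕ) + 2 ≤ j → g i * g j = g j * g i)
    (hbraid : ∀ i j : Fin n, (i : ℕ) + 1 = j → g i * g j * g i = g j * g i * g j)
    {w : Perm (Fin (n + 1))} {i : Fin n} (h : IsDescent w i) :
    permLift g w = g i * permLift g (adj i * w) := by
  induction hN : permLength w using Nat.strong_induction_on generalizing w i with
  | _ N ih =>
  subst hN
  have ih' : ∀ {u : Perm (Fin (n + 1))} {i : Fin n}, permLength u < permLength w →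
      IsDescent u i → permLift g u = g i * permLift g (adj i * u) :=
    fun hu hi => ih _ hu hi rfl
  have lt : ∀ {u : Perm (Fin (n + 1))} {i : Fin n}, IsDescent u i →
      permLength (adj i * u) < permLength u := fun hi => by
    rw [permLength_of_isDescent hi]; omega
  have key : ∀ i j : Fin n, (i : ℕ) < j → IsDescent w i → IsDescent w j →
      g i * permLift g (adj i * w) = g j * permLift g (adj j * w) := by
    intro i j hij hi hj
    rcases (Nat.succ_le_of_lt hij).eq_or_lt with hij | hij
    · have hsc : i.succ = j.castSucc := by simp [Fin.ext_iff, ← hij]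
      have e1 : adj i j.succ = j.succ := adj_of_ne
        (by simp only [ne_eq, Fin.ext_iff, Fin.val_castSucc, Fin.val_succ]; omega)
        (by simp only [ne_eq, Fin.ext_iff, Fin.val_succ]; omega)
      have e2 : adj j i.castSucc = i.castSucc := adj_of_ne
        (by simp only [ne_eq, Fin.ext_iff, Fin.val_castSucc]; omega)
        (by simp only [ne_eq, Fin.ext_iff, Fin.val_castSucc, Fin.val_succ]; omega)
      have e3 : adj j i.succ = j.succ := by rw [hsc, adj_castSucc]
      have e4 : adj i j.castSucc = i.castSucc := by rw [← hsc, adj_succ]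
      have d1 : IsDescent (adj i * w) j := by
        rw [IsDescent, inv_adj_mul, inv_adj_mul, e1, e4]
        exact lt_trans hj (by rw [← hsc]; exact hi)
      have d2 : IsDescent (adj j * (adj i * w)) i := by
        rw [IsDescent]
        simp only [inv_adj_mul]
        rw [e2, e3, e1, adj_castSucc, hsc]
        exact hj
      have d3 : IsDescent (adj j * w) i := by
        rw [IsDescent, inv_adj_mul, inv_adj_mul, e2, e3]
        exact lt_trans hj (by rw [← hsc]; exact hi)
      have d4 : IsDescent (adj i * (adj j * w)) j := by
        rw [IsDescent]
        simp only [inv_adj_mul]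
        rw [e1, e4, e2, adj_succ, ← hsc]
        exact hi
      rw [ih' (lt hi) d1, ih' ((lt d1).trans (lt hi)) d2, ih' (lt hj) d3,
        ih' ((lt d3).trans (lt hj)) d4]
      simp only [← mul_assoc]
      rw [hbraid i j hij, adj_braid hij]
    · have hf : (i : ℕ) + 2 ≤ j ∨ (j : ℕ) + 2 ≤ i := Or.inl hij
      rw [ih' (lt hi) ((isDescent_adj_mul_of_far hf).mpr hj),
        ih' (lt hj) ((isDescent_adj_mul_of_far hf.symm).mpr hi), ← mul_assoc, ← mul_assoc,
        hfar i j hij, ← mul_assoc, ← mul_assoc, adj_commute_of_far hf]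
  have hex : ∃ i, IsDescent w i := ⟨i, h⟩
  have hw : permLift g w = g hex.choose * permLift g (adj hex.choose * w) := by
    rw [permLift, dif_pos hex]
  rw [hw]
  rcases lt_trichotomy (hex.choose : ℕ) i with hlt | heq | hlt
  · exact key _ _ hlt hex.choose_spec h
  · rw [Fin.ext heq]
  · exact (key _ _ hlt h hex.choose_spec).symm

/-- If the `g i` satisfy the relations of the symmetric group, `permLift g` is multiplicative. -/
theorem permLift_adj_mul {M : Type*} [Monoid M] (g : Fin n → M) (hsq : ∀ i, g i * g i = 1)
    (hfar : ∀ i j : Fin n, (i : ℕ) + 2 ≤ j → g i * g j = g j * g i)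
    (hbraid : ∀ i j : Fin n, (i : ℕ) + 1 = j → g i * g j * g i = g j * g i * g j)
    (i : Fin n) (w : Perm (Fin (n + 1))) :
    permLift g (adj i * w) = g i * permLift g w := by
  by_cases h : IsDescent w i
  · rw [permLift_of_isDescent g hfar hbraid h, ← mul_assoc, hsq, one_mul]
  · rw [permLift_of_isDescent g hfar hbraid (isDescent_adj_mul_self.mpr h), adj_mul_adj_mul]

theorem perm_induction {p : Perm (Fin (n + 1)) → Prop} (one : p 1)
    (mul : ∀ i w, p w → p (adj i * w)) (w : Perm (Fin (n + 1))) : p w := by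
  induction hN : permLength w using Nat.strong_induction_on generalizing w with
  | _ N ih =>
  by_cases h : ∃ i, IsDescent w i
  · obtain ⟨i, hi⟩ := h
    rw [← adj_mul_adj_mul i w]
    exact mul i _ (ih _ (by rw [← hN, permLength_of_isDescent hi]; omega) _ rfl)
  · rw [eq_one_of_not_isDescent (not_exists.mp h)]
    exact one

end Perm

end GL4Weight

end
noncomputable section

namespace GL4Weight

/-! ### The exchange operators and the pairing defined by the weighted symmetrization -/

section Exchange

open Equiv

variable {n : ℕ} (z : Fin (n + 1) → ℂ)

/-- The exchange operators on functions on the orbit of `z` under permutations. -/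
def exchange (i : Fin n) : Module.End ℂ (Perm (Fin (n + 1)) → ℂ) where
  toFun f σ := (1 + (z (σ i.castSucc) - z (σ i.succ))⁻¹) * f (σ * adj i) -
    (z (σ i.castSucc) - z (σ i.succ))⁻¹ * f σ
  map_add' f g := by funext σ; simp only [Pi.add_apply]; ring
  map_smul' c f := by funext σ; simp only [Pi.smul_apply, smul_eq_mul, RingHom.id_apply]; ring

theorem exchange_apply (i : Fin n) (f : Perm (Fin (n + 1)) → ℂ) (σ : Perm (Fin (n + 1))) :
    exchange z i f σ = (1 + (z (σ i.castSucc) - z (σ i.succ))⁻¹) * f (σ * adj i) -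
      (z (σ i.castSucc) - z (σ i.succ))⁻¹ * f σ := rfl

variable {z} (hz : Function.Injective z)

include hz in
theorem sub_ne_zero_of_perm (σ : Perm (Fin (n + 1))) {a b : Fin (n + 1)} (h : a ≠ b) :
    z (σ a) - z (σ b) ≠ 0 :=
  sub_ne_zero.mpr fun e => h (σ.injective (hz e))

include hz in
theorem exchange_mul_self (i : Fin n) : exchange z i * exchange z i = 1 := by
  refine LinearMap.ext fun f => funext fun σ => ?_
  have h1 := sub_ne_zero_of_perm hz σ (Fin.castSucc_lt_succ (i := i)).ne
  have h2 := sub_ne_zero_of_perm hz σ (Fin.castSucc_lt_succ (i := i)).ne'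
  have e : (z (σ i.succ) - z (σ i.castSucc))⁻¹ = -(z (σ i.castSucc) - z (σ i.succ))⁻¹ := by
    rw [← neg_sub, inv_neg]
  simp only [Module.End.mul_apply, exchange_apply, Perm.mul_apply, adj_castSucc, adj_succ, mul_assoc,
    adj_mul_self, mul_one, Module.End.one_apply, e]
  ring

theorem exchange_far (i j : Fin n) (h : (i : ℕ) + 2 ≤ j) :
    exchange z i * exchange z j = exchange z j * exchange z i := by
  refine LinearMap.ext fun f => funext fun σ => ?_
  have h1 : adj i j.castSucc = j.castSucc := adj_of_ne
    (by simp only [ne_eq, Fin.ext_iff, Fin.val_castSucc]; omega)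
    (by simp only [ne_eq, Fin.ext_iff, Fin.val_castSucc, Fin.val_succ]; omega)
  have h2 : adj i j.succ = j.succ := adj_of_ne
    (by simp only [ne_eq, Fin.ext_iff, Fin.val_castSucc, Fin.val_succ]; omega)
    (by simp only [ne_eq, Fin.ext_iff, Fin.val_succ]; omega)
  have h3 : adj j i.castSucc = i.castSucc := adj_of_ne
    (by simp only [ne_eq, Fin.ext_iff, Fin.val_castSucc]; omega)
    (by simp only [ne_eq, Fin.ext_iff, Fin.val_castSucc, Fin.val_succ]; omega)
  have h4 : adj j i.succ = i.succ := adj_of_ne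
    (by simp only [ne_eq, Fin.ext_iff, Fin.val_castSucc, Fin.val_succ]; omega)
    (by simp only [ne_eq, Fin.ext_iff, Fin.val_succ]; omega)
  simp only [Module.End.mul_apply, exchange_apply, Perm.mul_apply, h1, h2, h3, h4, mul_assoc,
    adj_commute_of_far (Or.inl h)]
  ring

include hz in
theorem exchange_braid (i j : Fin n) (h : (i : ℕ) + 1 = j) :
    exchange z i * exchange z j * exchange z i = exchange z j * exchange z i * exchange z j := by
  refine LinearMap.ext fun f => funext fun σ => ?_
  have hsc : j.castSucc = i.succ := by simp [Fin.ext_iff, h]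
  have e1 : adj i j.succ = j.succ := adj_of_ne
    (by simp only [ne_eq, Fin.ext_iff, Fin.val_castSucc, Fin.val_succ]; omega)
    (by simp only [ne_eq, Fin.ext_iff, Fin.val_succ]; omega)
  have e2 : adj j i.castSucc = i.castSucc := adj_of_ne
    (by simp only [ne_eq, Fin.ext_iff, Fin.val_castSucc]; omega)
    (by simp only [ne_eq, Fin.ext_iff, Fin.val_castSucc, Fin.val_succ]; omega)
  have e3 : adj j i.succ = j.succ := by rw [← hsc, adj_castSucc]
  have e4 : adj j j.succ = i.succ := by rw [adj_succ, hsc]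
  have hb : adj i * (adj j * adj i) = adj j * (adj i * adj j) := by
    rw [← mul_assoc, ← mul_assoc, adj_braid h]
  have h12 := sub_ne_zero_of_perm hz σ (Fin.castSucc_lt_succ (i := i)).ne
  have h23 := sub_ne_zero_of_perm hz σ (Fin.castSucc_lt_succ (i := j)).ne
  have h13 := sub_ne_zero_of_perm hz σ (a := i.castSucc) (b := j.succ)
    (by simp only [ne_eq, Fin.ext_iff, Fin.val_castSucc, Fin.val_succ]; omega)
  have inv : ∀ a b : ℂ, (a - b)⁻¹ = -(b - a)⁻¹ := fun a b => by rw [← neg_sub, inv_neg]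
  rw [hsc] at h23
  simp only [Module.End.mul_apply, exchange_apply, Perm.mul_apply, hsc, e1, e2, e3, e4, mul_assoc,
    adj_castSucc, adj_succ, adj_mul_self, mul_one, hb]
  rw [inv (z (σ i.succ)) (z (σ i.castSucc)), inv (z (σ j.succ)) (z (σ i.succ))]
  generalize z (σ i.castSucc) = a at *
  generalize z (σ i.succ) = b at *
  generalize z (σ j.succ) = c at *
  -- The one relation among the three inverse differences behind the braid identity; with it the
  -- inverses may be treated as independent variables.
  have key : (a - b)⁻¹ * (b - c)⁻¹ = (a - c)⁻¹ * ((a - b)⁻¹ + (b - c)⁻¹) := by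
    field_simp; ring
  generalize (a - b)⁻¹ = x at *
  generalize (b - c)⁻¹ = y at *
  generalize (a - c)⁻¹ = w at *
  linear_combination ((1 + x) * f (σ * adj i) - (x - y) * f σ - (1 + y) * f (σ * adj j)) * key

variable (z) in
/-- The action of permutations on functions on the orbit of `z` that extends the exchange
operators. -/
def orbitAction (w : Perm (Fin (n + 1))) : Module.End ℂ (Perm (Fin (n + 1)) → ℂ) :=
  permLift (exchange z) w

theorem orbitAction_one : orbitAction z 1 = 1 := permLift_one _

include hz in
theorem orbitAction_adj_mul (i : Fin n) (w : Perm (Fin (n + 1))) :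
    orbitAction z (adj i * w) = exchange z i * orbitAction z w :=
  permLift_adj_mul _ (exchange_mul_self hz) exchange_far (exchange_braid hz) i w

include hz in
-- Triangularity: each letter of a reduced word of `w` either stays at the current point or
-- multiplies it by an adjacent transposition, so values at σ only involve points σu with u no
-- longer than `w`.
theorem orbitAction_single_eq_zero (w : Perm (Fin (n + 1))) :
    ∀ σ π : Perm (Fin (n + 1)), permLength w < permLength (σ⁻¹ * π) →
      orbitAction z w (Pi.single π 1) σ = 0 := by
  induction hN : permLength w using Nat.strong_induction_on generalizing w with
  | _ N ih =>
  subst hN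
  intro σ π h
  by_cases hd : ∃ i, IsDescent w i
  · obtain ⟨i, hi⟩ := hd
    have hl := permLength_of_isDescent hi
    rw [← adj_mul_adj_mul i w, orbitAction_adj_mul hz, Module.End.mul_apply, exchange_apply,
      ih _ (by omega) _ rfl σ π (by omega), ih _ (by omega) _ rfl (σ * adj i) π, mul_zero,
      mul_zero, sub_zero]
    rw [mul_inv_rev, adj_inv, mul_assoc]
    have := permLength_le_adj_mul (σ⁻¹ * π) i
    omega
  · have hw := eq_one_of_not_isDescent (not_exists.mp hd)
    rw [hw, orbitAction_one, Module.End.one_apply, Pi.single_apply, if_neg]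
    rintro rfl
    rw [hw, inv_mul_cancel] at h
    exact lt_irrefl _ h

include hz in
-- The leading coefficient: σw is reached from σ only if every letter of the reduced word moves the
-- point. Each move contributes a factor `1 + (z a - z b)⁻¹`, and the factors are indexed by the
-- inversions.
theorem orbitAction_single_mul (w : Perm (Fin (n + 1))) :
    ∀ σ : Perm (Fin (n + 1)), orbitAction z w (Pi.single (σ * w) 1) σ =
      ∏ p ∈ inversions w, (1 + (z (σ p.1) - z (σ p.2))⁻¹) := by
  induction hN : permLength w using Nat.strong_induction_on generalizing w with
  | _ N ih =>
  subst hN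
  intro σ
  by_cases hd : ∃ i, IsDescent w i
  · obtain ⟨i, hi⟩ := hd
    have hl := permLength_of_isDescent hi
    obtain ⟨u, rfl⟩ : ∃ u, w = adj i * u := ⟨adj i * w, (adj_mul_adj_mul i w).symm⟩
    rw [adj_mul_adj_mul] at hl
    have := ih _ (by omega) u rfl (σ * adj i)
    rw [orbitAction_adj_mul hz, Module.End.mul_apply, exchange_apply,
      orbitAction_single_eq_zero hz u σ (σ * (adj i * u)), mul_zero, sub_zero,
      prod_inversions_adj_mul (isDescent_adj_mul_self.mp hi),
      ← mul_assoc, this]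
    · rfl
    · rw [inv_mul_cancel_left]; omega
  · have hw := eq_one_of_not_isDescent (not_exists.mp hd)
    have : inversions (1 : Perm (Fin (n + 1))) = ∅ := by
      ext p
      simp only [mem_inversions, inv_one, Perm.one_apply, Finset.notMem_empty, iff_false, not_and,
        not_lt]
      exact le_of_lt
    simp [hw, orbitAction_one, this]

theorem adj_mul_revPerm (i : Fin n) :
    adj i * Fin.revPerm = Fin.revPerm * adj i.rev := by
  have h := Equiv.mul_swap_eq_swap_mul (Fin.revPerm : Perm (Fin (n + 1))) i.rev.castSucc i.rev.succ
  unfold adj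
  rw [h]
  simp only [Fin.revPerm_apply, Fin.rev_castSucc, Fin.rev_succ, Fin.rev_rev]
  rw [swap_comm]

theorem revPerm_mul_adj (i : Fin n) :
    Fin.revPerm * adj i = adj i.rev * Fin.revPerm := by
  rw [adj_mul_revPerm, Fin.rev_rev]

include hz in
/-- A sum over all permutations that does not depend on the point of the orbit. -/
theorem sum_orbitAction_eq (f h : Perm (Fin (n + 1)) → ℂ) (σ : Perm (Fin (n + 1))) :
    ∑ τ, orbitAction z τ f σ * orbitAction z (Fin.revPerm * τ) h (σ * Fin.revPerm) =
      ∑ τ, orbitAction z τ f 1 * orbitAction z (Fin.revPerm * τ) h Fin.revPerm := by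
  have step : ∀ (σ : Perm (Fin (n + 1))) (i : Fin n),
      ∑ τ, orbitAction z τ f (σ * adj i) *
          orbitAction z (Fin.revPerm * τ) h (σ * adj i * Fin.revPerm) =
        ∑ τ, orbitAction z τ f σ * orbitAction z (Fin.revPerm * τ) h (σ * Fin.revPerm) := by
    intro σ i
    -- The summands are not individually invariant under the move from σ to `σ * adj i`; the sums
    -- over the pairs {τ, `adj i * τ`} are. Left multiplication of w₀τ by the transposition with
    -- index `i.rev` matches that of τ by `adj i`, since w₀ conjugates one into the other.
    have double : ∀ g : Perm (Fin (n + 1)) → ℂ, 2 * ∑ τ, g τ = ∑ τ, (g τ + g (adj i * τ)) := by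
      intro g
      rw [Finset.sum_add_distrib, Fintype.sum_equiv (Equiv.mulLeft (adj i))
        (fun τ => g (adj i * τ)) g fun τ => rfl, two_mul]
    refine mul_left_cancel₀ (two_ne_zero (α := ℂ)) ?_
    rw [double, double]
    refine Finset.sum_congr rfl fun τ _ => ?_
    have hu := sub_ne_zero_of_perm hz σ (Fin.castSucc_lt_succ (i := i)).ne
    have inv : (z (σ i.succ) - z (σ i.castSucc))⁻¹ = -(z (σ i.castSucc) - z (σ i.succ))⁻¹ := by
      rw [← neg_sub, inv_neg]
    rw [← mul_assoc Fin.revPerm, revPerm_mul_adj, mul_assoc (adj i.rev), orbitAction_adj_mul hz,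
      orbitAction_adj_mul hz]
    simp only [Module.End.mul_apply, exchange_apply]
    generalize orbitAction z τ f = F
    generalize orbitAction z (Fin.revPerm * τ) h = H
    have e1 : σ * adj i * Fin.revPerm = σ * Fin.revPerm * adj i.rev := by
      rw [mul_assoc, adj_mul_revPerm, mul_assoc]
    have e2 : σ * adj i * Fin.revPerm * adj i.rev = σ * Fin.revPerm := by
      rw [e1, mul_assoc, adj_mul_self, mul_one]
    have e3 : σ * adj i * adj i = σ := by rw [mul_assoc, adj_mul_self, mul_one]
    rw [e2, e3, ← e1]
    simp only [Perm.mul_apply, Fin.revPerm_apply, Fin.rev_castSucc, Fin.rev_succ, Fin.rev_rev,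
      adj_castSucc, adj_succ, inv]
    generalize F σ = F0
    generalize F (σ * adj i) = F1
    generalize H (σ * Fin.revPerm) = K0
    generalize H (σ * adj i * Fin.revPerm) = K1
    ring
  have all : ∀ w σ : Perm (Fin (n + 1)),
      ∑ τ, orbitAction z τ f (σ * w) * orbitAction z (Fin.revPerm * τ) h (σ * w * Fin.revPerm) =
        ∑ τ, orbitAction z τ f σ * orbitAction z (Fin.revPerm * τ) h (σ * Fin.revPerm) := by
    intro w
    induction w using perm_induction with
    | one => intro σ; rw [mul_one]
    | mul i w ih => intro σ; rw [← mul_assoc, ih, step]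
  simpa using all σ 1

include hz in
-- Identifies the weight with the leading coefficient of w₀ at the base point πw₀: reversing the
-- order turns `1 - (a - b)⁻¹` into `1 + (b - a)⁻¹`.
theorem Q_comp_perm (π : Perm (Fin (n + 1))) :
    Q (z ∘ π) = ∏ p ∈ inversions (Fin.revPerm : Perm (Fin (n + 1))),
      (1 + (z ((π * Fin.revPerm : Perm _) p.1) - z ((π * Fin.revPerm : Perm _) p.2))⁻¹) := by
  unfold Q
  rw [Finset.prod_sigma', inversions_revPerm]
  refine Finset.prod_bij' (fun p _ => (p.2.rev, p.1.rev)) (fun p _ => ⟨p.2.rev, p.1.rev⟩)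
    ?_ ?_ ?_ ?_ ?_
  · rintro ⟨a, b⟩ h; simpa using h
  · rintro ⟨a, b⟩ h; simpa using h
  · rintro ⟨a, b⟩ h; simp
  · rintro ⟨a, b⟩ h; simp
  · rintro ⟨a, b⟩ h
    have hab : a < b := by simpa using h
    have h1 := sub_ne_zero_of_perm hz π hab.ne
    have h2 : z (π b) - z (π a) ≠ 0 := sub_ne_zero_of_perm hz π hab.ne'
    simp only [Function.comp_apply, Perm.mul_apply, Fin.revPerm_apply, Fin.rev_rev]
    rw [← neg_sub (z (π a)) (z (π b)), inv_neg]
    field_simp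
    ring

include hz in
/-- The weighted symmetrization as a sum over the orbit action. -/
theorem sum_Q_mul_eq (f h : Perm (Fin (n + 1)) → ℂ) :
    ∑ σ : Perm (Fin (n + 1)), f σ * h σ * Q (z ∘ σ) =
      ∑ τ, orbitAction z τ f 1 * orbitAction z (Fin.revPerm * τ) h Fin.revPerm := by
  have hh : h = ∑ π, h π • (Pi.single π 1 : Perm (Fin (n + 1)) → ℂ) := by
    funext σ
    simp [Finset.sum_apply, Pi.single_apply]
  -- By linearity `h` may be a delta function at π. The base point is then moved to π, so that the
  -- second factor is evaluated at πw₀, at distance w₀ from the support. Triangularity kills every τ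
  -- except 1, and the surviving leading coefficient is `Q (z ∘ π)`.
  have single : ∀ π, ∑ τ, orbitAction z τ f 1 *
      orbitAction z (Fin.revPerm * τ) (Pi.single π 1) Fin.revPerm = f π * Q (z ∘ π) := by
    intro π
    rw [← sum_orbitAction_eq hz f _ π, Finset.sum_eq_single 1]
    · have := orbitAction_single_mul hz Fin.revPerm (π * Fin.revPerm)
      have e : π * Fin.revPerm * Fin.revPerm = π := by
        rw [mul_assoc]; ext; simp
      rw [e] at this
      rw [orbitAction_one, mul_one, this, Q_comp_perm hz]
      rfl
    · intro τ _ hτ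
      rw [orbitAction_single_eq_zero hz, mul_zero]
      have e : (π * Fin.revPerm)⁻¹ * π = Fin.revPerm := by
        rw [mul_inv_rev, mul_assoc, inv_mul_cancel, mul_one]; rfl
      rw [e]
      refine permLength_lt_revPerm fun h' => hτ ?_
      simpa using h'
    · simp
  conv_rhs => rw [hh]
  simp only [map_sum, map_smul, Finset.sum_apply, Pi.smul_apply, smul_eq_mul, Finset.mul_sum]
  rw [Finset.sum_comm]
  refine Finset.sum_congr rfl fun π _ => ?_
  have := single π
  rw [mul_right_comm, ← this, Finset.sum_mul]
  refine Finset.sum_congr rfl fun τ _ => ?_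
  ring

end Exchange

end GL4Weight

end
noncomputable section

namespace GL4Weight

section Symmetrization

open Equiv

/-! ### The exchange action on the coefficients of Bethe vectors -/

/-- This is `chainCoeff_swap` read on the orbit: on coefficients of Bethe vectors the exchange
operators act by permuting the spins, the evaluation points staying fixed. -/
theorem exchange_chainCoeff {ι : Type*} [DecidableEq ι] (h t : ι → ℂ) {n : ℕ}
    {z : Fin (n + 1) → ℂ} (hz : Function.Injective z) (S : Finset ι) (ht : Set.InjOn t S)
    (htz : ∀ i ∈ S, ∀ m, t i ≠ z m) (i : Fin n) (J : Fin (n + 1) → Bool) :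
    exchange z i (fun σ => chainCoeff h t (n + 1) (z ∘ σ) J S) =
      fun σ : Perm (Fin (n + 1)) => chainCoeff h t (n + 1) (z ∘ σ) (J ∘ adj i) S := by
  funext σ
  have hu := sub_ne_zero_of_perm hz σ (Fin.castSucc_lt_succ (i := i)).ne
  have := chainCoeff_swap h t i (z ∘ σ) J S ht fun i hi m => htz i hi (σ m)
  rw [exchange_apply]
  change (z (σ i.castSucc) - z (σ i.succ)) * chainCoeff h t (n + 1) (z ∘ σ) (J ∘ adj i) S =
    (z (σ i.castSucc) - z (σ i.succ) + 1) * chainCoeff h t (n + 1) (z ∘ (σ * adj i : Perm (Fin (n + 1)))) J S -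
      chainCoeff h t (n + 1) (z ∘ σ) J S at this
  field_simp
  linear_combination -this

theorem rev_comp_adj_rev {n : ℕ} (i : Fin n) :
    (Fin.rev : Fin (n + 1) → Fin (n + 1)) ∘ adj i.rev = adj i ∘ Fin.rev := by
  have := revPerm_mul_adj i.rev
  rw [Fin.rev_rev] at this
  exact congrArg DFunLike.coe this

/-- Negating the points and reversing their order each change the sign of a difference of
neighbours. The two signs cancel, so the second chain is governed by the same exchange operators as
the first. -/
theorem exchange_chainCoeff_rev {ι : Type*} [DecidableEq ι] (h t : ι → ℂ) {n : ℕ}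
    {z : Fin (n + 1) → ℂ} (hz : Function.Injective z) (S : Finset ι) (ht : Set.InjOn t S)
    (htz : ∀ i ∈ S, ∀ m, t i ≠ -z m) (i : Fin n) (J : Fin (n + 1) → Bool) :
    exchange z i (fun σ => chainCoeff h t (n + 1) (fun m => -z (σ m.rev)) (J ∘ Fin.rev) S) =
      fun σ => chainCoeff h t (n + 1) (fun m => -z (σ m.rev)) ((J ∘ adj i) ∘ Fin.rev) S := by
  funext σ
  have hu := sub_ne_zero_of_perm hz σ (Fin.castSucc_lt_succ (i := i)).ne
  have := chainCoeff_swap h t i.rev (fun m => -z (σ m.rev)) (J ∘ Fin.rev) S ht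
    fun i hi m => htz i hi _
  change (-z (σ i.rev.castSucc.rev) - -z (σ i.rev.succ.rev)) *
      chainCoeff h t (n + 1) _ (J ∘ (Fin.rev ∘ adj i.rev)) S =
    (-z (σ i.rev.castSucc.rev) - -z (σ i.rev.succ.rev) + 1) *
      chainCoeff h t (n + 1) ((fun m => -z (σ m)) ∘ (Fin.rev ∘ adj i.rev)) _ S - _ at this
  rw [rev_comp_adj_rev, Fin.rev_castSucc, Fin.rev_succ, Fin.rev_rev, neg_sub_neg] at this
  rw [exchange_apply]
  change _ * chainCoeff h t (n + 1) (fun m => -z (σ m.rev)) (J ∘ (adj i ∘ Fin.rev)) S =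
    _ * chainCoeff h t (n + 1) (fun m => -z ((σ * adj i) m.rev)) _ S - _ at this
  rw [Function.comp_assoc]
  field_simp
  linear_combination -this

theorem orbitAction_of_exchange {n : ℕ} {z : Fin (n + 1) → ℂ} (hz : Function.Injective z)
    (F : (Fin (n + 1) → Bool) → Perm (Fin (n + 1)) → ℂ)
    (hF : ∀ i J, exchange z i (F J) = F (J ∘ adj i)) (w : Perm (Fin (n + 1)))
    (J : Fin (n + 1) → Bool) : orbitAction z w (F J) = F (J ∘ (w⁻¹ : Perm (Fin (n + 1)))) := by
  induction w using perm_induction with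
  | one => rw [orbitAction_one]; rfl
  | mul i w ih => rw [orbitAction_adj_mul hz, Module.End.mul_apply, ih, hF, mul_inv_rev, adj_inv]; rfl

/-- The weighted symmetrization of a product of two coefficients of Bethe vectors. -/
theorem sum_chainCoeff_mul_chainCoeff {ι κ : Type*} [DecidableEq ι] [DecidableEq κ]
    (h t : ι → ℂ) (h' t' : κ → ℂ) {k : ℕ} {z : Fin k → ℂ} (hz : Function.Injective z)
    (S : Finset ι) (ht : Set.InjOn t S) (htz : ∀ i ∈ S, ∀ m, t i ≠ z m)
    (S' : Finset κ) (ht' : Set.InjOn t' S') (htz' : ∀ i ∈ S', ∀ m, t' i ≠ -z m)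
    (A B : Fin k → Bool) :
    ∑ σ : Perm (Fin k), chainCoeff h t k (z ∘ σ) A S *
        chainCoeff h' t' k (fun m => -z (σ m.rev)) (B ∘ Fin.rev) S' * Q (z ∘ σ) =
      ∑ τ : Perm (Fin k), chainCoeff h t k z (A ∘ τ) S *
        chainCoeff h' t' k (fun m => -z m) (B ∘ τ) S' := by
  cases k with
  | zero => simp [chainCoeff, Q]
  | succ n =>
    have := sum_Q_mul_eq hz (fun σ => chainCoeff h t (n + 1) (z ∘ σ) A S)
      (fun σ => chainCoeff h' t' (n + 1) (fun m => -z (σ m.rev)) (B ∘ Fin.rev) S')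
    -- The action of τ composes spins with τ⁻¹, whence the reindexing by inversion. At the base
    -- points 1 and w₀ both chains see the points in the original order, and w₀ cancels the reversal
    -- of the second configuration.
    rw [this, ← Equiv.sum_comp (Equiv.inv (Perm (Fin (n + 1))))]
    refine Finset.sum_congr rfl fun τ _ => ?_
    rw [orbitAction_of_exchange hz (fun J σ => chainCoeff h t (n + 1) (z ∘ σ) J S)
        (exchange_chainCoeff h t hz S ht htz),
      orbitAction_of_exchange hz
        (fun J σ => chainCoeff h' t' (n + 1) (fun m => -z (σ m.rev)) (J ∘ Fin.rev) S')
        (exchange_chainCoeff_rev h' t' hz S' ht' htz')]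
    have e1 : A ∘ ((Equiv.inv (Perm (Fin (n + 1))) τ)⁻¹ : Perm (Fin (n + 1))) = A ∘ τ := by simp
    have e2 : (B ∘ ((Fin.revPerm * Equiv.inv (Perm (Fin (n + 1))) τ)⁻¹ : Perm (Fin (n + 1)))) ∘
        Fin.rev = B ∘ τ := by
      funext m
      simp only [Equiv.inv_apply, mul_inv_rev, inv_inv, Function.comp_apply, Perm.mul_apply]
      exact congrArg (fun m => B (τ m)) (Fin.rev_rev m)
    have e3 : (fun m => -z ((Fin.revPerm : Perm (Fin (n + 1))) m.rev)) = fun m => -z m := by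
      funext m
      rw [Fin.revPerm_apply, Fin.rev_rev]
    simp only [e1, e2, e3, Perm.coe_one, Function.comp_id]

/-- The case of two chains without parameters: all coefficients equal 1, and the right side counts
permutations. -/
theorem sum_Q_comp_perm {k : ℕ} {z : Fin k → ℂ} (hz : Function.Injective z) :
    ∑ σ : Perm (Fin k), Q (z ∘ σ) = (k.factorial : ℂ) := by
  have := sum_chainCoeff_mul_chainCoeff (ι := Fin 0) (κ := Fin 0) 0 0 0 0 hz ∅ (by simp) (by simp)
    ∅ (by simp) (by simp) (fun _ => false) (fun _ => false)
  have e : ∀ (h t : Fin 0 → ℂ) (k : ℕ) (z : Fin k → ℂ),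
      chainCoeff h t k z (fun _ => false) ∅ = 1 := by
    intro h t k
    induction k with
    | zero => intro z; rfl
    | succ k ih =>
      intro z
      simp only [chainCoeff, Bool.false_eq_true, if_false]
      exact ih _
  simpa [Function.comp_def, e, Fintype.card_perm] using this

/-! ### Sums over the permutations of a labelling -/

/-- A sum over the permutations of a labelling as a sum over the labellings with the same
multiplicities. -/
theorem sum_comp_perm {α β : Type*} [Fintype α] [DecidableEq α] [Fintype β] [DecidableEq β]
    (L : α → β) (g : (α → β) → ℂ) :
    ∑ τ : Perm α, g (L ∘ τ) = ((∏ c, (Fintype.card {a // L a = c}).factorial : ℕ) : ℂ) *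
      ∑ L' : α → β with ∀ c, Fintype.card {a // L' a = c} = Fintype.card {a // L a = c}, g L' := by
  have fib : ∀ L' : α → β,
      (∀ c, Fintype.card {a // L' a = c} = Fintype.card {a // L a = c}) →
      Fintype.card {τ : Perm α // L ∘ τ = L'} =
        ∏ c, (Fintype.card {a // L a = c}).factorial := by
    intro L' hL'
    -- Matching the fibres gives one permutation that carries `L` to `L'`; all the others differ
    -- from it by the stabilizer of `L`, whose order is the product of the factorials.
    let e : ∀ c, {a // L' a = c} ≃ {a // L a = c} := fun c => Fintype.equivOfCardEq (hL' c)
    let τ₀ : Perm α :=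
      (Equiv.sigmaFiberEquiv L').symm.trans ((Equiv.sigmaCongrRight e).trans (sigmaFiberEquiv L))
    have h0 : L ∘ τ₀ = L' := by
      funext a
      exact (e (L' a) ⟨a, rfl⟩).2
    rw [← DomMulAct.stabilizer_card L]
    refine Fintype.card_congr (Equiv.subtypeEquiv (Equiv.mulRight τ₀⁻¹) fun τ => ?_)
    change L ∘ τ = L' ↔ L ∘ (τ * τ₀⁻¹ : Perm α) = L
    constructor
    · intro h
      funext a
      have := congrFun (h.trans h0.symm) (τ₀⁻¹ a)
      simpa using this
    · intro h
      rw [← h0]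
      funext a
      have := congrFun h (τ₀ a)
      simpa using this
  rw [← Finset.sum_fiberwise_of_maps_to (s := Finset.univ)
    (t := {L' : α → β | ∀ c, Fintype.card {a // L' a = c} = Fintype.card {a // L a = c}})
    (g := fun τ : Perm α => L ∘ τ), Finset.mul_sum]
  · refine Finset.sum_congr rfl fun L' hL' => ?_
    rw [← fib L' (by simpa using hL'), Fintype.card_subtype, Finset.sum_congr rfl (g := fun _ => g L'),
      Finset.sum_const, nsmul_eq_mul]
    intro τ hτ
    rw [(Finset.mem_filter.mp hτ).2]
  · intro τ _
    simp only [Finset.mem_filter, Finset.mem_univ, true_and]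
    intro c
    exact Fintype.card_congr (Equiv.subtypeEquiv τ fun a => Iff.rfl)

end Symmetrization

end GL4Weight

end
noncomputable section

namespace GL4Weight

section Weighted

open Equiv

/-! ### Weighted symmetrizations satisfy the recursion of the coefficients of Bethe vectors -/

theorem chainCoeff_map {ι κ : Type*} [DecidableEq ι] [DecidableEq κ] (h t : ι → ℂ) (e : κ ↪ ι)
    (k : ℕ) (z : Fin k → ℂ) (J : Fin k → Bool) (S : Finset κ) :
    chainCoeff h t k z J (S.map e) = chainCoeff (h ∘ e) (t ∘ e) k z J S := by
  induction k generalizing S with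
  | zero => rfl
  | succ k ih =>
    simp only [chainCoeff, Finset.sum_map, ← Finset.map_erase, Finset.prod_map, ih,
      Function.comp_apply]

/-- `∑_σ (∏_a φ_a(t_{σ(a)})) Q(t_{σ(1)}, …, t_{σ(ξ)})`, where `a` runs from `1` to `p ≤ ξ`. -/
def weightedSum {ξ p : ℕ} (hp : p ≤ ξ) (φ : Fin p → ℂ → ℂ) (t : Fin ξ → ℂ) : ℂ :=
  ∑ σ : Perm (Fin ξ), (∏ a, φ a (t (σ (Fin.castLE hp a)))) * Q (t ∘ σ)

/-- The permutation that maps `0` to `i` and acts on the other indices as `σ`. -/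
def permCons {n : ℕ} (i : Fin (n + 1)) (σ : Perm (Fin n)) : Perm (Fin (n + 1)) :=
  ((finSuccEquiv' 0).trans (Equiv.optionCongr σ)).trans (finSuccEquiv' i).symm

theorem permCons_zero {n : ℕ} (i : Fin (n + 1)) (σ : Perm (Fin n)) : permCons i σ 0 = i := by
  simp [permCons]

theorem permCons_succ {n : ℕ} (i : Fin (n + 1)) (σ : Perm (Fin n)) (j : Fin n) :
    permCons i σ j.succ = i.succAbove (σ j) := by
  have : finSuccEquiv' (0 : Fin (n + 1)) j.succ = some j := by
    rw [finSuccEquiv'_zero, finSuccEquiv_succ]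
  simp [permCons, this]

theorem permCons_bijective (n : ℕ) :
    Function.Bijective fun x : Fin (n + 1) × Perm (Fin n) => permCons x.1 x.2 := by
  rw [Fintype.bijective_iff_injective_and_card]
  constructor
  · rintro ⟨i, σ⟩ ⟨i', σ'⟩ h
    have h : permCons i σ = permCons i' σ' := h
    have h0 : i = i' := by
      rw [← permCons_zero i σ, ← permCons_zero i' σ', h]
    subst h0
    refine Prod.ext rfl (Equiv.ext fun j => ?_)
    have := DFunLike.congr_fun h j.succ
    rw [permCons_succ, permCons_succ] at this
    exact Fin.succAbove_right_injective this
  · simp [Fintype.card_perm, Nat.factorial_succ]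

theorem Q_succ {n : ℕ} (s : Fin (n + 1) → ℂ) :
    Q s = (∏ j : Fin n, (s 0 - s j.succ - 1) / (s 0 - s j.succ)) * Q fun j => s j.succ := by
  simp only [Q, Fin.prod_univ_succ (n := n), Fin.prod_Ioi_zero, Fin.prod_Ioi_succ]

/-- Permutations are sorted by i = σ(0). The factors of `Q` that involve the first variable do not
depend on the order of the others and can be taken out. -/
theorem weightedSum_succ {ξ p : ℕ} (hp : p + 1 ≤ ξ + 1) (φ : Fin (p + 1) → ℂ → ℂ)
    (t : Fin (ξ + 1) → ℂ) (ht : Function.Injective t) :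
    weightedSum hp φ t = ∑ i, φ 0 (t i) * (∏ j, (1 - (t i - t (i.succAbove j))⁻¹)) *
      weightedSum (Nat.le_of_succ_le_succ hp) (fun a => φ a.succ) (t ∘ i.succAbove) := by
  unfold weightedSum
  rw [← (permCons_bijective ξ).sum_comp, Fintype.sum_prod_type]
  refine Finset.sum_congr rfl fun i _ => ?_
  rw [Finset.mul_sum]
  refine Finset.sum_congr rfl fun σ _ => ?_
  have e1 : ∏ j : Fin ξ, (t i - t (i.succAbove (σ j)) - 1) / (t i - t (i.succAbove (σ j))) =
      ∏ j, (1 - (t i - t (i.succAbove j))⁻¹) := by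
    rw [Equiv.prod_comp σ fun j => (t i - t (i.succAbove j) - 1) / (t i - t (i.succAbove j))]
    refine Finset.prod_congr rfl fun j _ => ?_
    have : t i - t (i.succAbove j) ≠ 0 :=
      sub_ne_zero.mpr fun e => Fin.succAbove_ne i j (ht e).symm
    field_simp
  rw [Q_succ, Fin.prod_univ_succ]
  have c0 : Fin.castLE hp 0 = 0 := rfl
  have cs : ∀ a : Fin p, Fin.castLE hp a.succ = (Fin.castLE (Nat.le_of_succ_le_succ hp) a).succ :=
    fun a => rfl
  simp only [Function.comp_apply, c0, cs, permCons_zero, permCons_succ, e1, Function.comp_def]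
  ring

/-- Induction on the sites. If the leftmost site is occupied, its parameter is the first variable,
and splitting off that variable is the recursion of `chainCoeff`; an empty leftmost site does not
enter the formula. When no site is left, neither is any factor, and the sum of `Q` over the
remaining variables is the factorial. -/
theorem weightedSum_eq_chainCoeff (η : ℂ → ℂ) {k : ℕ} (z : Fin k → ℂ) (J : Fin k → Bool) {p : ℕ}
    (e : Fin p → Fin k) (he : StrictMono e) (hJ : ∀ m, J m = true ↔ ∃ a, e a = m) {ξ : ℕ}
    (hp : p ≤ ξ) (t : Fin ξ → ℂ) (ht : Function.Injective t) :
    weightedSum hp (fun a u => η u * (u - z (e a))⁻¹ *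
        ∏ m ∈ Finset.Ioi (e a), (1 + (u - z m)⁻¹)) t =
      ((ξ - p).factorial : ℂ) * chainCoeff (fun i => η (t i)) t k z J Finset.univ := by
  induction k generalizing p ξ with
  | zero =>
    obtain rfl : p = 0 := by
      rcases p with _ | p
      · rfl
      · exact (e 0).elim0
    simp [weightedSum, chainCoeff, sum_Q_comp_perm ht]
  | succ k ih =>
    by_cases h0 : J 0 = true
    · obtain ⟨a, ha⟩ := (hJ 0).mp h0
      obtain ⟨p, rfl⟩ : ∃ q, p = q + 1 := ⟨p - 1, by have := a.pos; omega⟩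
      obtain ⟨ξ, rfl⟩ : ∃ q, ξ = q + 1 := ⟨ξ - 1, by omega⟩
      have he0 : e 0 = 0 := by
        have := he.monotone (Fin.zero_le a)
        rw [ha] at this
        exact Fin.le_zero_iff.mp this
      have hne : ∀ b : Fin p, e b.succ ≠ 0 := fun b h => by
        have := he (Fin.succ_pos b)
        rw [h] at this
        exact absurd this (Fin.not_lt_zero _)
      have hes : ∀ b : Fin p, ((e b.succ).pred (hne b)).succ = e b.succ := fun b => Fin.succ_pred _ _
      have he' : StrictMono fun b : Fin p => (e b.succ).pred (hne b) := fun b c hbc => by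
        rw [Fin.pred_lt_pred_iff]
        exact he (Fin.succ_lt_succ_iff.mpr hbc)
      have hJ' : ∀ m, Fin.tail J m = true ↔ ∃ b : Fin p, (e b.succ).pred (hne b) = m := by
        intro m
        rw [Fin.tail, hJ]
        constructor
        · rintro ⟨b, hb⟩
          obtain ⟨b, rfl⟩ : ∃ c : Fin p, b = c.succ := by
            refine Fin.exists_succ_eq.mpr (?_ : b ≠ 0) |>.imp fun c hc => hc.symm
            rintro rfl
            rw [he0] at hb
            exact Fin.succ_ne_zero m hb.symm
          exact ⟨b, Fin.succ_injective _ ((hes b).trans hb)⟩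
        · rintro ⟨b, rfl⟩
          exact ⟨b.succ, (hes b).symm⟩
      rw [weightedSum_succ hp _ _ ht, chainCoeff, if_pos h0, Finset.mul_sum]
      refine Finset.sum_congr rfl fun i _ => ?_
      have herase : Finset.univ.erase i = Finset.univ.map (Fin.succAboveEmb i) := by
        ext j
        simp [Fin.exists_succAbove_eq_iff]
      have := ih (Fin.tail z) (Fin.tail J) _ he' hJ' (Nat.le_of_succ_le_succ hp)
        (t ∘ i.succAbove) (ht.comp Fin.succAbove_right_injective)
      have e2 : (fun (b : Fin p) (u : ℂ) => η u * (u - z (e b.succ))⁻¹ *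
            ∏ m ∈ Finset.Ioi (e b.succ), (1 + (u - z m)⁻¹)) =
          fun (b : Fin p) (u : ℂ) => η u * (u - Fin.tail z ((e b.succ).pred (hne b)))⁻¹ *
            ∏ m ∈ Finset.Ioi ((e b.succ).pred (hne b)), (1 + (u - Fin.tail z m)⁻¹) := by
        funext b u
        conv_lhs => rw [← hes b, Fin.prod_Ioi_succ]
        rfl
      rw [e2, this, herase, Finset.prod_map, chainCoeff_map, he0, Fin.prod_Ioi_zero,
        Nat.add_sub_add_right]
      simp only [Fin.coe_succAboveEmb, Fin.tail, Function.comp_def]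
      ring
    · have hne : ∀ b : Fin p, e b ≠ 0 := fun b h => h0 ((hJ 0).mpr ⟨b, h⟩)
      have hes : ∀ b : Fin p, ((e b).pred (hne b)).succ = e b := fun b => Fin.succ_pred _ _
      have he' : StrictMono fun b : Fin p => (e b).pred (hne b) := fun b c hbc => by
        rw [Fin.pred_lt_pred_iff]
        exact he hbc
      have hJ' : ∀ m, Fin.tail J m = true ↔ ∃ b : Fin p, (e b).pred (hne b) = m := by
        intro m
        rw [Fin.tail, hJ]
        refine exists_congr fun b => ?_
        exact ⟨fun h => Fin.succ_injective _ ((hes b).trans h),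
          fun h => (hes b).symm.trans (congrArg Fin.succ h)⟩
      rw [chainCoeff, if_neg h0, ← ih (Fin.tail z) (Fin.tail J) _ he' hJ' hp t ht]
      congr 1
      funext b u
      conv_lhs => rw [← hes b, Fin.prod_Ioi_succ]
      rfl

/-- The labelling of the sites by membership in `I`. -/
def spins {k : ℕ} (I : Finset (Fin k)) : Fin k → Bool := fun m => decide (m ∈ I)

theorem spins_eq_true_iff {k : ℕ} (I : Finset (Fin k)) (m : Fin k) :
    spins I m = true ↔ ∃ a, nth I a = m := by
  have := Set.ext_iff.mp (Finset.range_orderEmbOfFin I rfl) m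
  simp only [spins, decide_eq_true_eq]
  exact this.symm

theorem VI_eq_chainCoeff {ξ k : ℕ} (I : Finset (Fin k)) (hI : I.card ≤ ξ) (t : Fin ξ → ℂ)
    (z : Fin k → ℂ) (y : ℂ) (ht : Function.Injective t) (htz : ∀ i m, t i ≠ z m) :
    VI I t z y = chainCoeff (fun i => t i - y) t k z (spins I) Finset.univ := by
  have key := weightedSum_eq_chainCoeff (fun u => u - y) z (spins I) (nth I)
    (Finset.orderEmbOfFin I rfl).strictMono (spins_eq_true_iff I) hI t ht
  have hf : ((ξ - I.card).factorial : ℂ) ≠ 0 := Nat.cast_ne_zero.mpr (Nat.factorial_ne_zero _)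
  rw [VI, dif_pos hI, one_div, inv_mul_eq_iff_eq_mul₀ hf, ← key, symBar, sym, weightedSum]
  refine Finset.sum_congr rfl fun σ _ => ?_
  rw [FI, ← Finset.prod_mul_distrib]
  congr 1
  refine Finset.prod_congr rfl fun a _ => ?_
  rw [one_div]
  have : ∀ m, (t (σ (Fin.castLE hI a)) - z m + 1) / (t (σ (Fin.castLE hI a)) - z m) =
      1 + (t (σ (Fin.castLE hI a)) - z m)⁻¹ := fun m => by
    have := sub_ne_zero.mpr (htz (σ (Fin.castLE hI a)) m)
    field_simp
  simp only [this]
  ring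

/-- This lets the reversed numbering of the variables in `VItilde` be replaced by a change of sign.
-/
theorem Q_comp_rev {ξ : ℕ} (t : Fin ξ → ℂ) : Q (t ∘ Fin.rev) = Q fun i => -t i := by
  unfold Q
  rw [Finset.prod_sigma', Finset.prod_sigma']
  refine Finset.prod_bij' (fun p _ => ⟨p.2.rev, p.1.rev⟩) (fun p _ => ⟨p.2.rev, p.1.rev⟩)
    ?_ ?_ ?_ ?_ ?_
  · rintro ⟨a, b⟩ h; simpa using h
  · rintro ⟨a, b⟩ h; simpa using h
  · rintro ⟨a, b⟩ h; simp
  · rintro ⟨a, b⟩ h; simp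
  · rintro ⟨a, b⟩ h
    simp only [Function.comp_apply, neg_sub_neg]

/-- Reversing the order of the variables and writing `z - t` as `-t - (-z)` brings the function to
the shape of `VI` in the variables -t with points -z. The factor `t - y` becomes the function `-u -
y` of u = -t. -/
theorem VItilde_eq_chainCoeff {ξ k : ℕ} (I : Finset (Fin k)) (hI : I.card ≤ ξ) (t : Fin ξ → ℂ)
    (z : Fin k → ℂ) (y : ℂ) (ht : Function.Injective t) (htz : ∀ i m, t i ≠ z m) :
    VItilde I t z y = chainCoeff (fun i => t i - y) (fun i => -t i) k (fun m => -z m) (spins I)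
      Finset.univ := by
  have key := weightedSum_eq_chainCoeff (fun u => -u - y) (fun m => -z m) (spins I) (nth I)
    (Finset.orderEmbOfFin I rfl).strictMono (spins_eq_true_iff I) hI (fun i => -t i)
    (neg_injective.comp ht)
  simp only [neg_neg] at key
  have hf : ((ξ - I.card).factorial : ℂ) ≠ 0 := Nat.cast_ne_zero.mpr (Nat.factorial_ne_zero _)
  rw [VItilde, dif_pos hI, one_div, inv_mul_eq_iff_eq_mul₀ hf, ← key, symBar, sym, weightedSum,
    ← Equiv.sum_comp (Equiv.mulRight (Fin.revPerm : Perm (Fin ξ)))]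
  refine Finset.sum_congr rfl fun σ _ => ?_
  have hQ : Q (fun i => t (Equiv.mulRight (Fin.revPerm : Perm (Fin ξ)) σ i)) =
      Q ((fun i => -t i) ∘ σ) := Q_comp_rev (t ∘ σ)
  have hr : ∀ i : Fin ξ, Equiv.mulRight (Fin.revPerm : Perm (Fin ξ)) σ i.rev = σ i := by
    intro i
    simp
  rw [FItilde, ← Finset.prod_mul_distrib]
  simp only [hr, hQ]
  congr 1
  refine Finset.prod_congr rfl fun a _ => ?_
  have : ∀ m, (z m - t (σ (Fin.castLE hI a)) + 1) / (z m - t (σ (Fin.castLE hI a))) =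
      1 + (-t (σ (Fin.castLE hI a)) - -z m)⁻¹ := fun m => by
    have := sub_ne_zero.mpr (htz (σ (Fin.castLE hI a)) m).symm
    rw [neg_sub_neg]
    field_simp
  simp only [this, neg_sub_neg, one_div]
  ring

theorem spins_check {k : ℕ} (I : Finset (Fin k)) : spins (check I) = spins I ∘ Fin.rev := by
  funext m
  have : m ∈ check I ↔ m.rev ∈ I := by
    simp only [check, Finset.mem_image]
    exact ⟨by rintro ⟨a, ha, rfl⟩; rwa [Fin.rev_rev], fun h => ⟨_, h, Fin.rev_rev m⟩⟩
  simp [spins, this]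

theorem card_check {k : ℕ} (I : Finset (Fin k)) : (check I).card = I.card :=
  Finset.card_image_of_injective _ Fin.rev_injective

/-- The two sums of coefficients over the pairs with the same multiplicities. -/
theorem coeff_eq_sum {ξ : Fin 3 → ℕ} (t : (a : Fin 3) → Fin (ξ a) → ℂ)
    (hinj : Function.Injective fun s : (a : Fin 3) × Fin (ξ a) => t s.1 s.2) (x : ℂ)
    (Λ : Fin 4 → ℂ) (P : Finset (Fin (ξ 1)) × Finset (Fin (ξ 1))) (h1 : P.1.card ≤ ξ 2)
    (h2 : P.2.card ≤ ξ 0) :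
    coeff t x Λ P = ∑ τ : Perm (Fin (ξ 1)),
      chainCoeff (fun i => t 2 i - (x - Λ 2)) (t 2) (ξ 1) (t 1) (spins P.1 ∘ τ) Finset.univ *
        chainCoeff (fun i => t 0 i - (x - Λ 1)) (fun i => -t 0 i) (ξ 1) (fun m => -t 1 m)
          (spins P.2 ∘ τ) Finset.univ := by
  have inj : ∀ a, Function.Injective (t a) := fun a i j hij => by
    have := @hinj ⟨a, i⟩ ⟨a, j⟩ hij
    simpa using this
  have ne : ∀ a b i j, a ≠ b → t a i ≠ t b j := fun a b i j hab h => by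
    have := @hinj ⟨a, i⟩ ⟨b, j⟩ h
    exact hab (congrArg Sigma.fst this)
  -- Both configurations are reversed: the first because `check` reverses `P.1`, the second because
  -- the chain symmetrization contains a reversal that has to be undone. The common reversal is then
  -- absorbed in τ.
  have key := sum_chainCoeff_mul_chainCoeff (fun i => t 2 i - (x - Λ 2)) (t 2)
    (fun i => t 0 i - (x - Λ 1)) (fun i => -t 0 i) (inj 1) Finset.univ (inj 2).injOn
    (fun i _ m => ne 2 1 i m (by decide)) Finset.univ (neg_injective.comp (inj 0)).injOn
    (fun i _ m h => ne 0 1 i m (by decide) (neg_injective h)) (spins P.1 ∘ Fin.rev)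
    (spins P.2 ∘ Fin.rev)
  have hreindex : ∀ g : Perm (Fin (ξ 1)) → ℂ,
      ∑ τ : Perm (Fin (ξ 1)), g (Fin.revPerm * τ) = ∑ τ, g τ := fun g =>
    Equiv.sum_comp (Equiv.mulLeft (Fin.revPerm : Perm (Fin (ξ 1)))) g
  rw [← hreindex]
  refine Eq.trans ?_ key
  rw [coeff, symBar, sym]
  refine Finset.sum_congr rfl fun σ _ => ?_
  rw [VI_eq_chainCoeff _ (by rwa [card_check]) _ _ _ (inj 2) fun i m => ne 2 1 _ _ (by decide),
    VItilde_eq_chainCoeff _ h2 _ _ _ (inj 0) fun i m => ne 0 1 _ _ (by decide), spins_check]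
  have : (spins P.2 ∘ Fin.rev) ∘ Fin.rev = spins P.2 := by
    funext m
    simp
  rw [this]
  rfl

end Weighted

end GL4Weight

end
noncomputable section

namespace GL4Weight

/-! ### Creation operators of a chain -/

section Chain

variable {ι M M' V : Type*} [AddCommGroup M] [Module ℂ M] [AddCommGroup M'] [Module ℂ M']
  [AddCommGroup V] [Module ℂ V]

/-- The exchange relations of the entries `op false i = A(t_i)` and `op true i = B(t_i)` of a
monodromy matrix. -/
structure ExchangeRel (t : ι → ℂ) (op : Bool → ι → Module.End ℂ M) : Prop where
  comm : ∀ c i j x, op c i (op c j x) = op c j (op c i x)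
  exch : ∀ i j x, i ≠ j → op false i (op true j x) =
    (1 - (t i - t j)⁻¹) • op true j (op false i x) + (t i - t j)⁻¹ • op true i (op false j x)

/-- The effect of adding a site at `z`. -/
structure IsSiteExtension (t : ι → ℂ) (z : ℂ) (incl : Bool → M →ₗ[ℂ] M')
    (op : Bool → ι → Module.End ℂ M) (op' : Bool → ι → Module.End ℂ M') : Prop where
  apply : ∀ c d i x, op' c i (incl d x) = incl d (op c i x) + (t i - z)⁻¹ • incl c (op d i x)
  span : ∀ y, ∃ x x', y = incl false x + incl true x'

theorem inv_sub_inv_swap (a b : ℂ) : (a - b)⁻¹ = -(b - a)⁻¹ := by rw [← neg_sub, inv_neg]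

/-- The coproduct property for one row of a monodromy matrix: multiplying by the L-operator `1 + (t
- z)⁻¹ P` of a new site preserves the exchange relations. All coefficient identities reduce to one
partial fraction identity. -/
theorem IsSiteExtension.exchangeRel {t : ι → ℂ} {z : ℂ} {incl : Bool → M →ₗ[ℂ] M'}
    {op : Bool → ι → Module.End ℂ M} {op' : Bool → ι → Module.End ℂ M'}
    (h : IsSiteExtension t z incl op op') (hop : ExchangeRel t op) (ht : Function.Injective t)
    (hz : ∀ i, t i ≠ z) : ExchangeRel t op' := by
  have key : ∀ i j, i ≠ j →
      (t i - t j)⁻¹ * ((t j - z)⁻¹ - (t i - z)⁻¹) = (t i - z)⁻¹ * (t j - z)⁻¹ := fun i j hij => by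
    have h1 := sub_ne_zero.mpr (hz i)
    have h2 := sub_ne_zero.mpr (hz j)
    have h3 := sub_ne_zero.mpr (ht.ne hij)
    field_simp
    ring
  have norm : ∀ i j, i ≠ j → ∀ x, op false j (op true i x) =
      (1 + (t i - t j)⁻¹) • op true i (op false j x) - (t i - t j)⁻¹ • op true j (op false i x) :=
    fun i j hij x => by
      rw [hop.exch j i x hij.symm, inv_sub_inv_swap (t j) (t i)]
      module
  constructor
  · intro c i j y
    by_cases hij : i = j
    · rw [hij]
    obtain ⟨x, x', rfl⟩ := h.span y
    have k := key i j hij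
    cases c <;> simp only [map_add, h.apply, map_smul, hop.comm _ i j, hop.exch i j _ hij,
      norm i j hij, smul_add, smul_sub, map_sub, smul_smul] <;>
    generalize (t i - t j)⁻¹ = g at * <;>
    generalize (t i - z)⁻¹ = p at * <;>
    generalize (t j - z)⁻¹ = q at * <;>
    match_scalars <;> grind
  · intro i j y hij
    obtain ⟨x, x', rfl⟩ := h.span y
    have k := key i j hij
    simp only [map_add, h.apply, map_smul, hop.comm _ i j, hop.exch i j _ hij,
      norm i j hij, smul_add, smul_sub, map_sub, smul_smul]
    generalize (t i - t j)⁻¹ = g at *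
    generalize (t i - z)⁻¹ = p at *
    generalize (t j - z)⁻¹ = q at *
    match_scalars <;> grind

/-- Moving `A(t_i)` through a product of creation operators to an eigenvector. -/
theorem ExchangeRel.apply_prod [DecidableEq ι] {t : ι → ℂ} {op : Bool → ι → Module.End ℂ M}
    (hop : ExchangeRel t op) (ht : Function.Injective t) {w : M} {α : ι → ℂ}
    (hw : ∀ i, op false i w = α i • w) (l : List ι) (hl : l.Nodup) (i : ι) (hi : i ∉ l) :
    op false i ((l.map (op true)).prod w) =
      ((∏ j ∈ l.toFinset, (1 - (t i - t j)⁻¹)) * α i) • (l.map (op true)).prod w +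
        ∑ m ∈ l.toFinset, ((t i - t m)⁻¹ * (∏ j ∈ l.toFinset.erase m, (1 - (t m - t j)⁻¹)) * α m) •
          op true i (((l.erase m).map (op true)).prod w) := by
  induction l generalizing i with
  | nil => simp [hw]
  | cons j l ih =>
    rw [List.nodup_cons] at hl
    rw [List.mem_cons, not_or] at hi
    have hj : j ∉ l.toFinset := by simpa using hl.1
    rw [List.map_cons, List.prod_cons, Module.End.mul_apply, hop.exch i j _ hi.1, ih hl.2 i hi.2,
      ih hl.2 j hl.1, List.toFinset_cons, Finset.sum_insert hj, Finset.prod_insert hj,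
      Finset.erase_insert hj, List.erase_cons_head]
    -- The word in which `m` has been replaced by i arises twice: from A(t_i) passing B(t_j)
    -- unchanged, and from the term in which the two arguments are exchanged. Partial fractions
    -- combine the two coefficients.
    have e : ∀ m ∈ l.toFinset,
        ((t i - t m)⁻¹ * (∏ j' ∈ (insert j l.toFinset).erase m, (1 - (t m - t j')⁻¹)) * α m) •
            op true i ((((j :: l).erase m).map (op true)).prod w) =
          ((1 - (t i - t j)⁻¹) * ((t i - t m)⁻¹ *
              (∏ j' ∈ l.toFinset.erase m, (1 - (t m - t j')⁻¹)) * α m) +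
            (t i - t j)⁻¹ * ((t j - t m)⁻¹ *
              (∏ j' ∈ l.toFinset.erase m, (1 - (t m - t j')⁻¹)) * α m)) •
            op true i (op true j (((l.erase m).map (op true)).prod w)) := by
      intro m hm
      have hml : m ∈ l := by simpa using hm
      have hjm : j ≠ m := fun h => hl.1 (h ▸ hml)
      have him : i ≠ m := fun h => hi.2 (h ▸ hml)
      rw [Finset.erase_insert_of_ne hjm, Finset.prod_insert (fun h => hj (Finset.mem_of_mem_erase h)),
        List.erase_cons_tail (by simpa using hjm), List.map_cons, List.prod_cons,
        Module.End.mul_apply]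
      congr 1
      have h1 := sub_ne_zero.mpr (ht.ne hi.1)
      have h2 := sub_ne_zero.mpr (ht.ne hjm)
      have h3 := sub_ne_zero.mpr (ht.ne him)
      have key : (t i - t m)⁻¹ * (1 - (t m - t j)⁻¹) =
          (1 - (t i - t j)⁻¹) * (t i - t m)⁻¹ + (t i - t j)⁻¹ * (t j - t m)⁻¹ := by
        rw [inv_sub_inv_swap (t m) (t j)]
        field_simp
        ring
      linear_combination (∏ j' ∈ l.toFinset.erase m, (1 - (t m - t j')⁻¹)) * α m * key
    rw [Finset.sum_congr rfl e]
    simp only [add_smul, Finset.sum_add_distrib, map_add, map_sum, map_smul, smul_add,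
      Finset.smul_sum, smul_smul, hop.comm true j i]
    module

/-- The creation operators of a chain with one more site. -/
theorem IsSiteExtension.prod_apply [DecidableEq ι] {t : ι → ℂ} {z : ℂ} {incl : Bool → M →ₗ[ℂ] M'}
    {op : Bool → ι → Module.End ℂ M} {op' : Bool → ι → Module.End ℂ M'}
    (h : IsSiteExtension t z incl op op') (hop : ExchangeRel t op) (ht : Function.Injective t)
    (hz : ∀ i, t i ≠ z) {w : M} {α : ι → ℂ} (hw : ∀ i, op false i w = α i • w) (l : List ι)
    (hl : l.Nodup) :
    (l.map (op' true)).prod (incl false w) = incl false ((l.map (op true)).prod w) +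
      incl true (∑ i ∈ l.toFinset,
        ((t i - z)⁻¹ * (∏ j ∈ l.toFinset.erase i, (1 - (t i - t j)⁻¹)) * α i) •
          ((l.erase i).map (op true)).prod w) := by
  induction l with
  | nil => simp
  | cons j l ih =>
    rw [List.nodup_cons] at hl
    have hj : j ∉ l.toFinset := by simpa using hl.1
    rw [List.map_cons, List.prod_cons, Module.End.mul_apply, ih hl.2, List.map_cons,
      List.prod_cons, Module.End.mul_apply, List.toFinset_cons, Finset.sum_insert hj,
      Finset.erase_insert hj, List.erase_cons_head, map_add, h.apply, h.apply,
      hop.apply_prod ht hw l hl.2 j hl.1]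
    -- The new site may already be up, which gives the factor `1 + (t j - z)⁻¹`, or be flipped now
    -- by A(t_j), whose action on the remaining word is `ExchangeRel.apply_prod`.
    have e : ∀ m ∈ l.toFinset,
        ((t m - z)⁻¹ * (∏ j' ∈ (insert j l.toFinset).erase m, (1 - (t m - t j')⁻¹)) * α m) •
            (((j :: l).erase m).map (op true)).prod w =
          ((1 + (t j - z)⁻¹) * ((t m - z)⁻¹ *
              (∏ j' ∈ l.toFinset.erase m, (1 - (t m - t j')⁻¹)) * α m) +
            (t j - z)⁻¹ * ((t j - t m)⁻¹ *
              (∏ j' ∈ l.toFinset.erase m, (1 - (t m - t j')⁻¹)) * α m)) •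
            op true j (((l.erase m).map (op true)).prod w) := by
      intro m hm
      have hml : m ∈ l := by simpa using hm
      have hjm : j ≠ m := fun h => hl.1 (h ▸ hml)
      rw [Finset.erase_insert_of_ne hjm, Finset.prod_insert (fun h => hj (Finset.mem_of_mem_erase h)),
        List.erase_cons_tail (by simpa using hjm), List.map_cons, List.prod_cons,
        Module.End.mul_apply]
      congr 1
      have h1 := sub_ne_zero.mpr (hz j)
      have h2 := sub_ne_zero.mpr (ht.ne hjm)
      have h3 := sub_ne_zero.mpr (hz m)
      have key : (t m - z)⁻¹ * (1 - (t m - t j)⁻¹) =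
          (1 + (t j - z)⁻¹) * (t m - z)⁻¹ + (t j - z)⁻¹ * (t j - t m)⁻¹ := by
        rw [inv_sub_inv_swap (t m) (t j)]
        field_simp
        ring
      linear_combination (∏ j' ∈ l.toFinset.erase m, (1 - (t m - t j')⁻¹)) * α m * key
    rw [Finset.sum_congr rfl e]
    simp only [add_smul, Finset.sum_add_distrib, map_add, map_sum, map_smul, smul_add,
      Finset.smul_sum, smul_smul, add_mul, one_mul]
    module

/-! ### The chain of two-dimensional sites -/

/-- The functions supported where the first spin is `c`. -/
def siteIncl (V : Type*) [AddCommGroup V] [Module ℂ V] {k : ℕ} (c : Bool) :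
    ((Fin k → Bool) → V) →ₗ[ℂ] ((Fin (k + 1) → Bool) → V) where
  toFun f J := if J 0 = c then f (Fin.tail J) else 0
  map_add' f g := by funext J; simp only [Pi.add_apply]; split_ifs <;> simp
  map_smul' r f := by
    funext J; simp only [Pi.smul_apply, RingHom.id_apply]; split_ifs <;> simp

theorem siteIncl_apply {k : ℕ} (c : Bool) (f : (Fin k → Bool) → V) (J : Fin (k + 1) → Bool) :
    siteIncl V c f J = if J 0 = c then f (Fin.tail J) else 0 := rfl

theorem siteIncl_single {k : ℕ} (c : Bool) (J : Fin k → Bool) (w : V) :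
    siteIncl V c (Pi.single J w) = Pi.single (Fin.cons c J : Fin (k + 1) → Bool) w := by
  funext J'
  induction J' using Fin.consCases with | _ d J' => ?_
  rw [siteIncl_apply, Fin.cons_zero, Fin.tail_cons, Pi.single_apply, Pi.single_apply]
  simp only [Fin.cons_inj]
  split_ifs <;> simp_all

/-- The restriction of a function to the configurations with first spin `c`. -/
def siteProj (V : Type*) [AddCommGroup V] [Module ℂ V] {k : ℕ} (c : Bool) :
    ((Fin (k + 1) → Bool) → V) →ₗ[ℂ] ((Fin k → Bool) → V) :=
  LinearMap.funLeft ℂ V fun K => (Fin.cons c K : Fin (k + 1) → Bool)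

theorem siteProj_siteIncl {k : ℕ} (c d : Bool) (f : (Fin k → Bool) → V) :
    siteProj V c (siteIncl V d f) = if c = d then f else 0 := by
  funext K
  rw [siteProj, LinearMap.funLeft_apply, siteIncl_apply, Fin.cons_zero, Fin.tail_cons]
  split_ifs <;> rfl

/-- The entries of the monodromy matrix of the chain of two-dimensional sites `z`, glued to a
module in which the entries act as `op`. -/
def chainOp (t : ι → ℂ) (op : Bool → ι → Module.End ℂ V) :
    (k : ℕ) → (Fin k → ℂ) → Bool → ι → Module.End ℂ ((Fin k → Bool) → V)
  | 0, _, c, i => (op c i).compLeft _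
  | k + 1, z, c, i => LinearMap.pi fun J => LinearMap.proj (Fin.tail J) ∘ₗ
      (chainOp t op k (Fin.tail z) c i ∘ₗ siteProj V (J 0) +
        if J 0 = c then (t i - z 0)⁻¹ • (chainOp t op k (Fin.tail z) true i ∘ₗ siteProj V true +
          chainOp t op k (Fin.tail z) false i ∘ₗ siteProj V false)
        else 0)

theorem chainOp_succ_apply (t : ι → ℂ) (op : Bool → ι → Module.End ℂ V) {k : ℕ}
    (z : Fin (k + 1) → ℂ) (c : Bool) (i : ι) (f : (Fin (k + 1) → Bool) → V)
    (J : Fin (k + 1) → Bool) :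
    chainOp t op (k + 1) z c i f J =
      chainOp t op k (Fin.tail z) c i (siteProj V (J 0) f) (Fin.tail J) +
        if J 0 = c then (t i - z 0)⁻¹ •
          (chainOp t op k (Fin.tail z) true i (siteProj V true f) (Fin.tail J) +
            chainOp t op k (Fin.tail z) false i (siteProj V false f) (Fin.tail J))
        else 0 := by
  rw [chainOp]
  split_ifs with h <;> simp [h]

theorem chainOp_isSiteExtension (t : ι → ℂ) (op : Bool → ι → Module.End ℂ V) {k : ℕ}
    (z : Fin (k + 1) → ℂ) :
    IsSiteExtension t (z 0) (siteIncl V) (chainOp t op k (Fin.tail z)) (chainOp t op (k + 1) z) := by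
  constructor
  · intro c d i x
    funext J
    rw [chainOp_succ_apply]
    simp only [siteProj_siteIncl, Pi.add_apply, Pi.smul_apply, siteIncl_apply]
    cases d <;> rcases J 0 <;> cases c <;> simp
  · intro y
    refine ⟨fun K => y (Fin.cons false K), fun K => y (Fin.cons true K), ?_⟩
    funext J
    rw [Pi.add_apply, siteIncl_apply, siteIncl_apply]
    rcases h : J 0
    · simp [← h, Fin.cons_self_tail]
    · simp [← h, Fin.cons_self_tail]

theorem chainOp_exchangeRel {t : ι → ℂ} {op : Bool → ι → Module.End ℂ V} (hop : ExchangeRel t op)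
    (ht : Function.Injective t) {k : ℕ} (z : Fin k → ℂ) (hz : ∀ i m, t i ≠ z m) :
    ExchangeRel t (chainOp t op k z) := by
  induction k with
  | zero =>
    constructor
    · intro c i j f
      funext J
      exact hop.comm c i j _
    · intro i j f hij
      funext J
      exact hop.exch i j _ hij
  | succ k ih =>
    exact (chainOp_isSiteExtension t op z).exchangeRel (ih (Fin.tail z) fun i m => hz i m.succ) ht
      fun i => hz i 0

/-- The all-down vector is the vacuum of the chain. Its eigenvalue supplies the factors `h i` and `1
+ (t i - z m)⁻¹` in the recursion of `chainCoeff`. -/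
theorem chainOp_false_single {t : ι → ℂ} {op : Bool → ι → Module.End ℂ V} {w : V} {η : ι → ℂ}
    (hw : ∀ i, op false i w = η i • w) {k : ℕ} (z : Fin k → ℂ) (i : ι) :
    chainOp t op k z false i (Pi.single (fun _ => false) w) =
      (η i * ∏ m, (1 + (t i - z m)⁻¹)) • Pi.single (fun _ => false) w := by
  induction k with
  | zero =>
    funext J
    have : J = fun _ => false := Subsingleton.elim _ _
    subst this
    simp [chainOp, hw]
  | succ k ih =>
    have e : (fun _ : Fin (k + 1) => false) = Fin.cons false fun _ => false := by
      funext m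
      refine Fin.cases rfl (fun m => rfl) m
    rw [e, ← siteIncl_single, (chainOp_isSiteExtension t op z).apply, ih, Fin.prod_univ_succ,
      map_smul]
    simp only [Fin.tail]
    module

/-- The number of spins up. -/
def spinCount {k : ℕ} (J : Fin k → Bool) : ℕ := (Finset.univ.filter fun m => J m = true).card

theorem spinCount_succ {k : ℕ} (J : Fin (k + 1) → Bool) :
    spinCount J = (if J 0 = true then 1 else 0) + spinCount (Fin.tail J) := by
  unfold spinCount
  rw [Finset.card_filter, Finset.card_filter, Fin.sum_univ_succ]
  rfl

/-- The off-shell Bethe vector of the chain. -/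
theorem prod_chainOp_apply [DecidableEq ι] {t : ι → ℂ} {op : Bool → ι → Module.End ℂ V} (hop : ExchangeRel t op)
    (ht : Function.Injective t) {E : Module.End ℂ V} (hE : ∀ i, op true i = E) {w : V} {η : ι → ℂ}
    (hw : ∀ i, op false i w = η i • w) {k : ℕ} (z : Fin k → ℂ) (hz : ∀ i m, t i ≠ z m)
    (l : List ι) (hl : l.Nodup) (J : Fin k → Bool) :
    (l.map (chainOp t op k z true)).prod (Pi.single (fun _ => false) w) J =
      chainCoeff η t k z J l.toFinset • (E ^ (l.length - spinCount J)) w := by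
  induction k generalizing l with
  | zero =>
    have hJ : J = fun _ => false := Subsingleton.elim _ _
    subst hJ
    rw [chainCoeff, one_smul]
    have : spinCount (fun _ : Fin 0 => false) = 0 := rfl
    rw [this, Nat.sub_zero]
    induction l with
    | nil => simp
    | cons i l ih =>
      rw [List.map_cons, List.prod_cons, Module.End.mul_apply, List.length_cons, pow_succ',
        Module.End.mul_apply, ← ih (List.nodup_cons.mp hl).2, ← hE i]
      rfl
  | succ k ih =>
    have e : (fun _ : Fin (k + 1) => false) = Fin.cons false fun _ => false := by
      funext m
      refine Fin.cases rfl (fun m => rfl) m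
    have hz' : ∀ i m, t i ≠ Fin.tail z m := fun i m => hz i m.succ
    -- The vacuum of the longer chain is the vacuum of the shorter one with a down spin in front, so
    -- adding the site produces exactly the two branches of the recursion.
    rw [e, ← siteIncl_single, (chainOp_isSiteExtension t op z).prod_apply
      (chainOp_exchangeRel hop ht (Fin.tail z) hz') ht (fun i => hz i 0)
      (chainOp_false_single hw (Fin.tail z)) l hl, Pi.add_apply, siteIncl_apply, siteIncl_apply,
      chainCoeff, spinCount_succ]
    by_cases h0 : J 0 = true
    · simp only [h0, Bool.true_eq_false, if_false, if_true, zero_add, Finset.sum_apply,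
        Finset.sum_smul, Pi.smul_apply]
      refine Finset.sum_congr rfl fun i hi => ?_
      have hil : i ∈ l := by simpa using hi
      have e2 : (l.erase i).toFinset = l.toFinset.erase i := by
        ext j
        simp [hl.mem_erase_iff]
      rw [ih (Fin.tail z) hz' (l.erase i) (hl.erase i), e2, List.length_erase_of_mem hil, smul_smul,
        Nat.sub_sub]
      congr 1
      ring
    · simp only [Bool.not_eq_true] at h0
      simp only [h0, if_true, Bool.false_eq_true, if_false, add_zero, zero_add]
      exact ih (Fin.tail z) hz' l hl _

end Chain

end GL4Weight

end
noncomputable section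

namespace GL4Weight

/-! ### Products over lists in a monoid -/

section ListProd

variable {G α β : Type*} [Monoid G]

theorem prod_mul_prod_of_commute (X Y : α → G) (l : List α) (hl : l.Nodup)
    (h : ∀ a ∈ l, ∀ b ∈ l, a ≠ b → Commute (X a) (Y b)) :
    (l.map X).prod * (l.map Y).prod = (l.map fun a => X a * Y a).prod := by
  induction l with
  | nil => simp
  | cons a l ih =>
    rw [List.nodup_cons] at hl
    have hc : Commute (l.map X).prod (Y a) := Commute.list_prod_left _ _ fun x hx => by
      obtain ⟨b, hb, rfl⟩ := List.mem_map.mp hx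
      exact h b (List.mem_cons_of_mem _ hb) a List.mem_cons_self fun e => hl.1 (e ▸ hb)
    simp only [List.map_cons, List.prod_cons]
    rw [← ih hl.2 fun a ha b hb => h a (List.mem_cons_of_mem _ ha) b (List.mem_cons_of_mem _ hb),
      mul_assoc, ← mul_assoc _ (Y a), hc.eq]
    simp only [mul_assoc]

theorem prod_prod_comm (R : α → β → G) (l : List α) (m : List β) (hl : l.Nodup) (hm : m.Nodup)
    (h : ∀ a b a' b', a ≠ a' → b ≠ b' → Commute (R a b) (R a' b')) :
    (l.map fun a => (m.map fun b => R a b).prod).prod =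
      (m.map fun b => (l.map fun a => R a b).prod).prod := by
  induction l with
  | nil => simp
  | cons a l ih =>
    rw [List.nodup_cons] at hl
    simp only [List.map_cons, List.prod_cons]
    rw [ih hl.2, prod_mul_prod_of_commute _ _ m hm]
    intro b _ b' _ hb
    refine Commute.list_prod_right _ _ fun x hx => ?_
    obtain ⟨a', ha', rfl⟩ := List.mem_map.mp hx
    exact h _ _ _ _ (fun e => hl.1 (e ▸ ha')) hb

variable (A : α → G) (B : β → G) (R : α → β → G)

theorem prod_mul_single_mul (b : β) (hR : ∀ a, A a * B b * R a b = R a b * (B b * A a))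
    (hA : ∀ a a', a ≠ a' → Commute (R a b) (A a')) (l : List α) (hl : l.Nodup) :
    (l.map A).prod * B b * (l.reverse.map fun a => R a b).prod =
      (l.reverse.map fun a => R a b).prod * (B b * (l.map A).prod) := by
  induction l with
  | nil => simp
  | cons a l ih =>
    rw [List.nodup_cons] at hl
    have h1 : Commute (A a) (l.reverse.map fun a => R a b).prod :=
      Commute.list_prod_right _ _ fun x hx => by
        obtain ⟨a', ha', rfl⟩ := List.mem_map.mp hx
        exact (hA a' a fun e => hl.1 (by rw [← e]; exact List.mem_reverse.mp ha')).symm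
    have h2 : Commute (l.map A).prod (R a b) := Commute.list_prod_left _ _ fun x hx => by
      obtain ⟨a', ha', rfl⟩ := List.mem_map.mp hx
      exact (hA a a' fun e => hl.1 (by rwa [e])).symm
    simp only [List.map_cons, List.prod_cons, List.reverse_cons, List.map_append, List.prod_append,
      List.map_nil, List.prod_nil, mul_one]
    calc A a * (l.map A).prod * B b * ((l.reverse.map fun a => R a b).prod * R a b)
        = A a * ((l.map A).prod * B b * (l.reverse.map fun a => R a b).prod) * R a b := by
          simp only [mul_assoc]
      _ = (A a * (l.reverse.map fun a => R a b).prod) * B b * ((l.map A).prod * R a b) := by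
          rw [ih hl.2]; simp only [mul_assoc]
      _ = (l.reverse.map fun a => R a b).prod * (A a * B b * R a b) * (l.map A).prod := by
          rw [h1.eq, h2.eq]; simp only [mul_assoc]
      _ = _ := by rw [hR]; simp only [mul_assoc]

theorem single_mul_prod_mul (a : α) (hR : ∀ b, A a * B b * R a b = R a b * (B b * A a))
    (hB : ∀ b b', b ≠ b' → Commute (R a b) (B b')) (m : List β) (hm : m.Nodup) :
    A a * (m.map B).prod * (m.map fun b => R a b).prod =
      (m.map fun b => R a b).prod * ((m.map B).prod * A a) := by
  induction m with
  | nil => simp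
  | cons b m ih =>
    rw [List.nodup_cons] at hm
    have h1 : Commute (m.map B).prod (R a b) := Commute.list_prod_left _ _ fun x hx => by
      obtain ⟨b', hb', rfl⟩ := List.mem_map.mp hx
      exact (hB b b' fun e => hm.1 (by rwa [e])).symm
    have h2 : Commute (B b) (m.map fun b => R a b).prod := Commute.list_prod_right _ _ fun x hx => by
      obtain ⟨b', hb', rfl⟩ := List.mem_map.mp hx
      exact (hB b' b fun e => hm.1 (by rwa [← e])).symm
    simp only [List.map_cons, List.prod_cons]
    calc A a * (B b * (m.map B).prod) * (R a b * (m.map fun b => R a b).prod)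
        = A a * B b * ((m.map B).prod * R a b) * (m.map fun b => R a b).prod := by
          simp only [mul_assoc]
      _ = (A a * B b * R a b) * ((m.map B).prod * (m.map fun b => R a b).prod) := by
          rw [h1.eq]; simp only [mul_assoc]
      _ = R a b * B b * (A a * (m.map B).prod * (m.map fun b => R a b).prod) := by
          rw [hR]; simp only [mul_assoc]
      _ = R a b * (B b * (m.map fun b => R a b).prod) * ((m.map B).prod * A a) := by
          rw [ih hm.2]; simp only [mul_assoc]
      _ = _ := by rw [h2.eq]; simp only [mul_assoc]

/-- Exchange of two ordered products, with the product over the second index outside. -/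
theorem prod_mul_prod_mul_prod (hR : ∀ a b, A a * B b * R a b = R a b * (B b * A a))
    (hA : ∀ a a' b, a ≠ a' → Commute (R a b) (A a'))
    (hB : ∀ a b b', b ≠ b' → Commute (R a b) (B b')) (l : List α) (hl : l.Nodup) (m : List β)
    (hm : m.Nodup) :
    (l.map A).prod * (m.map B).prod * (m.map fun b => (l.reverse.map fun a => R a b).prod).prod =
      (m.map fun b => (l.reverse.map fun a => R a b).prod).prod *
        ((m.map B).prod * (l.map A).prod) := by
  induction m with
  | nil => simp
  | cons b m ih =>
    rw [List.nodup_cons] at hm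
    set S : β → G := fun b => (l.reverse.map fun a => R a b).prod with hS
    have h1 : Commute (m.map B).prod (S b) := Commute.list_prod_left _ _ fun x hx => by
      obtain ⟨b', hb', rfl⟩ := List.mem_map.mp hx
      refine Commute.list_prod_right _ _ fun y hy => ?_
      obtain ⟨a, -, rfl⟩ := List.mem_map.mp hy
      exact (hB a b b' fun e => hm.1 (by rwa [e])).symm
    have h2 : Commute (B b) (m.map S).prod := Commute.list_prod_right _ _ fun x hx => by
      obtain ⟨b', hb', rfl⟩ := List.mem_map.mp hx
      refine Commute.list_prod_right _ _ fun y hy => ?_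
      obtain ⟨a, -, rfl⟩ := List.mem_map.mp hy
      exact (hB a b' b fun e => hm.1 (by rwa [← e])).symm
    have h3 : (l.map A).prod * B b * S b = S b * (B b * (l.map A).prod) :=
      prod_mul_single_mul A B R b (fun a => hR a b) (fun a a' => hA a a' b) l hl
    simp only [List.map_cons, List.prod_cons]
    calc (l.map A).prod * (B b * (m.map B).prod) * (S b * (m.map S).prod)
        = (l.map A).prod * B b * ((m.map B).prod * S b) * (m.map S).prod := by
          simp only [mul_assoc]
      _ = ((l.map A).prod * B b * S b) * ((m.map B).prod * (m.map S).prod) := by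
          rw [h1.eq]; simp only [mul_assoc]
      _ = S b * B b * ((l.map A).prod * (m.map B).prod * (m.map S).prod) := by
          rw [h3]; simp only [mul_assoc]
      _ = S b * (B b * (m.map S).prod) * ((m.map B).prod * (l.map A).prod) := by
          rw [ih hm.2]; simp only [mul_assoc]
      _ = _ := by rw [h2.eq]; simp only [mul_assoc]

/-- Exchange of two ordered products, with the product over the first index outside. -/
theorem prod_mul_prod_mul_prod' (hR : ∀ a b, A a * B b * R a b = R a b * (B b * A a))
    (hA : ∀ a a' b, a ≠ a' → Commute (R a b) (A a'))
    (hB : ∀ a b b', b ≠ b' → Commute (R a b) (B b')) (l : List α) (hl : l.Nodup) (m : List β)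
    (hm : m.Nodup) :
    (l.map A).prod * (m.map B).prod * (l.reverse.map fun a => (m.map fun b => R a b).prod).prod =
      (l.reverse.map fun a => (m.map fun b => R a b).prod).prod *
        ((m.map B).prod * (l.map A).prod) := by
  induction l with
  | nil => simp
  | cons a l ih =>
    rw [List.nodup_cons] at hl
    set S : α → G := fun a => (m.map fun b => R a b).prod with hS
    have h1 : Commute (A a) (l.reverse.map S).prod := Commute.list_prod_right _ _ fun x hx => by
      obtain ⟨a', ha', rfl⟩ := List.mem_map.mp hx
      refine Commute.list_prod_right _ _ fun y hy => ?_
      obtain ⟨b, -, rfl⟩ := List.mem_map.mp hy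
      exact (hA a' a b fun e => hl.1 (by rw [← e]; exact List.mem_reverse.mp ha')).symm
    have h2 : Commute (l.map A).prod (S a) := Commute.list_prod_left _ _ fun x hx => by
      obtain ⟨a', ha', rfl⟩ := List.mem_map.mp hx
      refine Commute.list_prod_right _ _ fun y hy => ?_
      obtain ⟨b, -, rfl⟩ := List.mem_map.mp hy
      exact (hA a a' b fun e => hl.1 (by rwa [e])).symm
    have h3 : A a * (m.map B).prod * S a = S a * ((m.map B).prod * A a) :=
      single_mul_prod_mul A B R a (fun b => hR a b) (fun b b' => hB a b b') m hm
    simp only [List.map_cons, List.prod_cons, List.reverse_cons, List.map_append, List.prod_append,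
      List.map_nil, List.prod_nil, mul_one]
    calc A a * (l.map A).prod * (m.map B).prod * ((l.reverse.map S).prod * S a)
        = A a * ((l.map A).prod * (m.map B).prod * (l.reverse.map S).prod) * S a := by
          simp only [mul_assoc]
      _ = (A a * (l.reverse.map S).prod) * (m.map B).prod * ((l.map A).prod * S a) := by
          rw [ih hl.2]; simp only [mul_assoc]
      _ = (l.reverse.map S).prod * (A a * (m.map B).prod * S a) * (l.map A).prod := by
          rw [h1.eq, h2.eq]; simp only [mul_assoc]
      _ = _ := by rw [h3]; simp only [mul_assoc]

end ListProd

/-! ### Operators on functions of configurations -/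

section Operators

open Equiv

variable {S C V : Type*} [Fintype S] [DecidableEq S] [Fintype C] [DecidableEq C] [AddCommGroup V]
  [Module ℂ V]

/-- The matrix of a permutation of the sites. -/
def permMat (C : Type*) [DecidableEq C] (π : Perm S) : Matrix (S → C) (S → C) ℂ :=
  Matrix.of fun I J => if J = I ∘ π then 1 else 0

theorem permMat_mul (π π' : Perm S) : permMat C π * permMat C π' = permMat C (π * π') := by
  ext I J
  simp only [Matrix.mul_apply, permMat, Matrix.of_apply, ite_mul, one_mul, zero_mul,
    Finset.sum_ite_eq', Finset.mem_univ, if_true]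
  rfl

/-- The `R`-matrix `1 + c P` acting in the factors `k` and `l`. -/
def exMat (C : Type*) [DecidableEq C] (c : ℂ) (k l : S) : Matrix (S → C) (S → C) ℂ :=
  1 + c • permMat C (swap k l)

theorem exMat_transpose (c : ℂ) (k l : S) : (exMat C c k l).transpose = exMat C c k l := by
  have : (permMat C (swap k l)).transpose = permMat C (swap k l) := by
    ext I J
    simp only [permMat, Matrix.transpose_apply, Matrix.of_apply]
    congr 1
    refine propext ⟨fun h => ?_, fun h => ?_⟩ <;>
    · rw [h]; funext m; simp
  rw [exMat, Matrix.transpose_add, Matrix.transpose_smul, this, Matrix.transpose_one]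

theorem exMat_commute {k l k' l' : S} (c c' : ℂ) (h : swap k l * swap k' l' = swap k' l' * swap k l) :
    Commute (exMat C c k l) (exMat C c' k' l') := by
  have : Commute (permMat C (swap k l)) (permMat C (swap k' l')) := by
    rw [commute_iff_eq, permMat_mul, permMat_mul, h]
  exact ((Commute.one_left _).add_left (((Commute.one_right _).add_right
    (this.smul_right c')).smul_left c))

theorem swap_commute_of_ne {k l k' l' : S} (h1 : k ≠ k') (h2 : k ≠ l') (h3 : l ≠ k') (h4 : l ≠ l') :
    swap k l * swap k' l' = swap k' l' * swap k l := by
  ext m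
  simp only [Perm.mul_apply, swap_apply_def]
  grind

/-- The Yang–Baxter equation. -/
theorem exMat_yangBaxter {k l m : S} (hkl : k ≠ l) (hkm : k ≠ m) (hlm : l ≠ m) (a b c : ℂ)
    (h : a * c = b * (a + c)) :
    exMat C a k l * exMat C b k m * exMat C c l m =
      exMat C c l m * (exMat C b k m * exMat C a k l) := by
  have e1 : swap k m * swap l m = swap k l * swap k m := by
    ext x; simp only [Perm.mul_apply, swap_apply_def]; grind
  have e2 : swap l m * swap k l = swap k l * swap k m := by
    ext x; simp only [Perm.mul_apply, swap_apply_def]; grind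
  have e3 : swap l m * swap k m = swap k m * swap k l := by
    ext x; simp only [Perm.mul_apply, swap_apply_def]; grind
  have e4 : swap k l * swap l m = swap k m * swap k l := by
    ext x; simp only [Perm.mul_apply, swap_apply_def]; grind
  have e5 : swap k l * (swap k l * swap k m) = swap k m := by
    rw [← mul_assoc, swap_mul_self, one_mul]
  have e6 : swap l m * (swap k m * swap k l) = swap k m := by
    ext x; simp only [Perm.mul_apply, swap_apply_def]; grind
  simp only [exMat, mul_add, add_mul, one_mul, mul_one, smul_mul_assoc, mul_smul_comm, permMat_mul,
    smul_add, smul_smul, mul_assoc, e1, e2, e3, e4, e5, e6]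
  generalize permMat C (swap k l * swap k m) = X
  generalize permMat C (swap k m * swap k l) = Y
  match_scalars <;> grind

/-- The action of a matrix of scalars on functions with values in `V`. -/
def scalarOp (V : Type*) [AddCommGroup V] [Module ℂ V] :
    Matrix (S → C) (S → C) ℂ →+* Module.End ℂ ((S → C) → V) where
  toFun M :=
    { toFun y I := ∑ J, M I J • y J
      map_add' y y' := by
        funext I
        simp only [Pi.add_apply, smul_add, Finset.sum_add_distrib]
      map_smul' c y := by
        funext I
        simp only [Pi.smul_apply, RingHom.id_apply, Finset.smul_sum, smul_smul, mul_comm] }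
  map_one' := by
    refine LinearMap.ext fun y => funext fun I => ?_
    simp [Matrix.one_apply]
  map_mul' M N := by
    refine LinearMap.ext fun y => funext fun I => ?_
    simp only [LinearMap.coe_mk, AddHom.coe_mk, Module.End.mul_apply, Matrix.mul_apply,
      Finset.sum_smul, Finset.smul_sum, smul_smul]
    exact Finset.sum_comm
  map_zero' := by
    refine LinearMap.ext fun y => funext fun I => ?_
    simp
  map_add' M N := by
    refine LinearMap.ext fun y => funext fun I => ?_
    simp [add_smul, Finset.sum_add_distrib]

theorem scalarOp_apply (M : Matrix (S → C) (S → C) ℂ) (y : (S → C) → V) (I : S → C) :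
    scalarOp V M y I = ∑ J, M I J • y J := rfl

theorem scalarOp_exMat_apply (c : ℂ) (k l : S) (y : (S → C) → V) (I : S → C) :
    scalarOp V (exMat C c k l) y I = y I + c • y (I ∘ swap k l) := by
  simp [scalarOp_apply, exMat, permMat, Matrix.one_apply, add_smul, Finset.sum_add_distrib]

/-- The matrix `L` acting in the factor `k`. -/
def siteOp (L : C → C → Module.End ℂ V) (k : S) : Module.End ℂ ((S → C) → V) where
  toFun y I := ∑ c, L (I k) c (y (Function.update I k c))
  map_add' y y' := by
    funext I
    simp only [Pi.add_apply, map_add, Finset.sum_add_distrib]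
  map_smul' r y := by
    funext I
    simp only [Pi.smul_apply, RingHom.id_apply, map_smul, Finset.smul_sum]

theorem siteOp_apply (L : C → C → Module.End ℂ V) (k : S) (y : (S → C) → V) (I : S → C) :
    siteOp L k y I = ∑ c, L (I k) c (y (Function.update I k c)) := rfl

theorem exMat_commute_siteOp (L : C → C → Module.End ℂ V) {k l m : S} (hk : m ≠ k) (hl : m ≠ l)
    (c : ℂ) : Commute (scalarOp V (exMat C c k l)) (siteOp L m) := by
  refine LinearMap.ext fun y => funext fun I => ?_
  simp only [Module.End.mul_apply, scalarOp_exMat_apply, siteOp_apply, map_add, map_smul,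
    Finset.sum_add_distrib, Finset.smul_sum, Function.comp_apply, swap_apply_of_ne_of_ne hk hl]
  congr 1
  refine Finset.sum_congr rfl fun d _ => ?_
  congr 3
  funext p
  simp only [Function.update_apply, Function.comp_apply]
  have : swap k l p = m ↔ p = m := by
    rw [swap_apply_def]; grind
  simp only [this]

/-- The relation `R T T = T T R`. -/
theorem exMat_mul_siteOp_mul_siteOp (L L' : C → C → Module.End ℂ V) {k l : S} (hkl : k ≠ l) (g : ℂ)
    (h : ∀ a b c d, L a c * L' b d + g • (L a d * L' b c) = L' b d * L a c + g • (L' a d * L b c)) :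
    siteOp L k * siteOp L' l * scalarOp V (exMat C g l k) =
      scalarOp V (exMat C g l k) * (siteOp L' l * siteOp L k) := by
  refine LinearMap.ext fun y => funext fun I => ?_
  set U : C → C → S → C := fun c d => Function.update (Function.update I k c) l d with hU
  have hU1 : ∀ c d, Function.update (Function.update I l d) k c = U c d := fun c d =>
    Function.update_comm hkl.symm _ _ _
  have hU2 : ∀ c d, U c d ∘ swap l k = U d c := fun c d => by
    funext p
    simp only [hU, Function.comp_apply, Function.update_apply, swap_apply_def]
    grind
  have hU3 : ∀ c d,
      Function.update (Function.update (I ∘ swap l k) l d) k c = U c d := fun c d => by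
    funext p
    simp only [hU, Function.comp_apply, Function.update_apply, swap_apply_def]
    grind
  simp only [Module.End.mul_apply, scalarOp_exMat_apply, siteOp_apply, hU1, hU3,
    Function.update_of_ne hkl.symm, Function.update_of_ne hkl, Function.comp_apply, swap_apply_left,
    swap_apply_right, map_add, map_sum, map_smul, Finset.sum_add_distrib]
  change (∑ c, ∑ d, L (I k) c (L' (I l) d (y (U c d)))) +
      ∑ c, ∑ d, g • L (I k) c (L' (I l) d (y (U c d ∘ swap l k))) =
    (∑ d, ∑ c, L' (I l) d (L (I k) c (y (U c d)))) +
      g • ∑ d, ∑ c, L' (I k) d (L (I l) c (y (U c d)))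
  simp only [hU2]
  rw [Finset.sum_comm (f := fun c d => g • L (I k) c (L' (I l) d (y (U d c)))),
    Finset.sum_comm (f := fun d c => L' (I l) d (L (I k) c (y (U c d)))),
    Finset.sum_comm (f := fun d c => L' (I k) d (L (I l) c (y (U c d)))), Finset.smul_sum]
  simp only [Finset.smul_sum, ← Finset.sum_add_distrib]
  refine Finset.sum_congr rfl fun c _ => Finset.sum_congr rfl fun d _ => ?_
  simpa using LinearMap.congr_fun (h (I k) (I l) c d) (y (U c d))

end Operators

end GL4Weight

end
noncomputable section

namespace GL4Weight

/-! ### Rearrangement of the product of monodromy matrices -/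

section Word

variable {S V : Type*} [Fintype S] [DecidableEq S] [AddCommGroup V] [Module ℂ V]

/-- The action of a matrix of operators on functions. -/
def matrixOp (S V : Type*) [Fintype S] [DecidableEq S] [AddCommGroup V] [Module ℂ V] :
    Matrix S S (Module.End ℂ V) →+* Module.End ℂ (S → V) :=
  (endVecRingEquivMatrixEnd S ℂ V).symm.toRingHom

theorem matrixOp_apply (M : Matrix S S (Module.End ℂ V)) (y : S → V) (I : S) :
    matrixOp S V M y I = ∑ J, M I J (y J) := by
  rfl

theorem matrixOp_single (M : Matrix S S (Module.End ℂ V)) (I J : S) (v : V) :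
    matrixOp S V M (Pi.single J v) I = M I J v := by
  rw [matrixOp_apply, Finset.sum_eq_single J]
  · simp
  · intro K _ hK
    simp [Pi.single_eq_of_ne hK]
  · simp

theorem prod_smul_map {A α : Type*} [Ring A] [Algebra ℂ A] (c : α → ℂ) (X : α → A) (l : List α) :
    (l.map fun i => c i • X i).prod = (l.map c).prod • (l.map X).prod := by
  induction l with
  | nil => simp
  | cons a l ih => simp only [List.map_cons, List.prod_cons, ih, smul_mul_smul_comm]

end Word

theorem siteOp_smul {S V C : Type*} [DecidableEq S] [AddCommGroup V] [Module ℂ V] [Fintype C] (r : ℂ) (L : C → C → Module.End ℂ V) (k : S) :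
    siteOp (fun a b => r • L a b) k = r • siteOp L k := by
  refine LinearMap.ext fun y => funext fun I => ?_
  simp [siteOp_apply, Finset.smul_sum]

/-! ### Matrices and operators attached to the tensor factors -/

section Sites

open Equiv

variable {m : ℕ} {ξ : Fin m → ℕ} {V : Type*} [AddCommGroup V] [Module ℂ V]

theorem rMatrix_apply (n : ℕ) (u : ℂ) (a b c d : Fin n) :
    rMatrix n u (a, b) (c, d) =
      (if a = c ∧ b = d then 1 else 0) + u⁻¹ * if a = d ∧ b = c then 1 else 0 := by
  simp only [rMatrix, Matrix.add_apply, Matrix.one_apply, Prod.mk.injEq, Matrix.smul_apply,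
    Matrix.sum_apply, Matrix.kroneckerMap_apply, Matrix.single_apply, smul_eq_mul]
  congr 2
  simp only [eq_comm (a := b) (b := c)]
  rw [Finset.sum_eq_single a, Finset.sum_eq_single c]
  · by_cases h1 : a = d <;> by_cases h2 : c = b <;> simp [h1, h2]
  · intro c' _ h
    simp [h]
  · simp
  · intro a' _ h
    simp [h]
  · simp

theorem matrixOp_siteR (u : ℂ) (k l : Site ξ) :
    matrixOp _ V (siteR u k l) = scalarOp V (exMat (Fin (m + 1)) u⁻¹ k l) := by
  refine LinearMap.ext fun y => funext fun I => ?_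
  rw [matrixOp_apply, scalarOp_apply]
  refine Finset.sum_congr rfl fun J _ => ?_
  rw [siteR, Matrix.of_apply, exMat, Matrix.add_apply, Matrix.smul_apply, Matrix.one_apply,
    permMat, Matrix.of_apply, rMatrix_apply]
  have h1 : I = J ↔ (∀ j, j ≠ k → j ≠ l → I j = J j) ∧ I k = J k ∧ I l = J l := by
    refine ⟨fun h => by simp [h], fun ⟨h, hk, hl⟩ => funext fun j => ?_⟩
    by_cases h1 : j = k
    · rw [h1, hk]
    by_cases h2 : j = l
    · rw [h2, hl]
    exact h j h1 h2
  have h2 : J = I ∘ swap k l ↔ (∀ j, j ≠ k → j ≠ l → I j = J j) ∧ I k = J l ∧ I l = J k := by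
    refine ⟨fun h => ?_, fun ⟨h, hk, hl⟩ => funext fun j => ?_⟩
    · subst h
      refine ⟨fun j h1 h2 => ?_, by simp, by simp⟩
      rw [Function.comp_apply, swap_apply_of_ne_of_ne h1 h2]
    · rw [Function.comp_apply]
      by_cases h1 : j = k
      · rw [h1, swap_apply_left, hl]
      by_cases h2 : j = l
      · rw [h2, swap_apply_right, hk]
      rw [swap_apply_of_ne_of_ne h1 h2, h j h1 h2]
  simp only [h1, h2]
  by_cases hp : ∀ j, j ≠ k → j ≠ l → I j = J j
  · rw [if_pos hp]
    simp only [and_iff_right hp, Module.algebraMap_end_apply, smul_eq_mul]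
  · rw [if_neg hp, if_neg fun h => hp h.1, if_neg fun h => hp h.1]
    simp

theorem matrixOp_siteT (L : Matrix (Fin (m + 1)) (Fin (m + 1)) (Module.End ℂ V)) (k : Site ξ) :
    matrixOp _ V (siteT L k) = siteOp (fun a b => L a b) k := by
  refine LinearMap.ext fun y => funext fun I => ?_
  rw [matrixOp_apply, siteOp_apply]
  simp only [siteT, Matrix.of_apply]
  have hinj : Function.Injective fun c => Function.update I k c := Function.update_injective I k
  have e : ∑ c, L (I k) c (y (Function.update I k c)) =
      ∑ J ∈ Finset.univ.image fun c => Function.update I k c, L (I k) (J k) (y J) := by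
    rw [Finset.sum_image hinj.injOn]
    simp
  rw [e, ← Finset.sum_subset (Finset.subset_univ (Finset.univ.image fun c => Function.update I k c))]
  · refine Finset.sum_congr rfl fun J hJ => ?_
    obtain ⟨c, -, rfl⟩ := Finset.mem_image.mp hJ
    rw [if_pos]
    intro l hl
    rw [Function.update_of_ne hl]
  · intro J _ hJ
    rw [if_neg, LinearMap.zero_apply]
    intro h
    refine hJ (Finset.mem_image.mpr ⟨J k, Finset.mem_univ _, funext fun l => ?_⟩)
    by_cases hl : l = k
    · subst hl; simp
    · rw [Function.update_of_ne hl, h l hl]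

/-- The `R`-matrix of two sites. -/
def rSite (t : (a : Fin m) → Fin (ξ a) → ℂ) (k l : Site ξ) :
    Matrix (Site ξ → Fin (m + 1)) (Site ξ → Fin (m + 1)) ℂ :=
  exMat (Fin (m + 1)) (t k.1 k.2 - t l.1 l.2)⁻¹ k l

/-- The ordered product of the `R`-matrices of two groups of sites. -/
def rBlock (t : (a : Fin m) → Fin (ξ a) → ℂ) (k j : Fin m) :
    Matrix (Site ξ → Fin (m + 1)) (Site ξ → Fin (m + 1)) ℂ :=
  ((List.finRange (ξ k)).map fun i =>
    ((List.finRange (ξ j)).reverse.map fun l => rSite t ⟨k, i⟩ ⟨j, l⟩).prod).prod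

theorem site_ne {k j : Fin m} (h : k ≠ j) (i : Fin (ξ k)) (l : Fin (ξ j)) :
    (⟨k, i⟩ : Site ξ) ≠ ⟨j, l⟩ := fun e => h (congrArg Sigma.fst e)

theorem site_ne' {k : Fin m} {i l : Fin (ξ k)} (h : i ≠ l) : (⟨k, i⟩ : Site ξ) ≠ ⟨k, l⟩ :=
  fun e => h (by simpa using e)

theorem matrixOp_bigR (t : (a : Fin m) → Fin (ξ a) → ℂ) (k j : Fin m) :
    matrixOp _ V (bigR (Module.End ℂ V) t k j) = scalarOp V (rBlock t k j) := by
  simp only [bigR, rBlock, map_list_prod, List.map_map]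
  congr 1
  refine List.map_congr_left fun i _ => ?_
  simp only [Function.comp_apply, map_list_prod, List.map_map]
  congr 1
  refine List.map_congr_left fun l _ => ?_
  exact matrixOp_siteR _ _ _

theorem rSite_commute (t : (a : Fin m) → Fin (ξ a) → ℂ) {k l k' l' : Site ξ} (h1 : k ≠ k')
    (h2 : k ≠ l') (h3 : l ≠ k') (h4 : l ≠ l') : Commute (rSite t k l) (rSite t k' l') :=
  exMat_commute _ _ (swap_commute_of_ne h1 h2 h3 h4)

/-- The Yang–Baxter equation for groups of sites. For a single site of group `a`, its R-matrices
with groups `b` and `c` are moved through the whole third block. Different sites of group `a` can be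
treated one after another, since their R-matrices with different groups commute. -/
theorem rBlock_mul_rBlock_mul_rBlock (t : (a : Fin m) → Fin (ξ a) → ℂ)
    (hinj : Function.Injective fun s : Site ξ => t s.1 s.2) {a b c : Fin m} (hab : a ≠ b)
    (hac : a ≠ c) (hbc : b ≠ c) :
    rBlock t a b * rBlock t a c * rBlock t b c = rBlock t b c * (rBlock t a c * rBlock t a b) := by
  set Y : Fin (ξ a) → Matrix (Site ξ → Fin (m + 1)) (Site ξ → Fin (m + 1)) ℂ := fun i =>
    ((List.finRange (ξ b)).reverse.map fun l => rSite t ⟨a, i⟩ ⟨b, l⟩).prod with hY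
  set X : Fin (ξ a) → Matrix (Site ξ → Fin (m + 1)) (Site ξ → Fin (m + 1)) ℂ := fun i =>
    ((List.finRange (ξ c)).reverse.map fun l => rSite t ⟨a, i⟩ ⟨c, l⟩).prod with hX
  have hXY : ∀ i i', i ≠ i' → Commute (X i) (Y i') := fun i i' h => by
    refine Commute.list_prod_left _ _ fun x hx => Commute.list_prod_right _ _ fun y hy => ?_
    obtain ⟨l, -, rfl⟩ := List.mem_map.mp hx
    obtain ⟨j, -, rfl⟩ := List.mem_map.mp hy
    exact rSite_commute t (site_ne' h) (site_ne hab _ _) (site_ne hac.symm _ _)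
      (site_ne hbc.symm _ _)
  have hline : ∀ i, Y i * X i * rBlock t b c = rBlock t b c * (X i * Y i) := fun i => by
    have := prod_mul_prod_mul_prod' (fun j : Fin (ξ b) => rSite t ⟨a, i⟩ ⟨b, j⟩)
      (fun l : Fin (ξ c) => rSite t ⟨a, i⟩ ⟨c, l⟩) (fun j l => rSite t ⟨b, j⟩ ⟨c, l⟩)
      (fun j l => ?_) (fun j j' l h => ?_) (fun j l l' h => ?_) (List.finRange (ξ b)).reverse
      (List.nodup_reverse.mpr (List.nodup_finRange _)) (List.finRange (ξ c)).reverse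
      (List.nodup_reverse.mpr (List.nodup_finRange _))
    · rw [List.reverse_reverse] at this
      exact this
    · refine exMat_yangBaxter (site_ne hab _ _) (site_ne hac _ _) (site_ne hbc _ _) _ _ _ ?_
      have h1 := sub_ne_zero.mpr (hinj.ne (site_ne hab i j))
      have h2 := sub_ne_zero.mpr (hinj.ne (site_ne hac i l))
      have h3 := sub_ne_zero.mpr (hinj.ne (site_ne hbc j l))
      simp only at h1 h2 h3 ⊢
      field_simp
      ring
    · exact rSite_commute t (site_ne hab.symm _ _) (site_ne' h) (site_ne hac.symm _ _)
        (site_ne hbc.symm _ _)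
    · exact rSite_commute t (site_ne hab.symm _ _) (site_ne hbc _ _) (site_ne hac.symm _ _)
        (site_ne' h)
  have hlist : ∀ l : List (Fin (ξ a)), (l.map fun i => Y i * X i).prod * rBlock t b c =
      rBlock t b c * (l.map fun i => X i * Y i).prod := fun l => by
    induction l with
    | nil => simp
    | cons i l ih =>
      simp only [List.map_cons, List.prod_cons]
      rw [mul_assoc, ih, ← mul_assoc, hline, mul_assoc]
  have h1 : rBlock t a b * rBlock t a c = ((List.finRange (ξ a)).map fun i => Y i * X i).prod :=
    prod_mul_prod_of_commute Y X _ (List.nodup_finRange _) fun i _ i' _ h => (hXY i' i h.symm).symm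
  have h2 : rBlock t a c * rBlock t a b = ((List.finRange (ξ a)).map fun i => X i * Y i).prod :=
    prod_mul_prod_of_commute X Y _ (List.nodup_finRange _) fun i _ i' _ h => hXY i i' h
  rw [h1, h2, hlist]

/-- The ordered product of the matrices `L u` in a group of sites. -/
def laxBlock (L : ℂ → Fin (m + 1) → Fin (m + 1) → Module.End ℂ V)
    (t : (a : Fin m) → Fin (ξ a) → ℂ) (j : Fin m) :
    Module.End ℂ ((Site ξ → Fin (m + 1)) → V) :=
  ((List.finRange (ξ j)).map fun i => siteOp (L (t j i)) (⟨j, i⟩ : Site ξ)).prod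

theorem laxBlock_mul_laxBlock_mul (L : ℂ → Fin (m + 1) → Fin (m + 1) → Module.End ℂ V)
    (hL : ∀ u v, u ≠ v → ∀ a b c d, L u a c * L v b d + (v - u)⁻¹ • (L u a d * L v b c) =
      L v b d * L u a c + (v - u)⁻¹ • (L v a d * L u b c))
    (t : (a : Fin m) → Fin (ξ a) → ℂ) (hinj : Function.Injective fun s : Site ξ => t s.1 s.2)
    {a b : Fin m} (hab : a ≠ b) :
    laxBlock L t a * laxBlock L t b * scalarOp V (rBlock t b a) =
      scalarOp V (rBlock t b a) * (laxBlock L t b * laxBlock L t a) := by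
  have := prod_mul_prod_mul_prod
    (fun i : Fin (ξ a) => siteOp (L (t a i)) (⟨a, i⟩ : Site ξ))
    (fun l : Fin (ξ b) => siteOp (L (t b l)) (⟨b, l⟩ : Site ξ))
    (fun i l => scalarOp V (rSite t ⟨b, l⟩ ⟨a, i⟩)) (fun i l => ?_) (fun i i' l h => ?_)
    (fun i l l' h => ?_) (List.finRange (ξ a)) (List.nodup_finRange _) (List.finRange (ξ b))
    (List.nodup_finRange _)
  · simp only [rBlock, map_list_prod, List.map_map, Function.comp_def]
    exact this
  · exact exMat_mul_siteOp_mul_siteOp _ _ (site_ne hab _ _) _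
      (hL _ _ (hinj.ne (site_ne hab i l)))
  · exact exMat_commute_siteOp _ (site_ne hab _ _) (site_ne' h.symm) _
  · exact exMat_commute_siteOp _ (site_ne' h.symm) (site_ne hab.symm _ _) _

theorem laxBlock_commute_rBlock (L : ℂ → Fin (m + 1) → Fin (m + 1) → Module.End ℂ V)
    (t : (a : Fin m) → Fin (ξ a) → ℂ) {a b c : Fin m} (hab : a ≠ b) (hac : a ≠ c) :
    Commute (laxBlock L t a) (scalarOp V (rBlock t b c)) := by
  simp only [rBlock, laxBlock, map_list_prod, List.map_map, Function.comp_def]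
  refine Commute.list_prod_left _ _ fun x hx => Commute.list_prod_right _ _ fun y hy => ?_
  obtain ⟨i, -, rfl⟩ := List.mem_map.mp hx
  obtain ⟨l, -, rfl⟩ := List.mem_map.mp hy
  refine Commute.list_prod_right _ _ fun z hz => ?_
  obtain ⟨j, -, rfl⟩ := List.mem_map.mp hz
  exact (exMat_commute_siteOp _ (site_ne hab _ _) (site_ne hac _ _) _).symm

end Sites

/-! ### Separation of the R-matrices into row and column factors -/

section Rank

variable {ξ : Fin 3 → ℕ} {V : Type*} [AddCommGroup V] [Module ℂ V]

/-- The product of monodromy matrices with the `R`-matrices moved apart. -/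
theorem hatT_word (L : ℂ → Fin 4 → Fin 4 → Module.End ℂ V)
    (hL : ∀ u v, u ≠ v → ∀ a b c d, L u a c * L v b d + (v - u)⁻¹ • (L u a d * L v b c) =
      L v b d * L u a c + (v - u)⁻¹ • (L v a d * L u b c))
    (t : (a : Fin 3) → Fin (ξ a) → ℂ) (hinj : Function.Injective fun s : Site ξ => t s.1 s.2) :
    laxBlock L t 0 * laxBlock L t 1 * laxBlock L t 2 *
        scalarOp V (rBlock t 2 1 * rBlock t 2 0 * rBlock t 1 0) =
      scalarOp V (rBlock t 1 0) * scalarOp V (rBlock t 2 0) *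
        (laxBlock L t 1 * laxBlock L t 2 * laxBlock L t 0) * scalarOp V (rBlock t 2 1) := by
  -- Reversing the three blocks puts those that involve group 0 next to the Lax blocks, through
  -- which they are pulled to the left; this moves the Lax block of group 0 to the far right.
  rw [rBlock_mul_rBlock_mul_rBlock t hinj (by decide) (by decide) (by decide), map_mul, map_mul]
  have c1 := laxBlock_commute_rBlock L t (a := 2) (b := 1) (c := 0) (by decide) (by decide)
  have c2 := laxBlock_commute_rBlock L t (a := 1) (b := 2) (c := 0) (by decide) (by decide)
  have r1 := laxBlock_mul_laxBlock_mul L hL t hinj (a := 0) (b := 1) (by decide)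
  have r2 := laxBlock_mul_laxBlock_mul L hL t hinj (a := 0) (b := 2) (by decide)
  generalize laxBlock L t 0 = A at *
  generalize laxBlock L t 1 = B at *
  generalize laxBlock L t 2 = D at *
  generalize scalarOp V (rBlock t 1 0) = X at *
  generalize scalarOp V (rBlock t 2 0) = Y at *
  generalize scalarOp V (rBlock t 2 1) = Z at *
  calc A * B * D * (X * (Y * Z)) = A * B * (D * X) * Y * Z := by simp only [mul_assoc]
    _ = (A * B * X) * D * Y * Z := by rw [c1.eq]; simp only [mul_assoc]
    _ = X * B * (A * D * Y) * Z := by rw [r1]; simp only [mul_assoc]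
    _ = X * (B * Y) * (D * A) * Z := by rw [r2]; simp only [mul_assoc]
    _ = _ := by rw [c2.eq]; simp only [mul_assoc]

end Rank

/-! ### The Lax matrix of the evaluation module -/

section Evaluation

variable {ξ : Fin 3 → ℕ} {V : Type*} [AddCommGroup V] [Module ℂ V] [LieRingModule (gl 4) V]
  [LieModule ℂ (gl 4) V]

/-- The matrix `(u - x) T(u)` of the evaluation module. -/
def lax (V : Type*) [AddCommGroup V] [Module ℂ V] [LieRingModule (gl 4) V]
    [LieModule ℂ (gl 4) V] (x u : ℂ) (a b : Fin 4) : Module.End ℂ V :=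
  (u - x) • (if a = b then 1 else 0) + act V b a

theorem act_mul_act (a b c d : Fin 4) :
    act V a b * act V c d = act V c d * act V a b + (if b = c then act V a d else 0) -
      if a = d then act V c b else 0 := by
  have h := congrArg (LieModule.toEnd ℂ (gl 4) V) (e_comm a b c d)
  rw [LieHom.map_lie, Ring.lie_def] at h
  unfold act
  rw [sub_eq_iff_eq_add'] at h
  have hf : ∀ (p : Prop) [Decidable p] (y : gl 4), LieModule.toEnd ℂ (gl 4) V (if p then y else 0) =
      if p then LieModule.toEnd ℂ (gl 4) V y else 0 := fun p _ y => by
    split_ifs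
    · rfl
    · exact (LieModule.toEnd ℂ (gl 4) V).toLinearMap.map_zero
  rw [h, map_sub, hf, hf]
  abel

/-- The products of two generators multiplied by `(v - u)⁻¹` coincide on both sides. What remains
there is linear in the generators, with coefficients proportional to `v - u`, and balances the
commutator. -/
theorem lax_rel (x u v : ℂ) (huv : u ≠ v) (a b c d : Fin 4) :
    lax V x u a c * lax V x v b d + (v - u)⁻¹ • (lax V x u a d * lax V x v b c) =
      lax V x v b d * lax V x u a c + (v - u)⁻¹ • (lax V x v a d * lax V x u b c) := by
  have h : v - u ≠ 0 := sub_ne_zero.mpr huv.symm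
  have e1 : ∀ (p : Prop) [Decidable p] (y : Module.End ℂ V),
    (if p then y else 0) = (if p then (1 : ℂ) else 0) • y := fun p _ y => by split_ifs <;> simp
  have h1 := act_mul_act (V := V) c a d b
  have h2 : act V c a * act V d b = act V d b * act V c a +
     ((if a = d then (1 : ℂ) else 0) • act V c b - (if b = c then (1 : ℂ) else 0) • act V d a) := by
    rw [h1]
    rw [e1 (a = d), e1 (c = b)]
    simp only [eq_comm (a := c) (b := b), add_sub_assoc]
  unfold lax
  rw [e1 (a = c), e1 (b = d), e1 (a = d), e1 (b = c)]
  simp only [mul_add, add_mul, smul_mul_assoc, mul_smul_comm, one_mul, mul_one, smul_add,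
    smul_smul, h2]
  generalize act V d b * act V c a = X
  generalize act V d a * act V c b = Y
  match_scalars <;> field_simp <;> ring

end Evaluation

end GL4Weight

end
noncomputable section

namespace GL4Weight

open Equiv

/-! ### Matrix coefficients and products of R-matrices on colour configurations -/

section Configurations

variable {S C M V : Type*} [Fintype S] [DecidableEq S] [Fintype C] [DecidableEq C] [AddCommGroup V]
  [Module ℂ V] [AddCommGroup M] [Module ℂ M]

theorem exMat_comm (c : ℂ) (k l : S) : exMat C c k l = exMat C c l k := by
  rw [exMat, exMat, swap_comm]

/-- The transposed matrix acts on the matrix coefficients of an operator. -/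
theorem apply_scalarOp_single (Ψ : Module.End ℂ ((S → C) → V)) (A : Matrix (S → C) (S → C) ℂ)
    (J I : S → C) (v : V) :
    Ψ (scalarOp V A (Pi.single J v)) I =
      scalarOp V A.transpose (fun K => Ψ (Pi.single K v) I) J := by
  have : scalarOp V A (Pi.single J v) = ∑ K, A K J • (Pi.single K v : (S → C) → V) := by
    funext K
    simp [scalarOp_apply, Pi.single_apply, Finset.sum_apply]
  rw [this, map_sum, Finset.sum_apply, scalarOp_apply]
  simp

/-- A product of operators at distinct sites. -/
theorem prod_siteOp_single (L : S → C → C → Module.End ℂ V) (l : List S) (hl : l.Nodup)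
    (K I : S → C) (v : V) :
    (l.map fun p => siteOp (L p) p).prod (Pi.single K v) I =
      if ∀ p, p ∉ l → I p = K p then (l.map fun p => L p (I p) (K p)).prod v else 0 := by
  induction l generalizing I with
  | nil =>
    simp only [List.map_nil, List.prod_nil, Module.End.one_apply, Pi.single_apply,
      List.not_mem_nil, not_false_eq_true, forall_const, funext_iff]
  | cons p l ih =>
    rw [List.nodup_cons] at hl
    simp only [List.map_cons, List.prod_cons, Module.End.mul_apply, siteOp_apply]
    have e : ∀ c, (l.map fun p' => L p' (Function.update I p c p') (K p')).prod =
        (l.map fun p' => L p' (I p') (K p')).prod := fun c => by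
      congr 1
      refine List.map_congr_left fun p' hp' => ?_
      rw [Function.update_of_ne (ne_of_mem_of_not_mem hp' hl.1)]
    rw [Finset.sum_eq_single (K p)]
    · rw [ih hl.2, e]
      have : (∀ p', p' ∉ l → Function.update I p (K p) p' = K p') ↔
          ∀ p', p' ∉ p :: l → I p' = K p' := by
        refine forall_congr' fun p' => ?_
        by_cases h : p' = p
        · subst h; simp
        · simp [h]
      simp only [this]
      split_ifs <;> simp
    · intro c _ hc
      rw [ih hl.2, if_neg, map_zero]
      intro h
      exact hc (by simpa using h p hl.1)
    · simp

/-! ### Evaluation of a product of `R`-matrices by a chain -/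

section Chain

variable {ι : Type*} (t : ι → ℂ) (op : Bool → ι → Module.End ℂ M) (col : Bool → C)

/-- One line through the sites of a chain. -/
theorem line_apply_eq {k : ℕ} (z : Fin k → ℂ) (i : ι) (s : S) (q : Fin k → S)
    (hq : Function.Injective q) (hs : ∀ j, s ≠ q j) (F : ((Fin k → Bool) → M) →ₗ[ℂ] V) (X : M)
    (y : (S → C) → V) (c : Bool) (J : Fin k → Bool) (I : S → C) (hIs : I s = col c)
    (hIq : ∀ j, I (q j) = col (J j))
    (hy : ∀ (I' : S → C) (c' : Bool) (J' : Fin k → Bool),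
      (∀ p, p ≠ s → (∀ j, p ≠ q j) → I' p = I p) → I' s = col c' →
      (∀ j, I' (q j) = col (J' j)) → y I' = F (Pi.single J' (op c' i X))) :
    ((List.finRange k).map fun j => scalarOp V (exMat C (t i - z j)⁻¹ s (q j))).prod y I =
      F (chainOp t op k z c i (Pi.single J X)) := by
  induction k generalizing c I with
  | zero =>
    have h0 : chainOp t op 0 z c i (Pi.single J X) = Pi.single J (op c i X) := by
      funext J'
      rw [Subsingleton.elim J' J]
      simp [chainOp]
    rw [h0, ← hy I c J (fun _ _ _ => rfl) hIs hIq]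
    simp
  | succ k ih =>
    have hq' : Function.Injective fun j : Fin k => q j.succ :=
      hq.comp (Fin.succ_injective k)
    have hJ : Fin.cons (J 0) (Fin.tail J) = J := Fin.cons_self_tail J
    have main : chainOp t op (k + 1) z c i (Pi.single J X) =
        siteIncl M (J 0) (chainOp t op k (Fin.tail z) c i (Pi.single (Fin.tail J) X)) +
          (t i - z 0)⁻¹ • siteIncl M c
            (chainOp t op k (Fin.tail z) (J 0) i (Pi.single (Fin.tail J) X)) := by
      rw [← (chainOp_isSiteExtension t op z).apply, siteIncl_single, hJ]
    rw [main, map_add, map_smul, List.finRange_succ, List.map_cons, List.prod_cons,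
      Module.End.mul_apply, scalarOp_exMat_apply, List.map_map]
    -- The identity part of the leftmost factor keeps the spin `J 0` on the first site and sends `c`
    -- along the rest of the line. The transposition deposits `c` there and sends `J 0` on. These
    -- are the two terms of the site extension.
    congr 1
    · refine ih (Fin.tail z) (fun j => q j.succ) hq' (fun j => hs _) (F ∘ₗ siteIncl M (J 0)) c
        (Fin.tail J) I hIs (fun j => hIq _) fun I' c' J' h1 h2 h3 => ?_
      rw [LinearMap.comp_apply, siteIncl_single]
      refine hy I' c' _ (fun p hp hpq => h1 p hp fun j => hpq _) h2 fun j => ?_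
      refine Fin.cases ?_ (fun j => ?_) j
      · rw [h1 (q 0) (hs 0).symm fun j => hq.ne (Fin.succ_ne_zero j).symm, hIq, Fin.cons_zero]
      · rw [h3, Fin.cons_succ]
    · congr 1
      refine ih (Fin.tail z) (fun j => q j.succ) hq' (fun j => hs _) (F ∘ₗ siteIncl M c) (J 0)
        (Fin.tail J) (I ∘ swap s (q 0)) ?_ (fun j => ?_) fun I' c' J' h1 h2 h3 => ?_
      · rw [Function.comp_apply, swap_apply_left, hIq]
      · rw [Function.comp_apply, swap_apply_of_ne_of_ne (hs _).symm
          (hq.ne (Fin.succ_ne_zero j)), hIq]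
        rfl
      · rw [LinearMap.comp_apply, siteIncl_single]
        refine hy I' c' _ (fun p hp hpq => ?_) h2 fun j => ?_
        · rw [h1 p hp fun j => hpq _, Function.comp_apply, swap_apply_of_ne_of_ne hp (hpq 0)]
        · refine Fin.cases ?_ (fun j => ?_) j
          · rw [h1 (q 0) (hs 0).symm fun j => hq.ne (Fin.succ_ne_zero j).symm,
              Function.comp_apply, swap_apply_right, hIs, Fin.cons_zero]
          · rw [h3, Fin.cons_succ]

/-- Several lines through the sites of a chain. -/
theorem lines_apply_eq [DecidableEq ι] {k : ℕ} (z : Fin k → ℂ) (s : ι → S)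
    (hsinj : Function.Injective s) (q : Fin k → S) (hq : Function.Injective q)
    (hs : ∀ i j, s i ≠ q j) (F : ((Fin k → Bool) → M) →ₗ[ℂ] V) (X : M) (y : (S → C) → V)
    (ls : List ι) (hls : ls.Nodup) (J : Fin k → Bool) (I : S → C)
    (hIs : ∀ i ∈ ls, I (s i) = col true) (hIq : ∀ j, I (q j) = col (J j))
    (hy : ∀ (I' : S → C) (d : ι → Bool) (J' : Fin k → Bool),
      (∀ p, (∀ i ∈ ls, p ≠ s i) → (∀ j, p ≠ q j) → I' p = I p) →
      (∀ i ∈ ls, I' (s i) = col (d i)) → (∀ j, I' (q j) = col (J' j)) →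
      y I' = F (Pi.single J' ((ls.map fun i => op (d i) i).prod X))) :
    (ls.reverse.map fun i => ((List.finRange k).map fun j =>
        scalarOp V (exMat C (t i - z j)⁻¹ (s i) (q j))).prod).prod y I =
      F ((ls.map (chainOp t op k z true)).prod (Pi.single J X)) := by
  induction ls generalizing y F with
  | nil => simpa using hy I (fun _ => true) J (fun _ _ _ => rfl) (by simp) hIq
  | cons i l ih =>
    rw [List.nodup_cons] at hls
    simp only [List.reverse_cons, List.map_append, List.prod_append, List.map_cons, List.map_nil,
      List.prod_cons, List.prod_nil, mul_one, Module.End.mul_apply]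
    -- The line of the head of the list stands rightmost and acts on `y` first. It is absorbed into
    -- `F`; the other lines do not touch its site, which still has the colour of `true`.
    refine ih (F ∘ₗ chainOp t op k z true i) _ hls.2
      (fun j hj => hIs j (List.mem_cons_of_mem _ hj)) fun I' d J' h1 h2 h3 => ?_
    rw [LinearMap.comp_apply]
    refine line_apply_eq t op col z i (s i) q hq (hs i) F _ y true J' I' ?_ h3
      fun I'' c J'' k1 k2 k3 => ?_
    · rw [h1 _ (fun j hj => hsinj.ne (ne_of_mem_of_not_mem hj hls.1).symm) (hs i)]
      exact hIs i List.mem_cons_self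
    · rw [hy I'' (Function.update d i c) J'' (fun p hp hpq => ?_) (fun j hj => ?_) k3]
      · rw [List.map_cons, List.prod_cons, Function.update_self, Module.End.mul_apply]
        congr 5
        refine List.map_congr_left fun j hj => ?_
        rw [Function.update_of_ne (ne_of_mem_of_not_mem hj hls.1)]
      · rw [k1 p (hp i List.mem_cons_self) hpq,
          h1 p (fun j hj => hp j (List.mem_cons_of_mem _ hj)) hpq]
      · by_cases hji : j = i
        · rw [hji, k2, Function.update_self]
        · rw [Function.update_of_ne hji, k1 _ (hsinj.ne hji) (hs j),
            h2 j ((List.mem_cons.mp hj).resolve_left hji)]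

end Chain

/-! ### Products of `R`-matrices that act trivially -/

section Trivial

variable {ι β : Type*} (a : C) (q : β → S)

/-- A site that the remaining factors do not touch keeps the forbidden colour in every term. The
predicate `A`, stable under the transpositions of the line, records the configurations on which `y`
is known to vanish. -/
theorem line_apply_eq_zero (s : S) (hq : Function.Injective q) (hs : ∀ m, s ≠ q m) (g : β → ℂ)
    (A : (S → C) → Prop) (hA : ∀ m I, A I → A (I ∘ swap s (q m))) (y : (S → C) → V)
    (hy : ∀ I, A I → (∃ m, I (q m) = a) → y I = 0) (ms : List β) (I : S → C) (hI : A I)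
    (h : ∃ m, m ∉ ms ∧ I (q m) = a) :
    (ms.map fun m => scalarOp V (exMat C (g m) s (q m))).prod y I = 0 := by
  induction ms generalizing I with
  | nil =>
    obtain ⟨m, -, hm⟩ := h
    exact hy I hI ⟨m, hm⟩
  | cons m ms ih =>
    obtain ⟨m', hm', h⟩ := h
    rw [List.mem_cons, not_or] at hm'
    rw [List.map_cons, List.prod_cons, Module.End.mul_apply, scalarOp_exMat_apply,
      ih I hI ⟨m', hm'.2, h⟩, ih _ (hA m I hI) ⟨m', hm'.2, ?_⟩, smul_zero, add_zero]
    rw [Function.comp_apply, swap_apply_of_ne_of_ne (hs m').symm (hq.ne hm'.1), h]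

/-- Any transposition would put the colour `a` of the site `s` on a site `q m` that no later factor
visits, so only the identity terms survive. -/
theorem line_apply_eq_ite (s : S) (hq : Function.Injective q) (hs : ∀ m, s ≠ q m) (g : β → ℂ)
    (A : (S → C) → Prop) (hA : ∀ m I, A I → A (I ∘ swap s (q m))) (y : (S → C) → V)
    (hy : ∀ I, A I → (∃ m, I (q m) = a) → y I = 0) (ms : List β) (hms : ms.Nodup) (I : S → C)
    (hI : A I) (hIs : I s = a) :
    (ms.map fun m => scalarOp V (exMat C (g m) s (q m))).prod y I = y I := by
  induction ms with
  | nil => simp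
  | cons m ms ih =>
    rw [List.nodup_cons] at hms
    rw [List.map_cons, List.prod_cons, Module.End.mul_apply, scalarOp_exMat_apply, ih hms.2,
      line_apply_eq_zero a q s hq hs g A hA y hy ms _ (hA m I hI) ⟨m, hms.1, ?_⟩, smul_zero,
      add_zero]
    rw [Function.comp_apply, swap_apply_right, hIs]

/-- A product of `R`-matrices acts trivially on a function that vanishes where a site `q m` has
color `a`, at the configurations in which all the sites `s i` have color `a`. -/
theorem lines_apply_eq_self (s : ι → S) (hsinj : Function.Injective s)
    (hq : Function.Injective q) (hs : ∀ i m, s i ≠ q m) (g : ι → β → ℂ) (y : (S → C) → V)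
    (hy : ∀ I, (∃ m, I (q m) = a) → y I = 0) (ms : List β) (hms : ms.Nodup) (ls : List ι)
    (hls : ls.Nodup) (I : S → C) (hI : ∀ i ∈ ls, I (s i) = a) :
    (ls.map fun i => (ms.map fun m => scalarOp V (exMat C (g i m) (s i) (q m))).prod).prod y I =
      y I := by
  induction ls generalizing I with
  | nil => simp
  | cons i l ih =>
    rw [List.nodup_cons] at hls
    rw [List.map_cons, List.prod_cons, Module.End.mul_apply,
      line_apply_eq_ite a q (s i) hq (hs i) (g i) (fun I => ∀ i ∈ l, I (s i) = a)
        (fun m I h j hj => ?_) _ (fun I h hm => ?_) ms hms I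
        (fun j hj => hI j (List.mem_cons_of_mem _ hj)) (hI i List.mem_cons_self),
      ih hls.2 I fun j hj => hI j (List.mem_cons_of_mem _ hj)]
    · rw [Function.comp_apply, swap_apply_of_ne_of_ne (hsinj.ne (ne_of_mem_of_not_mem hj hls.1)) (hs j m)]
      exact h j hj
    · rw [ih hls.2 I h, hy I hm]

end Trivial

end Configurations

end GL4Weight

end
noncomputable section

namespace GL4Weight

/-! ### The off-shell Bethe vector as a sum over spin configurations -/

section Pointwise

variable {V : Type*} [AddCommGroup V] [Module ℂ V]

/-- Operators acting pointwise on functions. -/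
def pointwise (κ : Type*) (V : Type*) [AddCommGroup V] [Module ℂ V] :
    Module.End ℂ V →+* Module.End ℂ (κ → V) where
  toFun f := f.compLeft κ
  map_one' := rfl
  map_mul' _ _ := rfl
  map_zero' := rfl
  map_add' _ _ := rfl

theorem pointwise_apply {κ : Type*} (f : Module.End ℂ V) (y : κ → V) (a : κ) :
    pointwise κ V f y a = f (y a) := rfl

theorem pointwise_smul {κ : Type*} (c : ℂ) (f : Module.End ℂ V) :
    pointwise κ V (c • f) = c • pointwise κ V f := rfl

/-- The exchange relations of operators `E` and `h i + H` with `[H, E] = ε E`. -/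
theorem exchangeRel_of_commutator {ι : Type*} {t h : ι → ℂ} (ht : Function.Injective t) {ε : ℂ}
    (hh : ∀ i j, h j - h i = ε * (t i - t j)) {E H : Module.End ℂ V} (hE : H * E = E * H + ε • E) :
    ExchangeRel t fun c i => if c = true then E else h i • 1 + H := by
  constructor
  · intro c i j x
    cases c <;> simp
    module
  · intro i j x hij
    have h1 : H (E x) = E (H x) + ε • E x := LinearMap.congr_fun hE x
    have h2 := sub_ne_zero.mpr (ht.ne hij)
    have h3 : h j = h i + ε * (t i - t j) := by rw [← hh]; ring
    simp only [Bool.false_eq_true, if_false, if_true, LinearMap.add_apply, LinearMap.smul_apply,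
      Module.End.one_apply, map_add, map_smul, h1, h3]
    match_scalars <;> field_simp <;> ring

end Pointwise

/-! ### The matrix entry with its row and column R-matrices -/

section Evaluation

variable {ξ : Fin 3 → ℕ} {V : Type*} [AddCommGroup V] [Module ℂ V] [LieRingModule (gl 4) V]
  [LieModule ℂ (gl 4) V]

theorem matrixOp_bigT (t : (a : Fin 3) → Fin (ξ a) → ℂ) (x : ℂ) (hx : ∀ a i, t a i ≠ x)
    (j : Fin 3) :
    matrixOp _ V (bigT (tValue (evalModule V x)) t j) =
      (∏ i, 1 / (t j i - x)) • laxBlock (lax V x) t j := by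
  rw [Fin.prod_univ_def, laxBlock, ← prod_smul_map, bigT, map_list_prod, List.map_map]
  congr 1
  refine List.map_congr_left fun i _ => ?_
  rw [Function.comp_apply, matrixOp_siteT, ← siteOp_smul]
  congr 1
  funext a b
  rw [tValue_evalModule V x _ (hx j i), lax, smul_add, smul_smul,
    one_div, inv_mul_cancel₀ (sub_ne_zero.mpr (hx j i)), one_smul]
  rfl

theorem hatT_eq {A : Type*} [Ring A] [Algebra ℂ A] (T : ℂ → Matrix (Fin 4) (Fin 4) A)
    (t : (a : Fin 3) → Fin (ξ a) → ℂ) :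
    hatT T t = bigT T t 0 * bigT T t 1 * bigT T t 2 *
      (bigR A t 2 1 * bigR A t 2 0 * bigR A t 1 0) := by
  have h1 : (List.finRange 3 : List (Fin 3)) = [0, 1, 2] := by decide
  have h2 : (List.finRange 3).reverse = [(2 : Fin 3), 1, 0] := by decide
  have h3 : ((List.finRange 3).filter fun j => j < (2 : Fin 3)).reverse = [1, 0] := by decide
  have h4 : ((List.finRange 3).filter fun j => j < (1 : Fin 3)).reverse = [0] := by decide
  have h5 : ((List.finRange 3).filter fun j => j < (0 : Fin 3)).reverse = [] := by decide
  rw [hatT, h2]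
  simp only [List.map_cons, List.map_nil, h3, h4, h5, List.prod_cons, List.prod_nil, mul_one]
  rw [h1]
  simp only [List.map_cons, List.map_nil, List.prod_cons, List.prod_nil, mul_one, mul_assoc]

/-- After the rearrangement the R-matrices on the left act on the row multiindex. The one on the
right acts on the column multiindex, which is why it appears transposed, applied to the function of
the columns `K`. -/
theorem bethe_apply (t : (a : Fin 3) → Fin (ξ a) → ℂ)
    (hinj : Function.Injective fun s : Site ξ => t s.1 s.2) (x : ℂ) (hx : ∀ a i, t a i ≠ x)
    (v : V) :
    bethe (evalModule V x) t v = (∏ a : Fin 3, ∏ i : Fin (ξ a), 1 / (t a i - x)) •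
      scalarOp V (rBlock t 2 1).transpose (fun K =>
        scalarOp V (rBlock t 1 0) (scalarOp V (rBlock t 2 0)
          ((laxBlock (lax V x) t 1 * laxBlock (lax V x) t 2 * laxBlock (lax V x) t 0)
            (Pi.single K v))) fun s => s.1.castSucc) fun s => s.1.succ := by
  have key : matrixOp _ V (hatT (tValue (evalModule V x)) t) =
      (∏ a : Fin 3, ∏ i : Fin (ξ a), 1 / (t a i - x)) •
        (scalarOp V (rBlock t 1 0) * scalarOp V (rBlock t 2 0) *
          (laxBlock (lax V x) t 1 * laxBlock (lax V x) t 2 * laxBlock (lax V x) t 0) *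
            scalarOp V (rBlock t 2 1)) := by
    rw [← hatT_word (lax V x) (lax_rel x) t hinj, hatT_eq]
    simp only [map_mul, matrixOp_bigT t x hx, matrixOp_bigR, Fin.prod_univ_three,
      smul_mul_assoc, mul_smul_comm, smul_smul]
    congr 1
    ring
  rw [bethe, ← matrixOp_single, key, LinearMap.smul_apply, Pi.smul_apply]
  congr 1
  exact apply_scalarOp_single (scalarOp V (rBlock t 1 0) * scalarOp V (rBlock t 2 0) *
    (laxBlock (lax V x) t 1 * laxBlock (lax V x) t 2 * laxBlock (lax V x) t 0)) _ _ _ _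

theorem rBlock_transpose (t : (a : Fin 3) → Fin (ξ a) → ℂ) (k j : Fin 3) :
    (rBlock t k j).transpose = ((List.finRange (ξ k)).reverse.map fun i =>
      ((List.finRange (ξ j)).map fun l => rSite t ⟨k, i⟩ ⟨j, l⟩).prod).prod := by
  rw [rBlock, Matrix.transpose_list_prod, List.map_map, ← List.map_reverse]
  congr 1
  refine List.map_congr_left fun i _ => ?_
  rw [Function.comp_apply, Matrix.transpose_list_prod, List.map_map, ← List.map_reverse,
    List.reverse_reverse]
  congr 1
  refine List.map_congr_left fun l _ => ?_
  exact exMat_transpose _ _ _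

/-- R-matrices in different rows and columns of the grid have disjoint pairs of sites and commute,
so the grid may be multiplied by rows or by columns. The second form makes the sites of group `j`
the lines of a chain. -/
theorem rBlock_eq_swap (t : (a : Fin 3) → Fin (ξ a) → ℂ) {k j : Fin 3} (h : k ≠ j) :
    rBlock t k j = ((List.finRange (ξ j)).reverse.map fun l =>
      ((List.finRange (ξ k)).map fun i => rSite t ⟨k, i⟩ ⟨j, l⟩).prod).prod :=
  prod_prod_comm _ _ _ (List.nodup_finRange _) (List.nodup_reverse.mpr (List.nodup_finRange _))
    fun _ _ _ _ h1 h2 => rSite_commute t (site_ne' h1) (site_ne h _ _) (site_ne h.symm _ _)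
      (site_ne' h2)

/-- The product of the entries of the matrices of a group of sites. -/
def entryProd (V : Type*) [AddCommGroup V] [Module ℂ V] [LieRingModule (gl 4) V]
    [LieModule ℂ (gl 4) V] (x : ℂ) {n : ℕ} (t : Fin n → ℂ) (c d : Fin n → Fin 4) :
    Module.End ℂ V :=
  ((List.finRange n).map fun i => lax V x (t i) (c i) (d i)).prod

theorem laxBlock_single (t : (a : Fin 3) → Fin (ξ a) → ℂ) (x : ℂ) (K I : Site ξ → Fin 4) (v : V) :
    (laxBlock (lax V x) t 1 * laxBlock (lax V x) t 2 * laxBlock (lax V x) t 0) (Pi.single K v) I =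
      entryProd V x (t 1) (fun i => I ⟨1, i⟩) (fun i => K ⟨1, i⟩)
        (entryProd V x (t 2) (fun i => I ⟨2, i⟩) (fun i => K ⟨2, i⟩)
          (entryProd V x (t 0) (fun i => I ⟨0, i⟩) (fun i => K ⟨0, i⟩) v)) := by
  set l : Fin 3 → List (Site ξ) := fun a => (List.finRange (ξ a)).map (Sigma.mk a) with hl
  have hmem : ∀ a s, s ∈ l a ↔ s.1 = a := fun a s => by
    simp only [hl, List.mem_map, List.mem_finRange, true_and]
    exact ⟨fun ⟨i, h⟩ => by rw [← h], fun h => by subst h; exact ⟨s.2, rfl⟩⟩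
  have hnd : ∀ a, (l a).Nodup := fun a =>
    (List.nodup_finRange _).map fun i j h => by simpa using h
  have hdis : ∀ a b, a ≠ b → List.Disjoint (l a) (l b) := fun a b hab s h1 h2 =>
    hab (((hmem a s).mp h1).symm.trans ((hmem b s).mp h2))
  have e : laxBlock (lax V x) t 1 * laxBlock (lax V x) t 2 * laxBlock (lax V x) t 0 =
      ((l 1 ++ l 2 ++ l 0).map fun s => siteOp (lax V x (t s.1 s.2)) s).prod := by
    simp only [hl, List.map_append, List.prod_append, List.map_map]
    rfl
  rw [e]
  refine (prod_siteOp_single (fun s : Site ξ => lax V x (t s.1 s.2)) _ ?_ K I v).trans ?_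
  · refine List.Nodup.append ((hnd 1).append (hnd 2) (hdis 1 2 (by decide))) (hnd 0) ?_
    rw [List.disjoint_append_left]
    exact ⟨hdis 1 0 (by decide), hdis 2 0 (by decide)⟩
  rw [if_pos]
  · simp only [hl, List.map_append, List.prod_append, List.map_map]
    rfl
  · intro s hs
    exfalso
    rcases s with ⟨a, i⟩
    fin_cases a <;> simp [hmem] at hs

theorem act_apply_act (a b c d : Fin 4) (w : V) :
    act V a b (act V c d w) = act V c d (act V a b w) + (if b = c then act V a d w else 0) -
      if a = d then act V c b w else 0 := by
  have h := LinearMap.congr_fun (act_mul_act (V := V) a b c d) w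
  simp only [LinearMap.sub_apply, LinearMap.add_apply, Module.End.mul_apply] at h
  rw [h]
  split_ifs <;> simp

/-- With column colour 1 every off-diagonal entry is some e_{1b}, and [e_{12}, e_{1b}] is zero or
-e_{12}. So e_{12} kills every such product applied to `v`, and row colour 2 produces precisely a
factor e_{12}. -/
theorem entry_list_apply_eq_zero (x : ℂ) {ι : Type*} (t : ι → ℂ) (c : ι → Fin 4) (v : V)
    (hv : act V 1 2 v = 0) (l : List ι) :
    act V 1 2 ((l.map fun i => lax V x (t i) (c i) 1).prod v) = 0 ∧
      ((∃ i ∈ l, c i = 2) → (l.map fun i => lax V x (t i) (c i) 1).prod v = 0) := by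
  induction l with
  | nil => simpa using hv
  | cons i l ih =>
    rw [List.map_cons, List.prod_cons, Module.End.mul_apply]
    generalize (l.map fun i => lax V x (t i) (c i) 1).prod v = w at ih ⊢
    obtain ⟨h1, h2⟩ := ih
    refine ⟨?_, ?_⟩
    · simp only [lax, LinearMap.add_apply, LinearMap.smul_apply, map_add, map_smul,
        act_apply_act 1 2, h1]
      generalize c i = b
      fin_cases b <;> simp [h1]
    · rintro ⟨j, hj, hc⟩
      rcases List.mem_cons.mp hj with rfl | hj
      · simp [lax, hc, h1]
      · rw [h2 ⟨j, hj, hc⟩, map_zero]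

theorem prod_lax_eq_prod_act (x : ℂ) {n : ℕ} (t : Fin n → ℂ) (c d : Fin n → Fin 4)
    (h : ∀ i, c i ≠ d i) :
    entryProd V x t c d = ((List.finRange n).map fun i => act V (d i) (c i)).prod := by
  rw [entryProd]
  congr 1
  refine List.map_congr_left fun i _ => ?_
  simp [lax, h i]

end Evaluation

end GL4Weight

end
noncomputable section

namespace GL4Weight

/-! ### Reduction of the matrix entry to two gl_2 chains -/

section Evaluation

variable {ξ : Fin 3 → ℕ} {V : Type*} [AddCommGroup V] [Module ℂ V] [LieRingModule (gl 4) V]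
  [LieModule ℂ (gl 4) V]

/-- The colors of the rows. -/
def rowColor (c : Bool) : Fin 4 := if c = true then 0 else 1

/-- The colors of the columns. -/
def colColor (c : Bool) : Fin 4 := if c = true then 3 else 2

theorem lax_rowColor (x u : ℂ) (c : Bool) :
    lax V x u (rowColor c) 1 = if c = true then act V 1 0 else (u - x) • 1 + act V 1 1 := by
  cases c <;> simp [lax, rowColor]

theorem lax_colColor (x u : ℂ) (c : Bool) :
    lax V x u 2 (colColor c) = if c = true then act V 3 2 else (u - x) • 1 + act V 2 2 := by
  cases c <;> simp [lax, colColor]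

/-- The row part. With group 2 fixed at row colour 2, ℝ₂₀ is invisible by singularity of `v`, and
ℝ₁₀ distributes the colours 0, 1 over groups 0 and 1 as a chain acting on `v`. The index `J` records
the row spins left on group 1. -/
theorem entry_apply (t : (a : Fin 3) → Fin (ξ a) → ℂ)
    (hinj : Function.Injective fun s : Site ξ => t s.1 s.2) (x : ℂ) (v : V) (Λ : Fin 4 → ℂ)
    (hv : IsSingularOfWeight v Λ) (K : Site ξ → Fin 4) (hK : ∀ i, K ⟨0, i⟩ = 1)
    (d : Fin (ξ 2) → Bool) (hd : ∀ i, K ⟨2, i⟩ = colColor (d i))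
    (J' : Fin (ξ 1) → Bool) (hJ' : ∀ i, K ⟨1, i⟩ = colColor (J' i)) :
    scalarOp V (rBlock t 1 0) (scalarOp V (rBlock t 2 0)
        ((laxBlock (lax V x) t 1 * laxBlock (lax V x) t 2 * laxBlock (lax V x) t 0)
          (Pi.single K v))) (fun s => s.1.castSucc) =
      ∑ J : Fin (ξ 1) → Bool,
        entryProd V x (t 1) (fun j => rowColor (J j)) (fun j => colColor (J' j))
          (entryProd V x (t 2) (fun _ => 2) (fun i => colColor (d i))
            (chainCoeff (fun i => t 0 i - (x - Λ 1)) (fun i => -t 0 i) (ξ 1) (fun m => -t 1 m) J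
              Finset.univ • (act V 1 0 ^ (ξ 0 - spinCount J)) v)) := by
  have hK0 : (fun i => K ⟨0, i⟩) = fun _ => 1 := funext hK
  have hK1 : (fun i => K ⟨1, i⟩) = fun i => colColor (J' i) := funext hJ'
  have hK2 : (fun i => K ⟨2, i⟩) = fun i => colColor (d i) := funext hd
  set y := (laxBlock (lax V x) t 1 * laxBlock (lax V x) t 2 * laxBlock (lax V x) t 0)
    (Pi.single K v) with hy
  have hyI : ∀ I, y I = entryProd V x (t 1) (fun i => I ⟨1, i⟩) (fun i => colColor (J' i))
        (entryProd V x (t 2) (fun i => I ⟨2, i⟩) (fun i => colColor (d i))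
          (entryProd V x (t 0) (fun i => I ⟨0, i⟩) (fun _ => 1) v)) := fun I => by
    rw [hy, laxBlock_single, hK0, hK1, hK2]
  have hsite : ∀ a, Function.Injective fun i => (⟨a, i⟩ : Site ξ) := fun a i j h => by
    simpa using h
  -- A nontrivial term of ℝ₂₀ would move colour 2 to a row of group 0, where the entries kill `v`.
  have hself : ∀ I : Site ξ → Fin 4, (∀ i, I ⟨2, i⟩ = 2) →
      scalarOp V (rBlock t 2 0) y I = y I := fun I hI => by
    have := lines_apply_eq_self (2 : Fin 4) (fun l : Fin (ξ 0) => (⟨0, l⟩ : Site ξ))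
      (fun i : Fin (ξ 2) => (⟨2, i⟩ : Site ξ)) (hsite 2) (hsite 0)
      (fun i m => site_ne (by decide) i m) (fun i l => (t 2 i - t 0 l)⁻¹) y (fun I hI => ?_)
      (List.finRange (ξ 0)).reverse (List.nodup_reverse.mpr (List.nodup_finRange _))
      (List.finRange (ξ 2)) (List.nodup_finRange _) I fun i _ => hI i
    · rw [← this]
      simp only [rBlock, map_list_prod, List.map_map, Function.comp_def]
      rfl
    · obtain ⟨m, hm⟩ := hI
      rw [hyI, entryProd, entryProd, entryProd, (entry_list_apply_eq_zero x (t 0)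
        (fun i => I ⟨0, i⟩) v (hv.1 1 2 (by decide)) _).2 ⟨m, List.mem_finRange m, hm⟩, map_zero,
        map_zero]
  set op : Bool → Fin (ξ 0) → Module.End ℂ V := fun c i =>
    if c = true then act V 1 0 else (t 0 i - x) • 1 + act V 1 1 with hop
  set F : ((Fin (ξ 1) → Bool) → V) →ₗ[ℂ] V := ∑ J : Fin (ξ 1) → Bool,
    (entryProd V x (t 1) (fun j => rowColor (J j)) (fun j => colColor (J' j)) *
      entryProd V x (t 2) (fun _ => 2) (fun i => colColor (d i))) ∘ₗ LinearMap.proj J with hF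
  have hFsum : ∀ f, F f = ∑ J : Fin (ξ 1) → Bool,
      entryProd V x (t 1) (fun j => rowColor (J j)) (fun j => colColor (J' j))
        (entryProd V x (t 2) (fun _ => 2) (fun i => colColor (d i)) (f J)) := fun f => by
    simp [hF, LinearMap.sum_apply]
  have hFsingle : ∀ J w, F (Pi.single J w) =
      entryProd V x (t 1) (fun j => rowColor (J j)) (fun j => colColor (J' j))
        (entryProd V x (t 2) (fun _ => 2) (fun i => colColor (d i)) w) := fun J w => by
    rw [hFsum, Finset.sum_eq_single J]
    · simp
    · intro J'' _ h
      simp [Pi.single_eq_of_ne h]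
    · simp
  -- The sites of group 0 are the lines and those of group 1 the chain. Since ℝ₁₀ depends on `t 1 j
  -- - t 0 i`, which is `-t 0 i - (-t 1 j)`, both kinds of variables enter with a minus sign.
  have hchain := lines_apply_eq (fun i => -t 0 i) op rowColor (fun m => -t 1 m)
    (fun i : Fin (ξ 0) => (⟨0, i⟩ : Site ξ)) (hsite 0) (fun j : Fin (ξ 1) => (⟨1, j⟩ : Site ξ))
    (hsite 1) (fun i j => site_ne (by decide) i j) F v (scalarOp V (rBlock t 2 0) y)
    (List.finRange (ξ 0)) (List.nodup_finRange _) (fun _ => false) (fun s => s.1.castSucc)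
    (fun i _ => rfl) (fun j => rfl) fun I' c J h1 h2 h3 => ?_
  · have hword : scalarOp V (rBlock t 1 0) =
        ((List.finRange (ξ 0)).reverse.map fun i => ((List.finRange (ξ 1)).map fun j =>
          scalarOp V (exMat (Fin 4) (-t 0 i - -t 1 j)⁻¹ (⟨0, i⟩ : Site ξ) ⟨1, j⟩)).prod).prod := by
      rw [rBlock_eq_swap t (by decide), map_list_prod, List.map_map]
      congr 1
      refine List.map_congr_left fun i _ => ?_
      rw [Function.comp_apply, map_list_prod, List.map_map]
      congr 1
      refine List.map_congr_left fun j _ => ?_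
      rw [Function.comp_apply, rSite, exMat_comm]
      congr 3
      ring
    have hinj0 : Function.Injective fun i => -t 0 i := fun i j h =>
      hsite 0 (hinj (neg_injective h))
    -- The sign ε is 1 because [e_{11}, e_{10}] = e_{10}, in agreement with the negated parameters.
    have hrel : ExchangeRel (fun i => -t 0 i) op :=
      exchangeRel_of_commutator hinj0 (ε := 1) (fun i j => by ring) (by
        rw [act_mul_act]; simp)
    rw [hword, hchain, hFsum]
    refine Finset.sum_congr rfl fun J _ => ?_
    rw [prod_chainOp_apply hrel hinj0 (E := act V 1 0) (fun _ => rfl)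
      (η := fun i => t 0 i - (x - Λ 1)) (fun i => ?_) _ (fun i m h => ?_) _ (List.nodup_finRange _),
      List.length_finRange, List.toFinset_finRange]
    · have h11 : act V 1 1 v = Λ 1 • v := hv.2 1
      simp only [hop, Bool.false_eq_true, if_false, LinearMap.add_apply, LinearMap.smul_apply,
        Module.End.one_apply, h11]
      module
    · exact site_ne (by decide) i m (hinj (neg_injective h))
  · have hI2 : ∀ i, I' ⟨2, i⟩ = 2 := fun i => by
      rw [h1 _ (fun _ _ => site_ne (by decide) _ _) fun _ => site_ne (by decide) _ _]
      rfl
    rw [hself I' hI2, hyI, hFsingle, funext h3, funext hI2]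
    congr 3
    rw [entryProd]
    congr 1
    refine List.map_congr_left fun i hi => ?_
    rw [h2 i hi, lax_rowColor]

/-- The column part. The transposed ℝ₂₁ distributes the colours 2, 3 over groups 1 and 2, again as a
chain, now acting on the vectors left by the row part. Rows and columns of group 1 never share a
colour, so its entries are off-diagonal and free of the spectral parameter. -/
theorem bethe_apply_eq_sum (t : (a : Fin 3) → Fin (ξ a) → ℂ)
    (hinj : Function.Injective fun s : Site ξ => t s.1 s.2) (x : ℂ) (hx : ∀ a i, t a i ≠ x) (v : V)
    (Λ : Fin 4 → ℂ) (hv : IsSingularOfWeight v Λ) :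
    bethe (evalModule V x) t v = (∏ a : Fin 3, ∏ i : Fin (ξ a), 1 / (t a i - x)) •
      ∑ J' : Fin (ξ 1) → Bool, ∑ J : Fin (ξ 1) → Bool,
        (chainCoeff (fun i => t 2 i - (x - Λ 2)) (t 2) (ξ 1) (t 1) J' Finset.univ *
          chainCoeff (fun i => t 0 i - (x - Λ 1)) (fun i => -t 0 i) (ξ 1) (fun m => -t 1 m) J
            Finset.univ) •
          ((List.finRange (ξ 1)).map fun j => act V (colColor (J' j)) (rowColor (J j))).prod
            ((act V 3 2 ^ (ξ 2 - spinCount J')) ((act V 1 0 ^ (ξ 0 - spinCount J)) v)) := by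
  rw [bethe_apply t hinj x hx]
  congr 1
  have hsite : ∀ a, Function.Injective fun i => (⟨a, i⟩ : Site ξ) := fun a i j h => by
    simpa using h
  set κ := Fin (ξ 1) → Bool with hκ
  set y : (Site ξ → Fin 4) → V := fun K =>
    scalarOp V (rBlock t 1 0) (scalarOp V (rBlock t 2 0)
      ((laxBlock (lax V x) t 1 * laxBlock (lax V x) t 2 * laxBlock (lax V x) t 0)
        (Pi.single K v))) fun s => s.1.castSucc with hy
  -- The vectors for all row configurations are carried along as one function of `J`, on which the
  -- operators act pointwise. It is an eigenvector of e_{22}, which commutes with e_{10}, so it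
  -- serves as the vacuum of the second chain.
  set X : κ → V := fun J => chainCoeff (fun i => t 0 i - (x - Λ 1)) (fun i => -t 0 i) (ξ 1)
    (fun m => -t 1 m) J Finset.univ • (act V 1 0 ^ (ξ 0 - spinCount J)) v with hX
  set op : Bool → Fin (ξ 2) → Module.End ℂ (κ → V) := fun c i =>
    if c = true then pointwise κ V (act V 3 2)
      else (t 2 i - x) • 1 + pointwise κ V (act V 2 2) with hop
  have hop' : ∀ c i, op c i = pointwise κ V (lax V x (t 2 i) 2 (colColor c)) := fun c i => by
    rw [lax_colColor]
    cases c
    · simp only [hop, Bool.false_eq_true, if_false, map_add, pointwise_smul, map_one]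
    · rfl
  set mid : κ → κ → Module.End ℂ V := fun J' J =>
    ((List.finRange (ξ 1)).map fun j => act V (colColor (J' j)) (rowColor (J j))).prod with hmid
  have hne : ∀ c c', rowColor c ≠ colColor c' := by decide
  set F : (κ → κ → V) →ₗ[ℂ] V := ∑ J' : κ, ∑ J : κ,
    mid J' J ∘ₗ LinearMap.proj J ∘ₗ LinearMap.proj J' with hF
  have hFsum : ∀ f, F f = ∑ J' : κ, ∑ J : κ, mid J' J (f J' J) := fun f => by
    simp [hF, LinearMap.sum_apply]
  have hchain := lines_apply_eq (t 2) op colColor (t 1)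
    (fun i : Fin (ξ 2) => (⟨2, i⟩ : Site ξ)) (hsite 2) (fun j : Fin (ξ 1) => (⟨1, j⟩ : Site ξ))
    (hsite 1) (fun i j => site_ne (by decide) i j) F X y
    (List.finRange (ξ 2)) (List.nodup_finRange _) (fun _ => false) (fun s => s.1.succ)
    (fun i _ => rfl) (fun j => rfl) fun I' d J' h1 h2 h3 => ?_
  · have hword : scalarOp V (rBlock t 2 1).transpose =
        ((List.finRange (ξ 2)).reverse.map fun i => ((List.finRange (ξ 1)).map fun j =>
          scalarOp V (exMat (Fin 4) (t 2 i - t 1 j)⁻¹ (⟨2, i⟩ : Site ξ) ⟨1, j⟩)).prod).prod := by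
      simp only [rBlock_transpose, map_list_prod, List.map_map, Function.comp_def]
      rfl
    have hinj2 : Function.Injective (t 2) := fun i j h => hsite 2 (hinj h)
    -- Here [e_{22}, e_{32}] = -e_{32}, so ε is -1 and the parameters keep their sign.
    have hrel : ExchangeRel (t 2) op :=
      exchangeRel_of_commutator hinj2 (ε := -1) (fun i j => by ring) (by
        have h := congrArg (pointwise κ V) (act_mul_act (V := V) 2 2 3 2)
        rw [← map_mul, h, ← map_mul]
        simp only [map_sub, map_add, if_true, show ((2 : Fin 4) = 3) = False by decide, if_false,
          map_zero]
        module)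
    rw [hword, hchain, hFsum]
    refine Finset.sum_congr rfl fun J' _ => Finset.sum_congr rfl fun J _ => ?_
    rw [prod_chainOp_apply hrel hinj2 (E := pointwise κ V (act V 3 2)) (fun _ => rfl)
      (η := fun i => t 2 i - (x - Λ 2)) (fun i => ?_) _ (fun i m h => ?_) _ (List.nodup_finRange _),
      List.length_finRange, List.toFinset_finRange, Pi.smul_apply, ← map_pow, pointwise_apply]
    · simp only [hX, map_smul, smul_smul]
      rfl
    · funext J
      have h22 : ∀ n, act V 2 2 ((act V 1 0 ^ n) v) = Λ 2 • (act V 1 0 ^ n) v := fun n => by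
        have hc : Commute (act V 2 2) (act V 1 0) := by
          rw [commute_iff_eq, act_mul_act]; simp
        have h0 : act V 2 2 v = Λ 2 • v := hv.2 2
        rw [← Module.End.mul_apply, (hc.pow_right n).eq, Module.End.mul_apply, h0, map_smul]
      simp only [hop, Bool.false_eq_true, if_false, LinearMap.add_apply, LinearMap.smul_apply,
        Module.End.one_apply, Pi.add_apply, Pi.smul_apply, pointwise_apply, hX, map_smul, h22]
      module
    · exact site_ne (by decide) i m (hinj h)
  · have hI0 : ∀ i, I' ⟨0, i⟩ = 1 := fun i => by
      rw [h1 _ (fun _ _ => site_ne (by decide) _ _) fun _ => site_ne (by decide) _ _]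
      rfl
    rw [hy]
    simp only
    rw [entry_apply t hinj x v Λ hv I' hI0 d (fun i => h2 i (List.mem_finRange i)) J' h3, hFsum]
    symm
    rw [Finset.sum_eq_single J']
    · refine Finset.sum_congr rfl fun J _ => ?_
      rw [Pi.single_eq_same, prod_lax_eq_prod_act x (t 1) _ _ fun j => hne _ _]
      congr 1
      have : ((List.finRange (ξ 2)).map fun i => op (d i) i).prod = pointwise κ V
          (entryProd V x (t 2) (fun _ => 2) (fun i => colColor (d i))) := by
        rw [entryProd, map_list_prod, List.map_map]
        congr 1
        exact List.map_congr_left fun i _ => hop' _ _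
      rw [this, pointwise_apply]
    · intro J'' _ h
      refine Finset.sum_eq_zero fun J _ => ?_
      rw [Pi.single_eq_of_ne h, Pi.zero_apply, map_zero]
    · simp

end Evaluation

end GL4Weight

end
noncomputable section

namespace GL4Weight

/-! ### Collecting the terms with equal weights -/

section Counting

/-- Each spin up consumes one parameter. This makes the truncated exponents harmless and bounds the
ranges of p and q. -/
theorem chainCoeff_eq_zero {ι : Type*} [DecidableEq ι] (h t : ι → ℂ) {k : ℕ} (z : Fin k → ℂ)
    (J : Fin k → Bool) (S : Finset ι) (hS : S.card < spinCount J) : chainCoeff h t k z J S = 0 := by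
  induction k generalizing S with
  | zero => simp [spinCount] at hS
  | succ k ih =>
    rw [spinCount_succ] at hS
    rw [chainCoeff]
    split_ifs with h0
    · refine Finset.sum_eq_zero fun i hi => ?_
      rw [ih, mul_zero]
      rw [if_pos h0] at hS
      rw [Finset.card_erase_of_mem hi]
      have := Finset.card_pos.mpr ⟨i, hi⟩
      omega
    · rw [if_neg h0] at hS
      exact ih _ _ _ (by omega)

/-- The number of sites with the value `c`. -/
def fiberCard {k : ℕ} {β : Type*} [DecidableEq β] (L : Fin k → β) (c : β) : ℕ :=
  Fintype.card {a // L a = c}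

theorem fiberCard_eq_count {k : ℕ} {β : Type*} [DecidableEq β] [BEq β] [LawfulBEq β]
    (L : Fin k → β) (c : β) : fiberCard L c = ((List.finRange k).map L).count c := by
  rw [fiberCard, Fintype.card_subtype, List.count, List.countP_map, List.countP_eq_length_filter,
    Fin.univ_def]
  simp only [Finset.card, Finset.filter, Multiset.filter_coe, Multiset.coe_card]
  congr 2
  funext a
  rw [Function.comp_apply, Bool.eq_iff_iff]
  simp

theorem fiberCard_eq_card_filter {k : ℕ} {β : Type*} [DecidableEq β] (L : Fin k → β) (c : β) :
    fiberCard L c = (Finset.univ.filter fun a => L a = c).card := Fintype.card_subtype _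

theorem card_filter_eq_add {k : ℕ} (L : Fin k → Bool × Bool) (P : Fin k → Prop) [DecidablePred P]
    (c d : Bool × Bool) (hcd : c ≠ d) (h : ∀ a, P a ↔ L a = c ∨ L a = d) :
    (Finset.univ.filter P).card = fiberCard L c + fiberCard L d := by
  rw [fiberCard_eq_card_filter, fiberCard_eq_card_filter, ← Finset.card_union_of_disjoint]
  · congr 1
    ext a
    simp [h]
  · rw [Finset.disjoint_filter]
    rintro a - h1 h2
    exact hcd (h1.symm.trans h2)

theorem spinCount_fst {k : ℕ} (L : Fin k → Bool × Bool) :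
    spinCount (Prod.fst ∘ L) = fiberCard L (true, true) + fiberCard L (true, false) :=
  card_filter_eq_add L _ _ _ (by decide) fun a => by
    rw [Function.comp_apply]
    rcases L a with ⟨c, d⟩
    cases c <;> cases d <;> simp

theorem spinCount_snd {k : ℕ} (L : Fin k → Bool × Bool) :
    spinCount (Prod.snd ∘ L) = fiberCard L (true, true) + fiberCard L (false, true) :=
  card_filter_eq_add L _ _ _ (by decide) fun a => by
    rw [Function.comp_apply]
    rcases L a with ⟨c, d⟩
    cases c <;> cases d <;> simp

theorem sum_fiberCard {k : ℕ} (L : Fin k → Bool × Bool) :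
    fiberCard L (false, false) + fiberCard L (false, true) + fiberCard L (true, false) +
      fiberCard L (true, true) = k := by
  have h := Finset.card_eq_sum_card_fiberwise (f := L) (s := Finset.univ) (t := Finset.univ)
    fun _ _ => Finset.mem_coe.mpr (Finset.mem_univ _)
  rw [Finset.card_univ, Fintype.card_fin, Fintype.sum_prod_type] at h
  simp only [Fintype.sum_bool] at h
  simp only [fiberCard_eq_card_filter]
  omega

theorem list_prod_eq_pow_count {G : Type*} [Monoid G] (f : Bool × Bool → G)
    (hf : ∀ c d, Commute (f c) (f d)) (l : List (Bool × Bool)) :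
    (l.map f).prod = f (false, false) ^ l.count (false, false) *
      f (false, true) ^ l.count (false, true) * f (true, false) ^ l.count (true, false) *
        f (true, true) ^ l.count (true, true) := by
  have move : ∀ c d n, f c * f d ^ n = f d ^ n * f c := fun c d n => ((hf c d).pow_right n).eq
  induction l with
  | nil => simp
  | cons c l ih =>
    rw [List.map_cons, List.prod_cons, ih]
    rcases c with ⟨c, d⟩
    cases c <;> cases d
    · simp [pow_succ', mul_assoc]
    · simp only [← mul_assoc, move (false, true) (false, false)]
      simp [pow_succ', mul_assoc]
    · simp only [← mul_assoc, move (true, false) (false, false)]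
      simp only [mul_assoc _ (f (true, false)), move (true, false) (false, true)]
      simp [pow_succ', mul_assoc]
    · simp only [← mul_assoc, move (true, true) (false, false)]
      simp only [mul_assoc _ (f (true, true)), move (true, true) (false, true)]
      simp only [← mul_assoc]
      simp only [mul_assoc _ (f (true, true)), move (true, true) (true, false)]
      simp [pow_succ', mul_assoc]

/-- The pair of spin configurations of a pair of subsets. -/
def pairSpins {k : ℕ} (P : Finset (Fin k) × Finset (Fin k)) : Fin k → Bool × Bool :=
  fun m => (spins P.1 m, spins P.2 m)

/-- The numbers of sites with given pairs of spins. -/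
def pairCount (p q r k : ℕ) : Bool × Bool → ℕ
  | (true, true) => r
  | (true, false) => p - r
  | (false, true) => q - r
  | (false, false) => k + r - (p + q)

theorem spinCount_spins {k : ℕ} (I : Finset (Fin k)) : spinCount (spins I) = I.card := by
  simp [spinCount, spins]

theorem fiberCard_pairSpins {k p q r : ℕ} {P : Finset (Fin k) × Finset (Fin k)}
    (hP : P ∈ pairs p q r k) (c : Bool × Bool) :
    fiberCard (pairSpins P) c = pairCount p q r k c := by
  obtain ⟨h1, h2, h3⟩ := hP
  have e1 := spinCount_fst (pairSpins P)
  have e2 := spinCount_snd (pairSpins P)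
  have e3 := sum_fiberCard (pairSpins P)
  have e4 : fiberCard (pairSpins P) (true, true) = r := by
    rw [fiberCard_eq_card_filter, ← h3]
    congr 1
    ext m
    simp [pairSpins, spins]
  change spinCount (spins P.1) = _ at e1
  change spinCount (spins P.2) = _ at e2
  rw [spinCount_spins] at e1 e2
  rcases c with ⟨c, d⟩
  cases c <;> cases d <;> simp only [pairCount] <;> omega

end Counting

/-! ### Orbits of pairs of spin configurations -/

section Evaluation

open Equiv

variable {ξ : Fin 3 → ℕ} {V : Type*} [AddCommGroup V] [Module ℂ V] [LieRingModule (gl 4) V]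
  [LieModule ℂ (gl 4) V]

/-- The coefficient of a pair of spin configurations. -/
def pairCoeff (t : (a : Fin 3) → Fin (ξ a) → ℂ) (x : ℂ) (Λ : Fin 4 → ℂ)
    (L : Fin (ξ 1) → Bool × Bool) : ℂ :=
  chainCoeff (fun i => t 2 i - (x - Λ 2)) (t 2) (ξ 1) (t 1) (Prod.fst ∘ L) Finset.univ *
    chainCoeff (fun i => t 0 i - (x - Λ 1)) (fun i => -t 0 i) (ξ 1) (fun m => -t 1 m)
      (Prod.snd ∘ L) Finset.univ

/-- Orbit–stabilizer for the simultaneous permutations of two configurations: the four factorials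
are the order of the stabilizer. The right side no longer mentions `P`. -/
theorem coeff_eq_mul_sum (t : (a : Fin 3) → Fin (ξ a) → ℂ)
    (hinj : Function.Injective fun s : (a : Fin 3) × Fin (ξ a) => t s.1 s.2) (x : ℂ)
    (Λ : Fin 4 → ℂ) {p q r : ℕ} (hr : InRange ξ p q r)
    {P : Finset (Fin (ξ 1)) × Finset (Fin (ξ 1))} (hP : P ∈ pairs p q r (ξ 1)) :
    coeff t x Λ P = (((p - r).factorial * (q - r).factorial * r.factorial *
        (ξ 1 + r - (p + q)).factorial : ℕ) : ℂ) *
      ∑ L : Fin (ξ 1) → Bool × Bool with ∀ c, fiberCard L c = pairCount p q r (ξ 1) c,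
        pairCoeff t x Λ L := by
  have hp : P.1.card ≤ ξ 2 := by rw [hP.1]; exact hr.1.trans (min_le_right _ _)
  have hq : P.2.card ≤ ξ 0 := by rw [hP.2.1]; exact hr.2.1.trans (min_le_right _ _)
  rw [coeff_eq_sum t hinj x Λ P hp hq]
  refine (sum_comp_perm (pairSpins P) (pairCoeff t x Λ)).trans ?_
  have hc : ∀ c, Fintype.card {a // pairSpins P a = c} = pairCount p q r (ξ 1) c :=
    fiberCard_pairSpins hP
  congr 1
  · simp only [hc]
    rw [Fintype.prod_prod_type]
    simp only [Fintype.prod_bool, pairCount]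
    congr 1
    ring
  · simp only [hc]
    rfl

theorem act_mul_commute {a b c d : Fin 4} (h1 : b ≠ c) (h2 : a ≠ d) :
    Commute (act V a b) (act V c d) := by
  rw [commute_iff_eq, act_mul_act, if_neg h1, if_neg h2]
  simp

theorem prod_act_apply (L : Fin (ξ 1) → Bool × Bool) (v : V) :
    ((List.finRange (ξ 1)).map fun j => act V (colColor (L j).1) (rowColor (L j).2)).prod
        ((act V 3 2 ^ (ξ 2 - spinCount (Prod.fst ∘ L)))
          ((act V 1 0 ^ (ξ 0 - spinCount (Prod.snd ∘ L))) v)) =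
      basisVector ξ (spinCount (Prod.fst ∘ L)) (spinCount (Prod.snd ∘ L))
        (fiberCard L (true, true)) v := by
  have h := list_prod_eq_pow_count (fun c : Bool × Bool => act V (colColor c.1) (rowColor c.2))
    (fun c d => act_mul_commute (by generalize c.2 = x; generalize d.1 = y; revert x y; decide)
      (by generalize c.1 = x; generalize d.2 = y; revert x y; decide))
    ((List.finRange (ξ 1)).map L)
  rw [List.map_map] at h
  have h1 := spinCount_fst L
  have h2 := spinCount_snd L
  have h3 := sum_fiberCard L
  have hc : Commute (act V 3 2) (act V 1 0) := act_mul_commute (by decide) (by decide)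
  refine (LinearMap.congr_fun h _).trans ?_
  simp only [← fiberCard_eq_count]
  rw [basisVector, ← Module.End.mul_apply (act V 3 2 ^ _), (hc.pow_pow _ _).eq,
    ← Module.End.mul_apply, ← mul_assoc]
  have e1 : fiberCard L (false, false) = ξ 1 + fiberCard L (true, true) -
    (spinCount (Prod.fst ∘ L) + spinCount (Prod.snd ∘ L)) := by omega
  have e2 : fiberCard L (false, true) = spinCount (Prod.snd ∘ L) - fiberCard L (true, true) := by
    omega
  have e3 : fiberCard L (true, false) = spinCount (Prod.fst ∘ L) - fiberCard L (true, true) := by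
    omega
  rw [e1, e2, e3]
  rfl

theorem bethe_apply_eq_sum_pairCoeff (t : (a : Fin 3) → Fin (ξ a) → ℂ)
    (hinj : Function.Injective fun s : Site ξ => t s.1 s.2) (x : ℂ) (hx : ∀ a i, t a i ≠ x) (v : V)
    (Λ : Fin 4 → ℂ) (hv : IsSingularOfWeight v Λ) :
    bethe (evalModule V x) t v = (∏ a : Fin 3, ∏ i : Fin (ξ a), 1 / (t a i - x)) •
      ∑ L : Fin (ξ 1) → Bool × Bool, pairCoeff t x Λ L •
        basisVector ξ (spinCount (Prod.fst ∘ L)) (spinCount (Prod.snd ∘ L))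
          (fiberCard L (true, true)) v := by
  rw [bethe_apply_eq_sum t hinj x hx v Λ hv]
  congr 1
  rw [← Fintype.sum_prod_type', ← (Equiv.arrowProdEquivProdArrow (Fin (ξ 1)) (fun _ => Bool)
    (fun _ => Bool)).sum_comp]
  refine Finset.sum_congr rfl fun L _ => ?_
  rw [← prod_act_apply]
  rfl

theorem fiberCard_eq_pairCount_iff (L : Fin (ξ 1) → Bool × Bool) {p q r : ℕ} (hp : r ≤ p)
    (hq : r ≤ q) (h : p + q ≤ ξ 1 + r) :
    (∀ c, fiberCard L c = pairCount p q r (ξ 1) c) ↔ spinCount (Prod.fst ∘ L) = p ∧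
      spinCount (Prod.snd ∘ L) = q ∧ fiberCard L (true, true) = r := by
  have h1 := spinCount_fst L
  have h2 := spinCount_snd L
  have h3 := sum_fiberCard L
  refine ⟨fun hc => ?_, fun hc c => ?_⟩
  · have a1 := hc (true, true)
    have a2 := hc (true, false)
    have a3 := hc (false, true)
    simp only [pairCount] at a1 a2 a3
    omega
  · rcases c with ⟨c, d⟩
    cases c <;> cases d <;> simp only [pairCount] <;> omega

end Evaluation

end GL4Weight

end

/-! ### Comparison of the two sides -/

open GL4Weight
theorem theorem5p4 {V : Type*} [AddCommGroup V] [Module ℂ V] [LieRingModule (gl 4) V]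
    [LieModule ℂ (gl 4) V] (v : V) (Λ : Fin 4 → ℂ) (hv : IsSingularOfWeight v Λ) (x : ℂ)
    (ξ : Fin 3 → ℕ) (t : (a : Fin 3) → Fin (ξ a) → ℂ)
    (hinj : Function.Injective fun s : (a : Fin 3) × Fin (ξ a) => t s.1 s.2)
    (hx : ∀ a i, t a i ≠ x) :
    (∀ P : ℕ → ℕ → ℕ → Finset (Fin (ξ 1)) × Finset (Fin (ξ 1)),
      (∀ p q r, InRange ξ p q r → P p q r ∈ pairs p q r (ξ 1)) →
      bethe (evalModule V x) t v =
        (∏ a : Fin 3, ∏ i : Fin (ξ a), 1 / (t a i - x)) •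
          ∑ p ∈ Finset.range (min (ξ 1) (ξ 2) + 1), ∑ q ∈ Finset.range (min (ξ 1) (ξ 0) + 1),
            ∑ r ∈ Finset.Icc (p + q - ξ 1) (min p q),
              (coeff t x Λ (P p q r) /
                (((p - r).factorial * (q - r).factorial * r.factorial *
                  (ξ 1 + r - (p + q)).factorial : ℕ) : ℂ)) • basisVector ξ p q r v) ∧
    (∀ p q r, InRange ξ p q r → ∀ P ∈ pairs p q r (ξ 1), ∀ P' ∈ pairs p q r (ξ 1),
      coeff t x Λ P = coeff t x Λ P') := by
  refine ⟨fun P hP => ?_, fun p q r hr P hP P' hP' => ?_⟩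
  · rw [bethe_apply_eq_sum_pairCoeff t hinj x hx v Λ hv]
    congr 1
    -- Every configuration pair contributes to the single triple given by its own counts, and pairs
    -- with too many spins up have coefficient zero. Truncated subtraction in the lower bound of `r`
    -- supplies the maximum with 0.
    have expand : ∀ L : Fin (ξ 1) → Bool × Bool, pairCoeff t x Λ L •
        basisVector ξ (spinCount (Prod.fst ∘ L)) (spinCount (Prod.snd ∘ L))
          (fiberCard L (true, true)) v =
        ∑ p ∈ Finset.range (min (ξ 1) (ξ 2) + 1), ∑ q ∈ Finset.range (min (ξ 1) (ξ 0) + 1),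
          ∑ r ∈ Finset.Icc (p + q - ξ 1) (min p q),
            if spinCount (Prod.fst ∘ L) = p ∧ spinCount (Prod.snd ∘ L) = q ∧
              fiberCard L (true, true) = r then pairCoeff t x Λ L • basisVector ξ p q r v
            else 0 := by
      intro L
      have h1 := spinCount_fst L
      have h2 := spinCount_snd L
      have h3 := sum_fiberCard L
      have z1 : ξ 2 < spinCount (Prod.fst ∘ L) → pairCoeff t x Λ L = 0 := fun h => by
        rw [pairCoeff, chainCoeff_eq_zero, zero_mul]
        simpa using h
      have z2 : ξ 0 < spinCount (Prod.snd ∘ L) → pairCoeff t x Λ L = 0 := fun h => by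
        rw [pairCoeff, chainCoeff_eq_zero _ _ _ (Prod.snd ∘ L), mul_zero]
        simpa using h
      by_cases h0 : pairCoeff t x Λ L = 0
      · simp [h0]
      have b1 : spinCount (Prod.fst ∘ L) ≤ ξ 2 := not_lt.mp fun h => h0 (z1 h)
      have b2 : spinCount (Prod.snd ∘ L) ≤ ξ 0 := not_lt.mp fun h => h0 (z2 h)
      rw [Finset.sum_eq_single (spinCount (Prod.fst ∘ L)),
        Finset.sum_eq_single (spinCount (Prod.snd ∘ L)),
        Finset.sum_eq_single (fiberCard L (true, true)), if_pos ⟨rfl, rfl, rfl⟩]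
      · exact fun r _ hr => if_neg fun h => hr h.2.2.symm
      · intro h
        rw [Finset.mem_Icc] at h
        omega
      · exact fun q _ hq => Finset.sum_eq_zero fun r _ => if_neg fun h => hq h.2.1.symm
      · intro h
        rw [Finset.mem_range] at h
        omega
      · exact fun p _ hp => Finset.sum_eq_zero fun q _ => Finset.sum_eq_zero fun r _ =>
          if_neg fun h => hp h.1.symm
      · intro h
        rw [Finset.mem_range] at h
        omega
    rw [Finset.sum_congr rfl fun L _ => expand L, Finset.sum_comm]
    refine Finset.sum_congr rfl fun p hp => ?_
    rw [Finset.sum_comm]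
    refine Finset.sum_congr rfl fun q hq => ?_
    rw [Finset.sum_comm]
    refine Finset.sum_congr rfl fun r hr => ?_
    rw [Finset.mem_range] at hp hq
    rw [Finset.mem_Icc] at hr
    have hrange : InRange ξ p q r := ⟨by omega, by omega, by omega, by omega⟩
    -- The denominator is exactly the order of the stabilizer, so division leaves the plain sum over
    -- the orbit.
    rw [coeff_eq_mul_sum t hinj x Λ hrange (hP p q r hrange), mul_div_cancel_left₀, Finset.sum_smul,
      Finset.sum_filter]
    · refine Finset.sum_congr rfl fun L _ => ?_
      simp only [fiberCard_eq_pairCount_iff L (show r ≤ p by omega) (show r ≤ q by omega)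
        (show p + q ≤ ξ 1 + r by omega)]
    · exact_mod_cast Nat.pos_iff_ne_zero.mp (by positivity)
  · rw [coeff_eq_mul_sum t hinj x Λ hr hP, coeff_eq_mul_sum t hinj x Λ hr hP']
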